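/- **Theorem (small-deformation limit of the constitutive model).** *Notation.* All tensors are real $3\times3$ matrices with the Frobenius norm $|A|^2=\mathrm{tr}(A^\top A)$ and $A{:}B=A_{ij}B_{ij}$; $\mathbb R^{3\times3}_{\rm dev}$ is the space of symmetric trace-free matrices, $\mathrm{GL}^+=\{\det F>0\}$, $\mathrm{SL}=\{\det P=1\}$, $\mathrm{SO}$ is the rotation group and $\mathrm{SL}^+_{\rm sym}$ the set of symmetric positive-definite matrices of determinant one. For a 4-tensor, $(\mathbb C A)_{ij}=\mathbb C_{ij\ell k}A_{\ell k}$ and $|A|^2_{\mathbb C}=A{:}\mathbb CA$. *Energetic solutions.* Given $E:\mathcal Z\times[0,T]\to(-\infty,\infty]$ and $D:\mathcal Z\times\mathcal Z\to[0,\infty]$, let $\mathcal S(t)=\{z: E(z,t)<\infty,\ E(z,t)\le E(\hat z,t)+D(z,\hat z)\ \forall \hat z\in\mathcal Z\}$ and $\mathrm{Diss}_{D,[0,t]}(z)=\sup\sum_{i=1}^N D(z(t_{i-1}),z(t_i))$, the supremum being over all partitions $0=t_0\le\dots\le t_N=t$. A map $z:[0,T]\to\mathcal Z$ is an energetic solution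 for $(\mathcal Z,E,D)$ starting from $z_0$ if $z(0)=z_0$ and, for all $t\in[0,T]$, $z(t)\in\mathcal S(t)$ and $E(z(t),t)+\mathrm{Diss}_{D,[0,t]}(z)=E(z(0),0)+\int_0^t\partial_\tau E(z(\tau),\tau)\,d\tau$, where the power $\partial_\tau E(z(\tau),\tau)$ exists and is integrable. *Finite plasticity.* Let $T,r>0$. Let $W_{\rm e}:\mathrm{GL}^+\to[0,\infty)$ be $C^1$, twice differentiable at $I$, with $W_{\rm e}(RF)=W_{\rm e}(F)=W_{\rm e}(FR)$ for all $R\in\mathrm{SO}$, and let $W_{\rm p}:\mathrm{SL}\to[0,\infty]$ satisfy $W_{\rm p}(QP)=W_{\rm p}(P)$ for all $Q\in\mathrm{SO}$. Put $\widehat W_{\rm e}(C)=W_{\rm e}(C^{1/2})$, $\widehat W_{\rm p}(C)=W_{\rm p}(C^{1/2})$, and let $\widetilde R(A)=\frac r2|A|$ if $\mathrm{tr}A=0$, $\widetilde R(A)=\infty$ otherwise, and $$D(C_0,C_1)=\inf\Big\{\int_0^1\widetilde R\big(c^{-1/2}\dot c\,c^{-1/2}\big)dt:\ c\in C^1([0,1];\mathrm{SL}^+_{\rm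 sym}),\ c(0)=C_0,\ c(1)=C_1\Big\}.$$ Let $e\in C^1([0,T];\mathbb R^{3\times3}_{\rm sym})$. For small $\varepsilon>0$ and $z,\hat z\in\mathbb R^{3\times3}_{\rm dev}$ (so that $z=\frac1{2\varepsilon}\log C_{\rm p}$ with $C_{\rm p}=\exp(2\varepsilon z)$) set $$E_\varepsilon(z,t)=\tfrac1{\varepsilon^2}\widehat W_{\rm e}\big(\exp(-\varepsilon z)(I+2\varepsilon e(t))\exp(-\varepsilon z)\big)+\tfrac1{\varepsilon^2}\widehat W_{\rm p}(\exp(2\varepsilon z)),\qquad D_\varepsilon(z,\hat z)=\tfrac1{2\varepsilon}D\big(\exp(2\varepsilon z),\exp(2\varepsilon\hat z)\big).$$ Write $\mathcal S_\varepsilon(t)$ for the corresponding stable states; a finite-plasticity trajectory is an energetic solution for $(\mathbb R^{3\times3}_{\rm dev},E_\varepsilon,D_\varepsilon)$. *Linearized plasticity.* Let $\mathbb C,\mathbb H$ be symmetric 4-tensors and set $E_0(z,t)=\frac12|e(t)-z|_{\mathbb C}^2+\frac12|z|^2_{\mathbb H}$, $D_0(z,\hat z)=\widetilde R(\hat z-z)=\frac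 r2|\hat z-z|$. *Assumptions.* (i) There is $c_3>0$ with $\widehat W_{\rm p}(\exp(2A))\ge c_3|A|^2$ for all $A\in\mathbb R^{3\times3}_{\rm dev}$. (ii) For every $\delta>0$ there is $c_\delta>0$ such that $|\widehat W_{\rm e}(I+2A)-\frac12|A|^2_{\mathbb C}|\le\delta|A|^2$ for all symmetric $A$ with $|A|\le c_\delta$, and $|\widehat W_{\rm p}(\exp(2A))-\frac12|A|^2_{\mathbb H}|\le\delta|A|^2$ for all $A\in\mathbb R^{3\times3}_{\rm dev}$ with $|A|\le c_\delta$. (iii) $z_\varepsilon$ are finite-plasticity trajectories starting from $z_{0\varepsilon}\in\mathcal S_\varepsilon(0)$, where $z_{0\varepsilon}\to z_0\in\mathbb R^{3\times3}_{\rm dev}$ and $E_\varepsilon(z_{0\varepsilon},0)\to E_0(z_0,0)$ as $\varepsilon\to0^+$ (along a continuous family or a sequence of parameters). *Conclusion.* There is exactly one energetic solution $z$ for $(\mathbb R^{3\times3}_{\rm dev},E_0,D_0)$ starting from $z_0$. It is Lipschitz continuous and a strong solution of linearized plasticity with linear kinematic hardening, $$\tfrac r2\,\partial|\dot z|+(\mathbb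 C+\mathbb H)z\ni\mathbb C e(t)\quad\text{in }\mathbb R^{3\times3}_{\rm dev}\text{ for a.e. }t\in(0,T),\qquad z(0)=z_0$$ (the inclusion being tested with deviatoric tensors). Moreover, for all $t\in[0,T]$, as $\varepsilon\to0$, $$z_\varepsilon(t)\to z(t),\qquad \mathrm{Diss}_{D_\varepsilon,[0,t]}(z_\varepsilon)\to\mathrm{Diss}_{D_0,[0,t]}(z),\qquad E_\varepsilon(z_\varepsilon(t),t)\to E_0(z(t),t).$$ -/

import Mathlib

open Filter Topology MeasureTheory Set
open scoped ENNReal NNReal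

/- Throughout, matrices carry the Frobenius norm `‖A‖² = tr (Aᵀ A)`. -/
attribute [local instance] Matrix.frobeniusNormedAddCommGroup Matrix.frobeniusNormedSpace

namespace Plasticity

noncomputable section

/-! ### Tensors -/

/-- 2-tensors in `ℝ³`. -/
abbrev Mat : Type := Matrix (Fin 3) (Fin 3) ℝ

/-- The linear space of symmetric trace-free (deviatoric) tensors. -/
def Dev : Submodule ℝ Mat where
  carrier := {A | A.IsSymm ∧ A.trace = 0}
  add_mem' := by
    rintro A B ⟨hA, hA'⟩ ⟨hB, hB'⟩
    exact ⟨hA.add hB, by rw [Matrix.trace_add, hA', hB', add_zero]⟩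
  zero_mem' := ⟨Matrix.isSymm_zero, Matrix.trace_zero _ _⟩
  smul_mem' := by
    rintro c A ⟨hA, hA'⟩
    exact ⟨hA.smul c, by rw [Matrix.trace_smul, hA', smul_zero]⟩

/-- Matrices with positive determinant. -/
def GLPos : Set Mat := {F | 0 < F.det}

/-- Matrices with determinant one. -/
def SL : Set Mat := {P | P.det = 1}

/-- Rotations. -/
def SO : Set Mat := {Q | Q.transpose * Q = 1 ∧ Q.det = 1}

/-- Symmetric positive-definite matrices with determinant one. -/
def SLSymPos : Set Mat := {C | C.PosDef ∧ C.det = 1}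

/-- The square root `C^{1/2}` of a symmetric positive-definite matrix (spectral calculus). -/
def sqrtM (C : Mat) : Mat := cfc Real.sqrt C

/-- The contraction product `A : B`. -/
def contr (A B : Mat) : ℝ := ∑ i, ∑ j, A i j * B i j

/-- 4-tensors in `ℝ³`. -/
abbrev Tensor4 : Type := Fin 3 → Fin 3 → Fin 3 → Fin 3 → ℝ

/-- The product `(ℂ A)_{ij} = ℂ_{ijlk} A_{lk}`. -/
def Tensor4.app (K : Tensor4) (A : Mat) : Mat :=
  Matrix.of fun i j => ∑ l, ∑ k, K i j l k * A l k

/-- (Major) symmetry of a 4-tensor. -/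
def Tensor4.IsSymm (K : Tensor4) : Prop := ∀ i j l k, K i j l k = K l k i j

/-- The quadratic form `|A|²_ℂ = A : ℂ A`. -/
def Tensor4.quad (K : Tensor4) (A : Mat) : ℝ := contr A (K.app A)

/-! ### Energetic solutions of rate-independent systems -/

section Energetic

variable {Z : Type*}

/-- Globally stable states at time `t`. -/
def stableStates (E : Z → ℝ → EReal) (D : Z → Z → ℝ≥0∞) (t : ℝ) : Set Z :=
  {q | E q t < ⊤ ∧ ∀ q' : Z, E q t ≤ E q' t + (D q q' : EReal)}

/-- Total dissipation on `[0,t]`: supremum over all partitions `0 = u₀ ≤ … ≤ u_N = t`. -/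
def diss (D : Z → Z → ℝ≥0∞) (t : ℝ) (q : ℝ → Z) : ℝ≥0∞ :=
  ⨆ (N : ℕ) (u : ℕ → ℝ) (_ : Monotone u ∧ u 0 = 0 ∧ u N = t),
    ∑ i ∈ Finset.range N, D (q (u i)) (q (u (i + 1)))

/-- The partial time derivative `∂_t E(q,t)` on the time interval `[0,T]`. -/
def power (T : ℝ) (E : Z → ℝ → EReal) (q : Z) (t : ℝ) : ℝ :=
  derivWithin (fun s => (E q s).toReal) (Icc 0 T) t

/-- Energetic solutions on `[0,T]` starting from `q₀`: global stability and energy balance.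
The power along the trajectory is required to exist and to be integrable, so that the
right-hand side of the energy balance is meaningful. -/
structure IsEnergeticSolution (T : ℝ) (E : Z → ℝ → EReal) (D : Z → Z → ℝ≥0∞)
    (q₀ : Z) (q : ℝ → Z) : Prop where
  init : q 0 = q₀
  stable : ∀ t ∈ Icc 0 T, q t ∈ stableStates E D t
  power_exists : ∀ t ∈ Icc 0 T,
    DifferentiableWithinAt ℝ (fun s => (E (q t) s).toReal) (Icc 0 T) t
  power_integrable : IntervalIntegrable (fun t => power T E (q t) t) volume 0 T
  balance : ∀ t ∈ Icc 0 T,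
    E (q t) t + (diss D t q : EReal)
      = E (q 0) 0 + ((∫ s in (0 : ℝ)..t, power T E (q s) s : ℝ) : EReal)

end Energetic

/-! ### The finite-plasticity constitutive model -/

/-- `Ŵₑ(Cₑ) = Wₑ(Cₑ^{1/2})`. -/
def hatWe (We : Mat → ℝ) (C : Mat) : ℝ := We (sqrtM C)

/-- `Ŵₚ(Cₚ) = Wₚ(Cₚ^{1/2})`. -/
def hatWp (Wp : Mat → ℝ≥0∞) (C : Mat) : ℝ≥0∞ := Wp (sqrtM C)

/-- `Ŵ(C,Cₚ) = Ŵₑ(Cₚ^{-1/2} C Cₚ^{-1/2}) + Ŵₚ(Cₚ)`. -/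
def hatW (We : Mat → ℝ) (Wp : Mat → ℝ≥0∞) (C Cp : Mat) : ℝ≥0∞ :=
  ENNReal.ofReal (hatWe We ((sqrtM Cp)⁻¹ * C * (sqrtM Cp)⁻¹)) + hatWp Wp Cp

/-- `R̃(A) = (r/2)|A|` on trace-free tensors, `∞` otherwise. -/
def tildeR (r : ℝ) (A : Mat) : ℝ≥0∞ :=
  if A.trace = 0 then ENNReal.ofReal (r / 2 * ‖A‖) else ⊤

/-- Infinitesimal dissipation `R̂(Cₚ,Ċₚ) = R̃(Cₚ^{-1/2} Ċₚ Cₚ^{-1/2})`. -/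
def hatR (r : ℝ) (C V : Mat) : ℝ≥0∞ := tildeR r ((sqrtM C)⁻¹ * V * (sqrtM C)⁻¹)

/-- Dissipation metric: infimum of `∫₀¹ R̂(c, ċ) dt` over `C¹` curves `c` in the symmetric
positive-definite unimodular matrices that connect `C₀` to `C₁`. -/
def dissMetric (r : ℝ) (C₀ C₁ : Mat) : ℝ≥0∞ :=
  ⨅ (c : ℝ → Mat) (_ : ContDiffOn ℝ 1 c (Icc 0 1) ∧ (∀ t ∈ Icc (0 : ℝ) 1, c t ∈ SLSymPos) ∧
      c 0 = C₀ ∧ c 1 = C₁),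
    ∫⁻ t in Icc (0 : ℝ) 1, hatR r (c t) (derivWithin c (Icc 0 1) t)

/-! ### Rescaled functionals, with `C = I + 2εe` and `Cₚ = exp(2εz)` -/

/-- `W_ε(e,z) = ε⁻² Ŵ(I + 2εe, exp(2εz))`. -/
def Weps (We : Mat → ℝ) (Wp : Mat → ℝ≥0∞) (ε : ℝ) (e z : Mat) : ℝ≥0∞ :=
  ENNReal.ofReal (1 / ε ^ 2) *
    hatW We Wp (1 + (2 * ε) • e) (NormedSpace.exp ((2 * ε) • z))

/-- `E_ε(z,t) = W_ε(e(t),z)`. -/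
def Eeps (We : Mat → ℝ) (Wp : Mat → ℝ≥0∞) (e : ℝ → Mat) (ε : ℝ) (z : Dev) (t : ℝ) : EReal :=
  (Weps We Wp ε (e t) (z : Mat) : EReal)

/-- `D_ε(z₁,z₂) = (2ε)⁻¹ D(exp(2εz₁), exp(2εz₂))`. -/
def Deps (r ε : ℝ) (z₁ z₂ : Dev) : ℝ≥0∞ :=
  ENNReal.ofReal (1 / (2 * ε)) *
    dissMetric r (NormedSpace.exp ((2 * ε) • (z₁ : Mat))) (NormedSpace.exp ((2 * ε) • (z₂ : Mat)))

/-! ### Linearized plasticity with linear kinematic hardening -/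

/-- `W₀(e,z) = ½|e - z|²_ℂ + ½|z|²_ℍ`. -/
def W0 (CC HH : Tensor4) (e z : Mat) : ℝ := 1 / 2 * CC.quad (e - z) + 1 / 2 * HH.quad z

/-- `E₀(z,t) = W₀(e(t),z)`. -/
def E0 (CC HH : Tensor4) (e : ℝ → Mat) (z : Dev) (t : ℝ) : EReal :=
  (W0 CC HH (e t) (z : Mat) : EReal)

/-- `D₀(z₁,z₂) = R̃(z₂ - z₁)`, that is `(r/2)|z₂ - z₁|`. -/
def D0 (r : ℝ) (z₁ z₂ : Dev) : ℝ≥0∞ := tildeR r ((z₂ : Mat) - (z₁ : Mat))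

/-- Strong solutions of `(r/2) ∂|ż| + (ℂ+ℍ) z ∋ ℂ e(t)`, `z(0) = z₀`, in the space of
deviatoric tensors: Lipschitz trajectories satisfying the inclusion almost everywhere. -/
structure IsStrongSolution (T r : ℝ) (CC HH : Tensor4) (e : ℝ → Mat) (z₀ : Dev)
    (z : ℝ → Dev) : Prop where
  init : z 0 = z₀
  lipschitz : ∃ K : ℝ≥0, LipschitzOnWith K z (Icc 0 T)
  inclusion : ∀ᵐ t ∂(volume.restrict (Icc 0 T)), ∃ v : Dev, HasDerivAt z v t ∧
    ∀ w : Dev,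
      contr (CC.app (e t) - (CC.app (z t : Mat) + HH.app (z t : Mat))) ((w : Mat) - (v : Mat))
        ≤ r / 2 * ‖(w : Mat)‖ - r / 2 * ‖(v : Mat)‖

end

end Plasticity

/-! On deviatoric tensors the limit system is quadratic: its energy is `½ a z z - ℓ t z + c t` with
`a = ℂ + ℍ` and `ℓ = ℂ e`, and its dissipation distance is `κ ‖w - v‖` with `κ = r/2`. The
trajectories of finite plasticity are compared directly with the solution `z` of the limit problem,
which gives an estimate of `½ a (w - z) (w - z)` uniform in time.

The comparison (`IsQuasistatic.comparison`) needs no time derivative of `w`, which may jump. On a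
short interval, the stability of `z` is tested with the increment of `w` and the approximate
stability of `w` with the increment of `z`; together with the energy balance of `w` and the flow
inequality of `z`, all first-order terms cancel except small multiples of the time step. Summation
over fine partitions removes the higher-order rest (`sub_le_of_increment_le`). The reference
trajectory comes from the implicit Euler scheme (`exists_isQuasistatic`), and
`IsQuasistatic.balance` turns its flow inequality into the energy balance.

What finite plasticity has to provide is collected in `IsApproximation`: uniform coercivity, and
closeness of energies, powers and dissipation distances on bounded sets. Energies and powers are
controlled by a second-order expansion at the identity, where the elastic stress vanishes because
the energy is minimal (`exists_hatWe_expansion`). The dissipation distance is bounded above by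
exponentials of segments, and below by a logarithmic length estimate valid for every competing curve
(`le_dissMetric`).

Coercivity and comparison with the zero state bound all stable states a priori, so closeness on one
ball suffices. Since the limit system approximates itself, the same estimate yields uniqueness. Once
states and powers converge, energies converge by uniform approximation, and dissipations because
every other term of the energy balance does (`IsQuadraticSystem.convergence`). -/

namespace Plasticity

/-! ### Rate-independent evolution of quadratic energies on a normed space -/

section Quadratic

/-- An interval function that is subordinate to a linear bound up to errors of higher order
is bounded by the linear part alone. -/
theorem sub_le_of_increment_le {f g : ℝ → ℝ} {A B C t : ℝ} (ht : 0 ≤ t)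
    (h : ∀ s s', 0 ≤ s → s ≤ s' → s' ≤ t →
      f s' - f s ≤ A * (s' - s) + B * (g s' - g s) * (s' - s) + C * (s' - s) ^ 2) :
    f t - f 0 ≤ A * t := by
  -- On the uniform partition into `N + 1` intervals the increments of `f` and `g` telescope; equal
  -- steps make this work without any sign or monotonicity condition on `B` and `g`.
  have key : ∀ N : ℕ, f t - f 0 ≤ A * t + (B * (g t - g 0) * t + C * t ^ 2) / (N + 1) := by
    intro N
    have hN : (0 : ℝ) < N + 1 := by positivity
    set u : ℕ → ℝ := fun i => i * (t / (N + 1)) with hu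
    have hstep : 0 ≤ t / (N + 1) := by positivity
    have hdiff : ∀ i, u (i + 1) - u i = t / (N + 1) := by
      intro i; simp only [hu]; push_cast; ring
    have huN : u (N + 1) = t := by simp only [hu]; push_cast; field_simp
    have hu0 : u 0 = 0 := by simp [hu]
    have hmono : Monotone u := by
      apply monotone_nat_of_le_succ; intro i; linarith [hdiff i]
    have hsum : ∑ i ∈ Finset.range (N + 1), (f (u (i + 1)) - f (u i)) ≤
        ∑ i ∈ Finset.range (N + 1), (A * (t / (N + 1)) +
          B * (t / (N + 1)) * (g (u (i + 1)) - g (u i)) + C * (t / (N + 1)) ^ 2) := by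
      apply Finset.sum_le_sum
      intro i hi
      have := h (u i) (u (i + 1)) (hu0 ▸ hmono (Nat.zero_le i)) (hmono (Nat.le_succ i))
        (huN ▸ hmono (Finset.mem_range.1 hi))
      rw [hdiff] at this
      linarith
    rw [Finset.sum_range_sub (fun i => f (u i)), Finset.sum_add_distrib, Finset.sum_add_distrib,
      ← Finset.mul_sum (f := fun i => g (u (i + 1)) - g (u i)),
      Finset.sum_range_sub (fun i => g (u i)), huN, hu0] at hsum
    simp only [Finset.sum_const, Finset.card_range, nsmul_eq_mul] at hsum
    push_cast at hsum
    calc f t - f 0 ≤ _ := hsum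
      _ = _ := by field_simp; ring
  have hlim : Tendsto (fun N : ℕ => A * t + (B * (g t - g 0) * t + C * t ^ 2) / ((N : ℝ) + 1)) atTop
      (𝓝 (A * t + 0)) :=
    tendsto_const_nhds.add
      (tendsto_const_nhds.div_atTop (tendsto_atTop_add_const_right _ _ tendsto_natCast_atTop_atTop))
  rw [add_zero] at hlim
  exact ge_of_tendsto' hlim key

/-- Dividing by `x` and letting `x → 0` extracts the first variation at a minimizer. -/
theorem nonneg_of_forall_small {A B : ℝ} (h : ∀ x : ℝ, 0 < x → x ≤ 1 → 0 ≤ x * A + x ^ 2 * B) :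
    0 ≤ A := by
  have hlim : Tendsto (fun x : ℝ => A + x * B) (𝓝[>] 0) (𝓝 (A + 0 * B)) :=
    (Continuous.tendsto (by fun_prop) 0).mono_left nhdsWithin_le_nhds
  rw [zero_mul, add_zero] at hlim
  refine ge_of_tendsto hlim ?_
  filter_upwards [Ioc_mem_nhdsGT (zero_lt_one' ℝ)] with x hx
  have := h x hx.1 hx.2
  have h2 : x * A + x ^ 2 * B = x * (A + x * B) := by ring
  rw [h2] at this
  exact nonneg_of_mul_nonneg_right this hx.1

variable {V : Type*} [NormedAddCommGroup V] [NormedSpace ℝ V]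

/-- Trajectories of the quasistatic evolution driven by the quadratic energy
`½ a z z - ℓ t z` and the dissipation potential `κ ‖·‖`, in derivative-free form. -/
structure IsQuasistatic (a : V →L[ℝ] V →L[ℝ] ℝ) (ℓ : ℝ → V →L[ℝ] ℝ) (κ T L C : ℝ)
    (z : ℝ → V) : Prop where
  lipschitz : ∀ s s', 0 ≤ s → s ≤ s' → s' ≤ T → ‖z s' - z s‖ ≤ L * (s' - s)
  stable : ∀ s, 0 ≤ s → s ≤ T → ∀ v, ℓ s v - a (z s) v ≤ κ * ‖v‖
  flow : ∀ s s', 0 ≤ s → s ≤ s' → s' ≤ T →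
    κ * ‖z s' - z s‖ ≤ ℓ s (z s' - z s) - a (z s) (z s' - z s) + C * (s' - s) ^ 2

/-- Comparison of a quasistatic trajectory `z` with an approximately stable trajectory `w`
that satisfies an approximate upper energy estimate. -/
theorem IsQuasistatic.comparison {a : V →L[ℝ] V →L[ℝ] ℝ} (ha : ∀ u v, a u v = a v u)
    {ℓ : ℝ → V →L[ℝ] ℝ} {κ T L C : ℝ} {z : ℝ → V} (hz : IsQuasistatic a ℓ κ T L C z)
    {w : ℝ → V} {g G c : ℝ → ℝ} {B η t : ℝ} (hη : 0 ≤ η) (ht : 0 ≤ t) (htT : t ≤ T)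
    (hst : ∀ s, 0 ≤ s → s ≤ t → ∀ v, ℓ s v - a (w s) v ≤ (κ + η) * ‖v‖)
    (hg : ∀ s s', 0 ≤ s → s ≤ s' → s' ≤ t → κ * ‖w s' - w s‖ ≤ g s' - g s)
    (hG : ∀ s s', 0 ≤ s → s ≤ s' → s' ≤ t →
      G s' - G s ≤ (c s' - ℓ s' (w s)) - (c s - ℓ s (w s)) + (η + B * (g s' - g s)) * (s' - s))
    (hE : 1 / 2 * a (w t) (w t) - ℓ t (w t) + c t + (g t - g 0)
      ≤ 1 / 2 * a (w 0) (w 0) - ℓ 0 (w 0) + c 0 + (G t - G 0) + η) :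
    1 / 2 * a (w t - z t) (w t - z t)
      ≤ 1 / 2 * a (w 0 - z 0) (w 0 - z 0) + η + (η + η * L) * t := by
  -- This `f` is `½ a (w - z) (w - z)` after `½ a w w` has been replaced by means of the upper
  -- energy estimate `hE`.
  have key := sub_le_of_increment_le (f := fun s => -g s + G s + (ℓ s (w s) - a (z s) (w s)) - c s
    + 1 / 2 * a (z s) (z s)) (g := g) (A := η + η * L) (B := B) (C := C + 1 / 2 * ‖a‖ * L ^ 2) ht ?_
  · simp only [map_sub, sub_apply] at *
    rw [ha (w t) (z t), ha (w 0) (z 0)]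
    linarith
  intro s s' h0 hss' h't
  -- `e1` and `e2` absorb the increment of `w` into that of `g`; `e4` and `e5` bound the cross term
  -- `a (z s - w s) (z s' - z s)` by `η ‖z s' - z s‖` up to second order.
  have e1 := hz.stable s' (by linarith) (by linarith) (w s' - w s)
  have e2 := hg s s' h0 hss' h't
  have e3 := hG s s' h0 hss' h't
  have e4 := hz.flow s s' h0 hss' (by linarith)
  have e5 := hst s h0 (by linarith) (z s' - z s)
  have e6 := hz.lipschitz s s' h0 hss' (by linarith)
  have e7 : a (z s' - z s) (z s' - z s) ≤ ‖a‖ * (L * (s' - s)) ^ 2 := by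
    calc a (z s' - z s) (z s' - z s) ≤ ‖a (z s' - z s) (z s' - z s)‖ := Real.le_norm_self _
      _ ≤ ‖a‖ * ‖z s' - z s‖ * ‖z s' - z s‖ := a.le_opNorm₂ _ _
      _ = ‖a‖ * ‖z s' - z s‖ ^ 2 := by ring
      _ ≤ _ := by gcongr
  have e8 : η * ‖z s' - z s‖ ≤ η * (L * (s' - s)) := by gcongr
  simp only [map_sub, sub_apply] at *
  rw [ha (z s') (z s)] at *
  rw [ha (w s) (z s'), ha (w s) (z s)] at *
  nlinarith

/-- Solvability of one step of the implicit Euler scheme. -/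
theorem exists_incremental_solution [FiniteDimensional ℝ V] {a : V →L[ℝ] V →L[ℝ] ℝ}
    (ha : ∀ u v, a u v = a v u) {α κ : ℝ} (hα : 0 < α) (hcoer : ∀ v, α * ‖v‖ ^ 2 ≤ a v v)
    (hκ : 0 ≤ κ) (f : V →L[ℝ] ℝ) (z : V) :
    ∃ y, (∀ v, f v - a y v ≤ κ * ‖v‖) ∧ κ * ‖y - z‖ ≤ f (y - z) - a y (y - z) := by
  -- `y` minimizes the incremental functional. Perturbing to `y + x • v` gives stability by the
  -- triangle inequality; retreating towards `z`, to `y - x • (y - z)`, gives the flow inequality.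
  obtain ⟨y, hy⟩ : ∃ y, ∀ x, 1 / 2 * a y y - f y + κ * ‖y - z‖
      ≤ 1 / 2 * a x x - f x + κ * ‖x - z‖ := by
    have hcont : Continuous fun x => 1 / 2 * a x x - f x + κ * ‖x - z‖ := by fun_prop
    refine hcont.exists_forall_le ?_
    have h1 : Tendsto (fun x : V => ‖x‖ * (α / 2 * ‖x‖ - ‖f‖)) (cocompact V) atTop := by
      have hn := tendsto_norm_cocompact_atTop (E := V)
      refine hn.atTop_mul_atTop₀ ?_
      exact tendsto_atTop_add_const_right _ _ (hn.const_mul_atTop (by positivity))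
    refine tendsto_atTop_mono (fun x => ?_) h1
    have h2 := hcoer x
    have h3 := (Real.le_norm_self _).trans (f.le_opNorm x)
    have h4 : 0 ≤ κ * ‖x - z‖ := by positivity
    nlinarith
  refine ⟨y, fun v => ?_, ?_⟩
  · rw [← sub_nonneg]
    refine nonneg_of_forall_small (B := 1 / 2 * a v v) fun x hx _ => ?_
    have h1 := hy (y + x • v)
    have h2 : ‖y + x • v - z‖ ≤ ‖y - z‖ + x * ‖v‖ := by
      calc ‖y + x • v - z‖ = ‖(y - z) + x • v‖ := by congr 1; abel
        _ ≤ _ := (norm_add_le _ _).trans (by rw [norm_smul, Real.norm_of_nonneg hx.le])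
    have h3 := mul_le_mul_of_nonneg_left h2 hκ
    simp only [map_add, map_smul, add_apply, smul_apply,
      smul_eq_mul, ha v y] at h1
    nlinarith
  · rw [← sub_nonneg]
    refine nonneg_of_forall_small (B := 1 / 2 * a (y - z) (y - z)) fun x hx hx1 => ?_
    have h1 := hy (y - x • (y - z))
    have h2 : ‖y - x • (y - z) - z‖ = (1 - x) * ‖y - z‖ := by
      have : y - x • (y - z) - z = (1 - x) • (y - z) := by rw [sub_smul, one_smul]; abel
      rw [this, norm_smul, Real.norm_of_nonneg (by linarith)]
    rw [h2] at h1
    generalize y - z = d at *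
    simp only [map_sub, map_smul, sub_apply, smul_apply,
      smul_eq_mul, ha d y] at h1
    nlinarith

/-- Estimates for the implicit Euler scheme. -/
theorem euler_estimates {a : V →L[ℝ] V →L[ℝ] ℝ} {α κ Λ τ : ℝ} (hα : 0 < α)
    (hcoer : ∀ v, α * ‖v‖ ^ 2 ≤ a v v) (hκ : 0 ≤ κ) (hτ : 0 ≤ τ) (hΛ : 0 ≤ Λ)
    {ℓ : ℝ → V →L[ℝ] ℝ} (hℓ : ∀ s s', ‖ℓ s' - ℓ s‖ ≤ Λ * |s' - s|) {y : ℕ → V}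
    (hst : ∀ n : ℕ, ∀ v, ℓ (n * τ) v - a (y n) v ≤ κ * ‖v‖)
    (hfl : ∀ n : ℕ, κ * ‖y (n + 1) - y n‖ ≤
      ℓ ((n + 1 : ℕ) * τ) (y (n + 1) - y n) - a (y (n + 1)) (y (n + 1) - y n)) :
    (∀ m k : ℕ, ‖y (m + k) - y m‖ ≤ Λ / α * (k * τ)) ∧
    ∀ m k : ℕ, κ * ‖y (m + k) - y m‖ ≤ ℓ (m * τ) (y (m + k) - y m) - a (y m) (y (m + k) - y m)
      + (Λ + ‖a‖ * (Λ / α)) * (Λ / α) * (k * τ) ^ 2 := by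
  -- Stability at step `n`, tested with the next increment `d`, is subtracted from the flow
  -- inequality: `α ‖d‖² ≤ a d d ≤ (ℓ_{n+1} - ℓ_n) d ≤ Λ τ ‖d‖`. For `n = 0` this uses stability of
  -- the initial state.
  have hinc : ∀ n : ℕ, ‖y (n + 1) - y n‖ ≤ Λ / α * τ := by
    intro n
    have h1 := hst n (y (n + 1) - y n)
    have h2 := hfl n
    have h3 := hcoer (y (n + 1) - y n)
    have h4 : (ℓ ((n + 1 : ℕ) * τ) - ℓ (n * τ)) (y (n + 1) - y n)
        ≤ Λ * τ * ‖y (n + 1) - y n‖ := by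
      refine (Real.le_norm_self _).trans ((ContinuousLinearMap.le_opNorm _ _).trans ?_)
      gcongr
      refine (hℓ _ _).trans (le_of_eq ?_)
      rw [show ((n + 1 : ℕ) : ℝ) * τ - n * τ = τ by push_cast; ring, abs_of_nonneg hτ]
    have h5 : α * ‖y (n + 1) - y n‖ ^ 2 ≤ Λ * τ * ‖y (n + 1) - y n‖ := by
      rw [sub_apply] at h4
      have : a (y (n + 1) - y n) (y (n + 1) - y n)
        = a (y (n + 1)) (y (n + 1) - y n) - a (y n) (y (n + 1) - y n) := by
        rw [map_sub a, sub_apply]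
      linarith
    rw [div_mul_eq_mul_div, le_div_iff₀ hα]
    rcases (norm_nonneg (y (n + 1) - y n)).eq_or_lt with h | h
    · rw [← h, zero_mul]; exact mul_nonneg hΛ hτ
    · nlinarith
  have hlip : ∀ m k : ℕ, ‖y (m + k) - y m‖ ≤ Λ / α * (k * τ) := by
    intro m k
    induction k with
    | zero => simp
    | succ k ih =>
      calc ‖y (m + (k + 1)) - y m‖ = ‖(y (m + k + 1) - y (m + k)) + (y (m + k) - y m)‖ := by
            rw [← add_assoc]; congr 1; abel
        _ ≤ Λ / α * τ + Λ / α * (k * τ) := (norm_add_le _ _).trans (add_le_add (hinc _) ih)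
        _ = _ := by push_cast; ring
  refine ⟨hlip, fun m k => ?_⟩
  induction k with
  | zero => simp
  | succ k ih =>
    have h1 := hfl (m + k)
    have h2 := hlip m (k + 1)
    rw [← add_assoc] at h2 ⊢
    set d := y (m + k + 1) - y (m + k) with hd
    have hd' : y (m + k + 1) - y m = (y (m + k) - y m) + d := by rw [hd]; abel
    have h3 : κ * ‖y (m + k + 1) - y m‖ ≤ κ * ‖y (m + k) - y m‖ + κ * ‖d‖ := by
      rw [hd', ← mul_add]; gcongr; exact norm_add_le _ _
    -- Freezing load and state at step `m` costs order `(k + 1) τ²` in the new step, and `k² + (k +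
    -- 1) ≤ (k + 1)²` keeps the accumulated cost quadratic.
    have h4 : (ℓ ((m + k + 1 : ℕ) * τ) - ℓ (m * τ)) d ≤ Λ * ((k + 1 : ℕ) * τ) * (Λ / α * τ) := by
      refine (Real.le_norm_self _).trans ((ContinuousLinearMap.le_opNorm _ _).trans ?_)
      gcongr
      · refine (hℓ _ _).trans (le_of_eq ?_)
        rw [show ((m + k + 1 : ℕ) : ℝ) * τ - m * τ = (k + 1 : ℕ) * τ by push_cast; ring,
          abs_of_nonneg (by positivity)]
      · exact hinc _
    have h5 : -(a (y (m + k + 1) - y m) d) ≤ ‖a‖ * (Λ / α * ((k + 1 : ℕ) * τ)) * (Λ / α * τ) := by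
      refine (neg_le_abs _).trans ((a.le_opNorm₂ _ _).trans ?_)
      gcongr
      exact hinc _
    rw [sub_apply] at h4
    rw [map_sub a, sub_apply] at h5
    have h6 : (Λ + ‖a‖ * (Λ / α)) * (Λ / α) * (k * τ) ^ 2
        + (Λ + ‖a‖ * (Λ / α)) * (Λ / α) * ((k + 1 : ℕ) * τ ^ 2)
        ≤ (Λ + ‖a‖ * (Λ / α)) * (Λ / α) * ((k + 1 : ℕ) * τ) ^ 2 := by
      rw [← mul_add]
      gcongr
      push_cast
      have : (0 : ℝ) ≤ k * τ ^ 2 := by positivity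
      linarith [this]
    rw [hd', map_add, map_add]
    rw [hd'] at h3
    linarith

/-- Existence of quasistatic trajectories that start from a stable state. -/
theorem exists_isQuasistatic [FiniteDimensional ℝ V] {a : V →L[ℝ] V →L[ℝ] ℝ}
    (ha : ∀ u v, a u v = a v u) {α κ Λ : ℝ} (hα : 0 < α) (hcoer : ∀ v, α * ‖v‖ ^ 2 ≤ a v v)
    (hκ : 0 ≤ κ) (hΛ : 0 ≤ Λ) {ℓ : ℝ → V →L[ℝ] ℝ} (hℓ : ∀ s s', ‖ℓ s' - ℓ s‖ ≤ Λ * |s' - s|)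
    (z₀ : V) (hz₀ : ∀ v, ℓ 0 v - a z₀ v ≤ κ * ‖v‖) (T : ℝ) :
    ∃ z : ℝ → V, z 0 = z₀ ∧
      IsQuasistatic a ℓ κ T (Λ / α) ((Λ + ‖a‖ * (Λ / α)) * (Λ / α)) z := by
  choose S hS1 hS2 using fun f z => exists_incremental_solution ha hα hcoer hκ f z
  set τ : ℕ → ℝ := fun N => 1 / ((N : ℝ) + 1) with hτdef
  have hτ : ∀ N, 0 < τ N := fun N => by simp only [hτdef]; positivity
  set y : ℕ → ℕ → V := fun N n => Nat.rec z₀ (fun n x => S (ℓ ((n + 1 : ℕ) * τ N)) x) n with hy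
  have hest := fun N : ℕ => euler_estimates (y := y N) hα hcoer hκ (hτ N).le hΛ hℓ
    (fun n => by
      cases n with
      | zero => simpa [hy] using hz₀
      | succ n => exact hS1 _ _)
    (fun n => hS2 _ _)
  have hst : ∀ N n : ℕ, ∀ v, ℓ (n * τ N) v - a (y N n) v ≤ κ * ‖v‖ := fun N n => by
    cases n with
    | zero => simpa [hy] using hz₀
    | succ n => exact hS1 _ _
  set k : ℕ → ℝ → ℕ := fun N t => ⌊t / τ N⌋₊ with hk
  have hτ0 : Tendsto τ atTop (𝓝 0) := tendsto_one_div_add_atTop_nhds_zero_nat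
  have hkt : ∀ t, 0 ≤ t → Tendsto (fun N => (k N t : ℝ) * τ N) atTop (𝓝 t) := by
    intro t ht
    have hl : Tendsto (fun N => t - τ N) atTop (𝓝 (t - 0)) := tendsto_const_nhds.sub hτ0
    rw [sub_zero] at hl
    refine tendsto_of_tendsto_of_tendsto_of_le_of_le hl tendsto_const_nhds ?_ ?_
    · intro N
      have h1 := Nat.lt_floor_add_one (t / τ N)
      rw [div_lt_iff₀ (hτ N)] at h1
      simp only [hk]; linarith
    · intro N
      have h1 := Nat.floor_le (div_nonneg ht (hτ N).le)
      rwa [le_div_iff₀ (hτ N)] at h1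
  -- Along an ultrafilter the bounded Euler interpolants converge at all times simultaneously, so no
  -- diagonal subsequence is needed.
  let U : Ultrafilter ℕ := Ultrafilter.of atTop
  have hU : (U : Filter ℕ) ≤ atTop := Ultrafilter.of_le _
  have hex : ∀ t, ∃ x, 0 ≤ t → Tendsto (fun N => y N (k N t)) U (𝓝 x) := by
    intro t
    by_cases ht : 0 ≤ t
    swap
    · exact ⟨z₀, fun h => absurd h ht⟩
    have hcomp := isCompact_closedBall z₀ (Λ / α * t)
    have hmem : ∀ N, y N (k N t) ∈ Metric.closedBall z₀ (Λ / α * t) := by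
      intro N
      rw [mem_closedBall_iff_norm]
      have h1 := (hest N).1 0 (k N t)
      rw [zero_add] at h1
      refine h1.trans ?_
      gcongr
      have h1 := Nat.floor_le (div_nonneg ht (hτ N).le)
      rwa [le_div_iff₀ (hτ N)] at h1
    obtain ⟨x, -, hx⟩ := hcomp.ultrafilter_le_nhds (U.map fun N => y N (k N t))
      (le_principal_iff.2 (mem_map.2 (univ_mem' hmem)))
    exact ⟨x, fun _ => hx⟩
  choose z hz using hex
  have hmono : ∀ N s s', s ≤ s' → k N s ≤ k N s' := fun N s s' h =>
    Nat.floor_le_floor (div_le_div_of_nonneg_right h (hτ N).le)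
  have hℓc : Continuous ℓ := by
    refine LipschitzWith.continuous (K := Λ.toNNReal) (LipschitzWith.of_dist_le_mul fun s s' => ?_)
    rw [dist_eq_norm, Real.dist_eq, Real.coe_toNNReal _ hΛ]
    exact hℓ _ _
  have hdiff : ∀ s s', 0 ≤ s → s ≤ s' →
      Tendsto (fun N => ((k N s' - k N s : ℕ) : ℝ) * τ N) U (𝓝 (s' - s)) := by
    intro s s' h0 h
    have h1 := ((hkt s' (h0.trans h)).sub (hkt s h0)).mono_left hU
    refine h1.congr fun N => ?_
    rw [Nat.cast_sub (hmono N s s' h)]; ring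
  have happ : ∀ {f : ℕ → V →L[ℝ] ℝ} {f₀ : V →L[ℝ] ℝ} {x : ℕ → V} {x₀ : V},
      Tendsto f U (𝓝 f₀) → Tendsto x U (𝓝 x₀) → Tendsto (fun N => f N (x N)) U (𝓝 (f₀ x₀)) :=
    fun {f f₀ x x₀} hf hx =>
      ((isBoundedBilinearMap_apply (𝕜 := ℝ) (E := V) (F := ℝ)).continuous.tendsto
        (f₀, x₀)).comp (hf.prodMk_nhds hx)
  refine ⟨z, ?_, ?_, ?_, ?_⟩
  · have h1 := hz 0 le_rfl
    have h2 : (fun N => y N (k N 0)) = fun _ => z₀ := by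
      funext N; simp [hk, hy]
    rw [h2] at h1
    exact tendsto_nhds_unique h1 tendsto_const_nhds
  · intro s s' h0 h _
    refine le_of_tendsto_of_tendsto' ((hz s' (h0.trans h)).sub (hz s h0)).norm
      ((hdiff s s' h0 h).const_mul (Λ / α)) fun N => ?_
    have h1 := (hest N).1 (k N s) (k N s' - k N s)
    rwa [Nat.add_sub_cancel' (hmono N s s' h)] at h1
  · intro s h0 _ v
    have h1 : Tendsto (fun N => ℓ (k N s * τ N)) U (𝓝 (ℓ s)) :=
      (hℓc.tendsto s).comp ((hkt s h0).mono_left hU)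
    have h2 : Tendsto (fun N => ℓ (k N s * τ N) v - a (y N (k N s)) v) U (𝓝 (ℓ s v - a (z s) v)) :=
      (happ h1 tendsto_const_nhds).sub
        (happ ((a.continuous.tendsto _).comp (hz s h0)) tendsto_const_nhds)
    exact le_of_tendsto' h2 fun N => hst N _ v
  · intro s s' h0 h _
    have h1 : Tendsto (fun N => ℓ (k N s * τ N)) U (𝓝 (ℓ s)) :=
      (hℓc.tendsto s).comp ((hkt s h0).mono_left hU)
    have hd := (hz s' (h0.trans h)).sub (hz s h0)
    refine le_of_tendsto_of_tendsto' (hd.norm.const_mul κ)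
      (((happ h1 hd).sub (happ ((a.continuous.tendsto _).comp (hz s h0)) hd)).add
      (((hdiff s s' h0 h).pow 2).const_mul _)) fun N => ?_
    have h1 := (hest N).2 (k N s) (k N s' - k N s)
    rwa [Nat.add_sub_cancel' (hmono N s s' h)] at h1

end Quadratic

/-! ### Energy balance of quasistatic trajectories -/

section Balance

variable {V : Type*} [NormedAddCommGroup V] [NormedSpace ℝ V]

/-- A quasistatic trajectory dissipates exactly the energy that is supplied to it: the increments
of supplied minus stored energy dominate the dissipation distance, and they are dominated by
every superadditive upper bound of the dissipation distance. -/
theorem IsQuasistatic.balance {a : V →L[ℝ] V →L[ℝ] ℝ} (ha : ∀ u v, a u v = a v u)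
    {ℓ : ℝ → V →L[ℝ] ℝ} {κ T L C Λ K : ℝ} {z : ℝ → V} (hz : IsQuasistatic a ℓ κ T L C z)
    (hΛ : 0 ≤ Λ) (hℓ : ∀ s s', 0 ≤ s → s ≤ s' → s' ≤ T → ‖ℓ s' - ℓ s‖ ≤ Λ * (s' - s))
    {c G : ℝ → ℝ}
    (hG : ∀ s s', 0 ≤ s → s ≤ s' → s' ≤ T →
      |G s' - G s - ((c s' - ℓ s' (z s)) - (c s - ℓ s (z s)))| ≤ K * (s' - s) ^ 2)
    {b : ℝ → ℝ} (hb : ∀ s, b s = G s - (1 / 2 * a (z s) (z s) - ℓ s (z s) + c s)) :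
    (∀ s s', 0 ≤ s → s ≤ s' → s' ≤ T → κ * ‖z s' - z s‖ ≤ b s' - b s) ∧
    ∀ (g : ℝ → ℝ) (t : ℝ), 0 ≤ t → t ≤ T →
      (∀ s s', 0 ≤ s → s ≤ s' → s' ≤ t → κ * ‖z s' - z s‖ ≤ g s' - g s) →
      b t - b 0 ≤ g t - g 0 := by
  -- Stability and flow sandwich the force tested with `z s' - z s`, so the increments of `b` equal
  -- `κ ‖z s' - z s‖` up to `O((s' - s)²)`. Both claims then follow by refining partitions.
  have hinc : ∀ s s', 0 ≤ s → s ≤ s' → s' ≤ T →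
      κ * ‖z s' - z s‖ - (b s' - b s) ≤ (C + Λ * L + 1 / 2 * ‖a‖ * L ^ 2 + K) * (s' - s) ^ 2 ∧
      (b s' - b s) - κ * ‖z s' - z s‖ ≤ (Λ * L + 1 / 2 * ‖a‖ * L ^ 2 + K) * (s' - s) ^ 2 := by
    intro s s' h0 h h'
    have h1 := abs_le.1 (hG s s' h0 h h')
    have h2 := hz.flow s s' h0 h h'
    have h3 := hz.stable s h0 (h.trans h') (z s' - z s)
    have h4 := hz.lipschitz s s' h0 h h'
    have h5 : |(ℓ s' - ℓ s) (z s' - z s)| ≤ Λ * (s' - s) * (L * (s' - s)) := by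
      refine ((ℓ s' - ℓ s).le_opNorm (z s' - z s)).trans ?_
      exact mul_le_mul (hℓ s s' h0 h h') h4 (norm_nonneg _) (mul_nonneg hΛ (by linarith))
    have h6 : |a (z s' - z s) (z s' - z s)| ≤ ‖a‖ * (L * (s' - s)) * (L * (s' - s)) := by
      refine (a.le_opNorm₂ _ _).trans ?_
      gcongr
      exact mul_nonneg (norm_nonneg a) ((norm_nonneg _).trans h4)
    rw [hb, hb]
    have h5 := abs_le.1 h5
    have h6 := abs_le.1 h6
    simp only [map_sub, sub_apply] at *
    rw [ha (z s') (z s)] at *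
    constructor <;> nlinarith
  refine ⟨fun s s' h0 h h' => ?_, fun g t h0 ht hg => ?_⟩
  · have key := sub_le_of_increment_le (f := fun x => κ * ‖z (s + x) - z s‖ - b (s + x))
      (g := fun _ => 0) (A := 0) (B := 0) (C := C + Λ * L + 1 / 2 * ‖a‖ * L ^ 2 + K)
      (t := s' - s) (by linarith) ?_
    · simp only [add_sub_cancel, add_zero, sub_self, norm_zero, mul_zero, zero_mul] at key
      linarith
    · intro x x' hx hxx hx'
      have h1 := (hinc (s + x) (s + x') (by linarith) (by linarith) (by linarith)).1
      rw [add_sub_add_left_eq_sub] at h1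
      have h2 : κ * ‖z (s + x') - z s‖ ≤ κ * ‖z (s + x') - z (s + x)‖ + κ * ‖z (s + x) - z s‖ := by
        by_cases hκ : 0 ≤ κ
        · rw [← mul_add]
          gcongr
          exact norm_sub_le_norm_sub_add_norm_sub _ _ _
        -- For `κ < 0`, stability tested with `v` and `-v` forces every norm to vanish.
        · have := hz.stable s h0 (h.trans h')
          have h3 : ∀ v : V, ‖v‖ = 0 := by
            intro v
            have e1 := this v
            have e2 := this (-v)
            rw [map_neg, map_neg, norm_neg] at e2
            nlinarith [norm_nonneg v]
          simp [h3]
      linarith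
  · have key := sub_le_of_increment_le (f := fun x => b x - g x)
      (g := fun _ => 0) (A := 0) (B := 0) (C := Λ * L + 1 / 2 * ‖a‖ * L ^ 2 + K)
      (t := t) h0 ?_
    · simp only [zero_mul] at key
      linarith
    · intro x x' hx hxx hx'
      have h1 := (hinc x x' (by linarith) (by linarith) (by linarith)).2
      have h2 := hg x x' hx hxx hx'
      linarith

end Balance

/-! ### Total dissipation as a superadditive interval function -/

section Diss

variable {Z : Type*} (D : Z → Z → ℝ≥0∞) (q : ℝ → Z)

theorem le_diss {t : ℝ} (N : ℕ) (u : ℕ → ℝ) (h : Monotone u) (h0 : u 0 = 0) (hN : u N = t) :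
    ∑ i ∈ Finset.range N, D (q (u i)) (q (u (i + 1))) ≤ diss D t q :=
  le_iSup_of_le N (le_iSup_of_le u (le_iSup_of_le ⟨h, h0, hN⟩ le_rfl))

/-- Any partition of `[0,s]` extends by the single point `s'`. The infinite case is separated
because the supremum is moved across the sum by truncated subtraction. -/
theorem diss_add_le {s s' : ℝ} (h0 : 0 ≤ s) (h : s ≤ s') :
    diss D s q + D (q s) (q s') ≤ diss D s' q := by
  have hext : ∀ (N : ℕ) (u : ℕ → ℝ), Monotone u → u 0 = 0 → u N = s →
      ∑ i ∈ Finset.range N, D (q (u i)) (q (u (i + 1))) + D (q s) (q s') ≤ diss D s' q := by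
    intro N u hu hu0 huN
    -- Partitions are sequences indexed by all of `ℕ`; values after index `N` are free and are
    -- replaced by the constant `s'`.
    set u' : ℕ → ℝ := fun i => if i ≤ N then u i else s' with hu'
    have hmono : Monotone u' := by
      intro i j hij
      simp only [hu']
      split_ifs with h1 h2 h2
      · exact hu hij
      · exact (hu h1).trans (huN ▸ h)
      · omega
      · exact le_rfl
    refine le_trans (le_of_eq ?_) (le_diss D q (N + 1) u' hmono (by simpa [hu'] using hu0)
      (by simp [hu']))
    rw [Finset.sum_range_succ]
    congr 1
    · refine Finset.sum_congr rfl fun i hi => ?_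
      have := Finset.mem_range.1 hi
      simp only [hu', if_pos this.le, if_pos (Nat.succ_le_of_lt this)]
    · simp [hu', huN]
  have hone : D (q s) (q s') ≤ diss D s' q := by
    refine le_trans le_add_self (hext 1 (fun i => if i = 0 then 0 else s) ?_ (by simp) (by simp))
    intro i j hij
    dsimp only
    split_ifs with h1 h2 h2
    · exact le_rfl
    · exact h0
    · omega
    · exact le_rfl
  by_cases htop : D (q s) (q s') = ⊤
  · rw [htop, top_le_iff] at hone
    rw [hone]; exact le_top
  refine add_le_of_le_tsub_right_of_le hone ?_
  refine iSup_le fun N => iSup_le fun u => iSup_le fun hu => ?_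
  exact ENNReal.le_sub_of_add_le_right htop (hext N u hu.1 hu.2.1 hu.2.2)

theorem diss_mono {s s' : ℝ} (h0 : 0 ≤ s) (h : s ≤ s') : diss D s q ≤ diss D s' q :=
  le_self_add.trans (diss_add_le D q h0 h)

/-- The upper bounds telescope along every partition. -/
theorem diss_le_of_le_sub {g : ℝ → ℝ} {t : ℝ}
    (hg : ∀ s s', 0 ≤ s → s ≤ s' → s' ≤ t → g s ≤ g s' ∧ D (q s) (q s') ≤ ENNReal.ofReal (g s' - g s)) :
    diss D t q ≤ ENNReal.ofReal (g t - g 0) := by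
  refine iSup_le fun N => iSup_le fun u => iSup_le fun ⟨hu, hu0, huN⟩ => ?_
  calc ∑ i ∈ Finset.range N, D (q (u i)) (q (u (i + 1)))
      ≤ ∑ i ∈ Finset.range N, ENNReal.ofReal (g (u (i + 1)) - g (u i)) :=
        Finset.sum_le_sum fun i hi => (hg _ _ (hu0 ▸ hu (Nat.zero_le i)) (hu (Nat.le_succ i))
          (huN ▸ hu (Finset.mem_range.1 hi))).2
    _ = ENNReal.ofReal (∑ i ∈ Finset.range N, (g (u (i + 1)) - g (u i))) := by
        rw [ENNReal.ofReal_sum_of_nonneg]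
        intro i hi
        exact sub_nonneg.2 (hg _ _ (hu0 ▸ hu (Nat.zero_le i)) (hu (Nat.le_succ i))
          (huN ▸ hu (Finset.mem_range.1 hi))).1
    _ = _ := by rw [Finset.sum_range_sub (fun i => g (u i)), huN, hu0]

/-- Increments of a finite total dissipation dominate the dissipation distance. -/
theorem toReal_le_diss_sub {s s' : ℝ} (h0 : 0 ≤ s) (h : s ≤ s') (hfin : diss D s' q ≠ ⊤) :
    (D (q s) (q s')).toReal ≤ (diss D s' q).toReal - (diss D s q).toReal := by
  have h1 := diss_add_le D q h0 h
  have h2 : diss D s q ≠ ⊤ := ne_top_of_le_ne_top hfin (diss_mono D q h0 h)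
  have h3 : D (q s) (q s') ≠ ⊤ := ne_top_of_le_ne_top hfin (le_add_self.trans h1)
  have h4 := ENNReal.toReal_mono hfin h1
  rw [ENNReal.toReal_add h2 h3] at h4
  linarith

end Diss

/-! ### Matrix preliminaries -/

theorem norm_sq_eq_contr (A : Mat) : ‖A‖ ^ 2 = contr A A := by
  rw [Matrix.frobenius_norm_def, ← Real.sqrt_eq_rpow, Real.sq_sqrt (by positivity), contr]
  simp only [Real.rpow_two, Real.norm_eq_abs, sq_abs]
  simp only [sq]

theorem D0_eq (r : ℝ) (z₁ z₂ : Dev) : D0 r z₁ z₂ = ENNReal.ofReal (r / 2 * ‖z₂ - z₁‖) := by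
  have : ((z₂ : Mat) - (z₁ : Mat)).trace = 0 := by
    rw [Matrix.trace_sub, z₂.2.2, z₁.2.2, sub_zero]
  rw [D0, tildeR, if_pos this]
  rfl

section MatrixCalculus

attribute [local instance] Matrix.frobeniusNormedRing Matrix.frobeniusNormedAlgebra

theorem posSemidef_mul_self {S : Mat} (h : S.IsSymm) : (S * S).PosSemidef := by
  have h1 := Matrix.posSemidef_conjTranspose_mul_self S
  rwa [Matrix.conjTranspose_eq_transpose_of_trivial, h.eq] at h1

-- Passing from the spectral calculus to `CFC.sqrt` gives access to the uniqueness of the positive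
-- semidefinite root.
open scoped MatrixOrder in
theorem sqrtM_eq_sqrt {C : Mat} (h : C.PosSemidef) : sqrtM C = CFC.sqrt C := by
  rw [CFC.sqrt_eq_real_sqrt C h.nonneg, cfcₙ_eq_cfc (hf0 := Real.sqrt_zero)]
  rfl

open scoped MatrixOrder in
theorem sqrtM_mul_self {S : Mat} (h : S.PosSemidef) : sqrtM (S * S) = S := by
  have hs : S.IsSymm := by
    have := h.1
    rwa [Matrix.IsHermitian, Matrix.conjTranspose_eq_transpose_of_trivial] at this
  rw [sqrtM_eq_sqrt (posSemidef_mul_self hs)]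
  exact CFC.sqrt_unique rfl h.nonneg

open scoped MatrixOrder in
theorem sqrtM_spec {C : Mat} (h : C.PosDef) :
    (sqrtM C).IsSymm ∧ sqrtM C * sqrtM C = C ∧ IsUnit (sqrtM C).det := by
  rw [sqrtM_eq_sqrt h.posSemidef]
  have h1 := CFC.sqrt_mul_sqrt_self C h.posSemidef.nonneg
  refine ⟨?_, h1, ?_⟩
  · have := (Matrix.nonneg_iff_posSemidef.1 (CFC.sqrt_nonneg C)).1
    rwa [Matrix.IsHermitian, Matrix.conjTranspose_eq_transpose_of_trivial] at this
  · have h2 : (CFC.sqrt C).det * (CFC.sqrt C).det = C.det := by rw [← Matrix.det_mul, h1]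
    have h3 := h.det_pos
    rw [isUnit_iff_ne_zero]
    intro h0
    rw [h0, zero_mul] at h2
    exact h3.ne h2

/-- A smooth local square root near the identity. -/
theorem exists_local_sqrt : ∃ G : Mat → Mat, ContDiffAt ℝ 2 G 1 ∧ G 1 = 1 ∧
    ∀ᶠ X in 𝓝 (1 : Mat), X.IsSymm → sqrtM X = G X := by
  have hsq : ContDiff ℝ 2 (fun X : Mat => X * X) := by fun_prop
  let dbl : Mat ≃L[ℝ] Mat := ContinuousLinearEquiv.equivOfInverse
    ((2 : ℝ) • ContinuousLinearMap.id ℝ Mat) ((2⁻¹ : ℝ) • ContinuousLinearMap.id ℝ Mat)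
    (fun A => by simp) (fun A => by simp)
  -- Squaring has derivative `A ↦ 2A` at the identity, which is invertible; the inverse function
  -- theorem then provides the smooth root.
  have hder : HasFDerivAt (fun X : Mat => X * X) (dbl : Mat →L[ℝ] Mat) 1 := by
    have h := (hasFDerivAt_id (𝕜 := ℝ) (1 : Mat)).mul' (hasFDerivAt_id (𝕜 := ℝ) (1 : Mat))
    refine h.congr_fderiv ?_
    ext1 A
    change (1 : Mat) • A + MulOpposite.op (1 : Mat) • A = (2 : ℝ) • A
    rw [one_smul, MulOpposite.op_one, one_smul, two_smul]
  have h2 : (2 : WithTop ℕ∞) ≠ 0 := two_ne_zero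
  set φ := hsq.contDiffAt.toOpenPartialHomeomorph (fun X : Mat => X * X) hder h2 with hφ
  have hφc : ∀ X, φ X = X * X := fun X => rfl
  have h1s : (1 : Mat) ∈ φ.source := hsq.contDiffAt.mem_toOpenPartialHomeomorph_source hder h2
  have hφ1 : φ 1 = 1 := by rw [hφc, one_mul]
  have hG1 : φ.symm 1 = 1 := by
    conv_lhs => rw [← hφ1]
    exact φ.left_inv h1s
  have h1t : (1 : Mat) ∈ φ.target := by
    have := φ.map_source h1s
    rwa [hφ1] at this
  have hGc : ContDiffAt ℝ 2 φ.symm 1 := by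
    have := hsq.contDiffAt.to_localInverse hder h2
    rwa [one_mul] at this
  have hGt : Tendsto φ.symm (𝓝 1) (𝓝 1) := by
    have := hGc.continuousAt.tendsto
    rwa [hG1] at this
  have hsquare : ∀ᶠ X in 𝓝 (1 : Mat), φ.symm X * φ.symm X = X := by
    filter_upwards [φ.open_target.mem_nhds h1t] with X hX
    exact φ.right_inv hX
  have htr : Tendsto (fun X : Mat => X.transpose) (𝓝 1) (𝓝 1) := by
    have : Continuous fun X : Mat => X.transpose := continuous_id.matrix_transpose
    have := this.tendsto 1
    rwa [Matrix.transpose_one] at this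
  -- The root and its transpose have the same square and both lie where squaring is injective.
  have hsymm : ∀ᶠ X in 𝓝 (1 : Mat), X.IsSymm → (φ.symm X).IsSymm := by
    have hsrc := φ.open_source.mem_nhds h1s
    filter_upwards [hsquare, hGt hsrc, (htr.comp hGt) hsrc] with X hX hX1 hX2 hs
    apply φ.injOn hX2 hX1
    rw [hφc, hφc]
    change (φ.symm X).transpose * (φ.symm X).transpose = _
    rw [← Matrix.transpose_mul, hX, hs.eq]
  refine ⟨φ.symm, hGc, hG1, ?_⟩
  -- Taking the local root twice writes the root itself as the square of a symmetric matrix. It is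
  -- therefore positive semidefinite and must be the spectral root.
  · filter_upwards [hsquare, hsymm, hGt hsquare, hGt hsymm] with X h1 h2 h3 h4 hs
    have hs1 := h2 hs
    have hs2 := h4 hs1
    have hps : (φ.symm X).PosSemidef := by
      have := posSemidef_mul_self hs2
      rwa [h3] at this
    conv_lhs => rw [← h1]
    exact sqrtM_mul_self hps

theorem exp_isSymm {A : Mat} (h : A.IsSymm) : (NormedSpace.exp A).IsSymm := by
  rw [Matrix.IsSymm, ← Matrix.exp_transpose, h.eq]

theorem exp_two_smul (A : Mat) :
    NormedSpace.exp ((2 : ℝ) • A) = NormedSpace.exp A * NormedSpace.exp A := by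
  rw [two_smul, Matrix.exp_add_of_commute _ _ (Commute.refl A)]

theorem exp_mul_exp_neg (A : Mat) : NormedSpace.exp A * NormedSpace.exp (-A) = 1 := by
  rw [← Matrix.exp_add_of_commute _ _ (Commute.refl A).neg_right, add_neg_cancel,
    NormedSpace.exp_zero]

theorem exp_neg_mul_exp (A : Mat) : NormedSpace.exp (-A) * NormedSpace.exp A = 1 := by
  rw [← Matrix.exp_add_of_commute _ _ (Commute.refl A).neg_left, neg_add_cancel,
    NormedSpace.exp_zero]

theorem exp_posSemidef {A : Mat} (h : A.IsSymm) : (NormedSpace.exp A).PosSemidef := by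
  have h1 : A = (2 : ℝ) • ((2⁻¹ : ℝ) • A) := by rw [smul_smul]; norm_num
  rw [h1, exp_two_smul]
  exact posSemidef_mul_self (exp_isSymm (h.smul _))

theorem exp_posDef {A : Mat} (h : A.IsSymm) : (NormedSpace.exp A).PosDef :=
  (exp_posSemidef h).posDef_iff_isUnit.2 (Matrix.isUnit_exp A)

theorem sqrtM_exp {A : Mat} (h : A.IsSymm) :
    sqrtM (NormedSpace.exp ((2 : ℝ) • A)) = NormedSpace.exp A := by
  rw [exp_two_smul]
  exact sqrtM_mul_self (exp_posSemidef h)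

theorem inv_sqrtM_exp {A : Mat} (h : A.IsSymm) :
    (sqrtM (NormedSpace.exp ((2 : ℝ) • A)))⁻¹ = NormedSpace.exp (-A) := by
  rw [sqrtM_exp h]
  exact Matrix.inv_eq_left_inv (exp_neg_mul_exp A)

/-- Jacobi's formula. -/
theorem hasDerivWithinAt_det {c : ℝ → Mat} {V : Mat} {s : Set ℝ} {t : ℝ}
    (h : HasDerivWithinAt c V s t) :
    HasDerivWithinAt (fun u => (c u).det) ((c t).adjugate * V).trace s t := by
  have he : ∀ i j, HasDerivWithinAt (fun u => c u i j) (V i j) s t := fun i j =>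
    hasDerivWithinAt_pi.1 (hasDerivWithinAt_pi.1 h i) j
  simp only [Matrix.det_fin_three]
  refine HasDerivWithinAt.congr_deriv ((((((((he 0 0).mul (he 1 1)).mul (he 2 2)).sub
    (((he 0 0).mul (he 1 2)).mul (he 2 1))).sub (((he 0 1).mul (he 1 0)).mul (he 2 2))).add
    (((he 0 1).mul (he 1 2)).mul (he 2 0))).add (((he 0 2).mul (he 1 0)).mul (he 2 1))).sub
    (((he 0 2).mul (he 1 1)).mul (he 2 0))) ?_
  simp only [Matrix.trace_fin_three, Matrix.mul_apply, Fin.sum_univ_three,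
    Matrix.adjugate_fin_three]
  simp
  ring

theorem hasDerivAt_exp_smul (A : Mat) (t : ℝ) :
    HasDerivAt (fun u : ℝ => NormedSpace.exp (u • A)) (NormedSpace.exp (t • A) * A) t :=
  hasDerivAt_exp_smul_const A t

/-- By Jacobi's formula the derivative of `det (exp (u • A))` is a multiple of `tr A`. -/
theorem det_exp_eq_one {A : Mat} (h : A.trace = 0) : (NormedSpace.exp A).det = 1 := by
  have h1 : ∀ t : ℝ, HasDerivAt (fun u : ℝ => (NormedSpace.exp (u • A)).det) 0 t := by
    intro t
    have := hasDerivWithinAt_det (hasDerivAt_exp_smul A t).hasDerivWithinAt (s := univ)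
    rw [hasDerivWithinAt_univ] at this
    refine this.congr_deriv ?_
    rw [← mul_assoc, Matrix.adjugate_mul, Matrix.smul_mul, one_mul, Matrix.trace_smul, h, smul_zero]
  have h2 := is_const_of_deriv_eq_zero (fun t => (h1 t).differentiableAt) (fun t => (h1 t).deriv) 1 0
  simpa using h2

theorem exp_mem_SLSymPos {A : Mat} (h : A ∈ Dev) : NormedSpace.exp A ∈ SLSymPos :=
  ⟨exp_posDef h.1, det_exp_eq_one h.2⟩

end MatrixCalculus

/-! ### Two-sided bounds for the dissipation metric -/

section DissMetric

attribute [local instance] Matrix.frobeniusNormedRing Matrix.frobeniusNormedAlgebra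

theorem contr_eq_trace (A B : Mat) : contr A B = (A.transpose * B).trace := by
  simp only [contr, Matrix.trace, Matrix.diag_apply, Matrix.mul_apply, Matrix.transpose_apply]
  rw [Finset.sum_comm]

theorem contr_add_right (A B C : Mat) : contr A (B + C) = contr A B + contr A C := by
  simp only [contr_eq_trace, Matrix.mul_add, Matrix.trace_add]

theorem abs_contr_le (A B : Mat) : |contr A B| ≤ ‖A‖ * ‖B‖ := by
  apply abs_le_of_sq_le_sq _ (by positivity)
  rw [mul_pow, norm_sq_eq_contr, norm_sq_eq_contr]
  simp only [contr, ← Finset.sum_product']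
  have := Finset.sum_mul_sq_le_sq_mul_sq (Finset.univ ×ˢ Finset.univ)
    (fun p : Fin 3 × Fin 3 => A p.1 p.2) (fun p => B p.1 p.2)
  simpa only [sq] using this

/-- Here `|SA|² = A : S²A = |A|² + A : (S² - 1)A`. Submultiplicativity alone would give the factor
`‖S‖²`, which does not tend to one as `S → 1` because the Frobenius norm of the identity is `√3`. -/
theorem norm_symm_mul_sq_le {S : Mat} (hS : S.IsSymm) (A : Mat) :
    ‖S * A‖ ^ 2 ≤ (1 + ‖S * S - 1‖) * ‖A‖ ^ 2 := by
  have h1 : contr (S * A) (S * A) = contr A (A + (S * S - 1) * A) := by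
    have : A + (S * S - 1) * A = S * (S * A) := by noncomm_ring
    rw [this, contr_eq_trace, contr_eq_trace, Matrix.transpose_mul, hS.eq, Matrix.mul_assoc]
  rw [norm_sq_eq_contr, h1, contr_add_right, ← norm_sq_eq_contr]
  have h2 := (le_abs_self _).trans (abs_contr_le A ((S * S - 1) * A))
  have h3 := norm_mul_le (S * S - 1) A
  nlinarith [norm_nonneg A]

theorem norm_conj_le {S : Mat} (hS : S.IsSymm) (M : Mat) :
    ‖S * M * S‖ ≤ (1 + ‖S * S - 1‖) * ‖M‖ := by
  have htr : ∀ A : Mat, ‖A.transpose‖ = ‖A‖ := fun A => Matrix.frobenius_norm_transpose A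
  refine le_of_sq_le_sq ?_ (by positivity)
  have h1 := norm_symm_mul_sq_le hS (M * S)
  have h2 := norm_symm_mul_sq_le hS M.transpose
  have h3 : ‖M * S‖ = ‖S * M.transpose‖ := by
    rw [← htr (M * S), Matrix.transpose_mul, hS.eq]
  rw [htr] at h2
  rw [h3, ← mul_assoc] at h1
  calc ‖S * M * S‖ ^ 2 ≤ _ := h1
    _ ≤ (1 + ‖S * S - 1‖) * ((1 + ‖S * S - 1‖) * ‖M‖ ^ 2) := by gcongr
    _ = _ := by ring

/-- `V` is recovered by conjugating `C^{-1/2} V C^{-1/2}` with `C^{1/2}`, and `norm_conj_le` bounds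
that conjugation. -/
theorem le_hatR {r : ℝ} (hr : 0 ≤ r) {C : Mat} (hC : C.PosDef) (V : Mat) :
    ENNReal.ofReal (r / 2 * (‖V‖ / (1 + ‖C - 1‖))) ≤ hatR r C V := by
  obtain ⟨h1, h2, h3⟩ := sqrtM_spec hC
  rw [hatR, tildeR]
  split_ifs
  swap
  · exact le_top
  refine ENNReal.ofReal_le_ofReal ?_
  gcongr
  rw [div_le_iff₀' (by positivity)]
  have h4 := norm_conj_le h1 ((sqrtM C)⁻¹ * V * (sqrtM C)⁻¹)
  have h5 : sqrtM C * ((sqrtM C)⁻¹ * V * (sqrtM C)⁻¹) * sqrtM C = V := by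
    rw [← mul_assoc, ← mul_assoc, Matrix.mul_nonsing_inv _ h3, one_mul, mul_assoc,
      Matrix.nonsing_inv_mul _ h3, mul_one]
  rwa [h5, h2] at h4

/-- Along a competing curve with arc length `m`, the distance from the identity is at most `‖C₀ - 1‖
+ m`. The dissipation rate thus dominates `(r/2) m' / (1 + ‖C₀ - 1‖ + m)`, whose integral is a
logarithm, and `log x ≥ 1 - 1/x` concludes. No localization of the curve is needed. -/
theorem le_dissMetric {r : ℝ} (hr : 0 ≤ r) (C₀ C₁ : Mat) :
    ENNReal.ofReal (r / 2 * (‖C₁ - C₀‖ / (1 + ‖C₀ - 1‖ + ‖C₁ - C₀‖))) ≤ dissMetric r C₀ C₁ := by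
  refine le_iInf fun c => le_iInf fun ⟨hc, hpos, hc0, hc1⟩ => ?_
  have huniq : UniqueDiffOn ℝ (Icc (0 : ℝ) 1) := uniqueDiffOn_Icc zero_lt_one
  have hcont' : ContinuousOn (fun t => ‖derivWithin c (Icc 0 1) t‖) (Icc 0 1) :=
    (hc.continuousOn_derivWithin huniq le_rfl).norm
  -- The speed is extended continuously to the whole line so that its primitive `m` is
  -- differentiable everywhere, including the endpoints.
  set v : ℝ → ℝ := IccExtend zero_le_one
    ((Icc (0 : ℝ) 1).domRestrict fun t => ‖derivWithin c (Icc 0 1) t‖) with hv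
  have hvc : Continuous v := hcont'.domRestrict.Icc_extend'
  have hveq : ∀ t ∈ Icc (0 : ℝ) 1, v t = ‖derivWithin c (Icc 0 1) t‖ := fun t ht => by
    rw [hv, IccExtend_of_mem _ _ ht]; rfl
  have hv0 : ∀ t, 0 ≤ v t := fun t => norm_nonneg _
  set m : ℝ → ℝ := fun t => ∫ s in (0 : ℝ)..t, v s with hm
  have hmd : ∀ t, HasDerivAt m (v t) t := fun t => (hvc.integral_hasStrictDerivAt 0 t).hasDerivAt
  have hm0 : m 0 = 0 := by simp [hm]
  have hder : ∀ t ∈ Icc (0 : ℝ) 1, HasDerivWithinAt c (derivWithin c (Icc 0 1) t) (Icc 0 1) t :=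
    fun t ht => ((hc.differentiableOn one_ne_zero) t ht).hasDerivWithinAt
  have hbound : ∀ t ∈ Icc (0 : ℝ) 1, ‖c t - C₀‖ ≤ m t := by
    refine fun t ht => image_norm_le_of_norm_deriv_right_le_deriv_boundary
      (f := fun t => c t - C₀) (f' := fun t => derivWithin c (Icc 0 1) t)
      (hc.continuousOn.sub continuousOn_const) ?_ ?_ hmd ?_ ht
    · intro x hx
      refine ((hder x (Ico_subset_Icc_self hx)).mono_of_mem_nhdsWithin ?_).sub_const C₀
      exact mem_of_superset (Icc_mem_nhdsGE hx.2) (Icc_subset_Icc_left hx.1)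
    · simp [hc0, hm0]
    · intro x hx
      exact (hveq x (Ico_subset_Icc_self hx)).ge
  have hmnn : ∀ t, 0 ≤ t → 0 ≤ m t := fun t ht =>
    intervalIntegral.integral_nonneg ht fun s _ => hv0 s
  have hden : ∀ t, 0 ≤ t → 0 < 1 + ‖C₀ - 1‖ + m t := fun t ht => by
    have := hmnn t ht; positivity
  set φ : ℝ → ℝ := fun t => r / 2 * (v t / (1 + ‖C₀ - 1‖ + m t)) with hφ
  have hmc : Continuous m := continuous_iff_continuousAt.2 fun t => (hmd t).continuousAt
  have hφc : ContinuousOn φ (Icc 0 1) :=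
    continuousOn_const.mul (hvc.continuousOn.div (continuous_const.add hmc).continuousOn
      fun t ht => (hden t ht.1).ne')
  have hφint : ∫ t in (0 : ℝ)..1, φ t
      = r / 2 * Real.log (1 + ‖C₀ - 1‖ + m 1) - r / 2 * Real.log (1 + ‖C₀ - 1‖ + m 0) := by
    apply intervalIntegral.integral_eq_sub_of_hasDerivAt
      (f := fun t => r / 2 * Real.log (1 + ‖C₀ - 1‖ + m t))
    · intro t ht
      rw [uIcc_of_le zero_le_one] at ht
      exact (((hmd t).const_add _).log (hden t ht.1).ne').const_mul _
    · exact (hφc.intervalIntegrable_of_Icc zero_le_one)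
  have hlow : r / 2 * (‖C₁ - C₀‖ / (1 + ‖C₀ - 1‖ + ‖C₁ - C₀‖)) ≤ ∫ t in (0 : ℝ)..1, φ t := by
    rw [hφint, hm0, add_zero, ← mul_sub,
      ← Real.log_div (hden 1 zero_le_one).ne' (by positivity)]
    gcongr
    have h1 := hbound 1 ⟨zero_le_one, le_rfl⟩
    rw [hc1] at h1
    have h2 : (1 + ‖C₀ - 1‖ + ‖C₁ - C₀‖) / (1 + ‖C₀ - 1‖) ≤ (1 + ‖C₀ - 1‖ + m 1) / (1 + ‖C₀ - 1‖) := by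
      gcongr
    refine le_trans ?_ (Real.log_le_log (by positivity) h2)
    refine le_trans (le_of_eq ?_) (Real.one_sub_inv_le_log_of_pos (by positivity))
    field_simp
    ring
  calc _ ≤ ENNReal.ofReal (∫ t in (0 : ℝ)..1, φ t) := ENNReal.ofReal_le_ofReal hlow
    _ = ∫⁻ t in Icc (0 : ℝ) 1, ENNReal.ofReal (φ t) := by
        rw [intervalIntegral.integral_of_le zero_le_one, ← integral_Icc_eq_integral_Ioc,
          ofReal_integral_eq_lintegral_ofReal]
        · exact hφc.integrableOn_Icc
        · filter_upwards [ae_restrict_mem measurableSet_Icc] with t ht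
          have := hden t ht.1
          have := hv0 t
          simp only [hφ, Pi.zero_apply]; positivity
    _ ≤ _ := by
        refine setLIntegral_mono' measurableSet_Icc fun t ht => ?_
        refine le_trans (ENNReal.ofReal_le_ofReal ?_) (le_hatR hr (hpos t ht).1 _)
        simp only [hφ]
        rw [hveq t ht]
        refine mul_le_mul_of_nonneg_left (div_le_div_of_nonneg_left (norm_nonneg _)
          (by positivity) ?_) (by positivity)
        calc 1 + ‖c t - 1‖ = 1 + ‖(C₀ - 1) + (c t - C₀)‖ := by congr 2; abel
          _ ≤ 1 + (‖C₀ - 1‖ + ‖c t - C₀‖) := by gcongr; exact norm_add_le _ _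
          _ ≤ _ := by have := hbound t ht; linarith

theorem dissMetric_le {r : ℝ} {C₀ C₁ : Mat} {c : ℝ → Mat} (hc : ContDiffOn ℝ 1 c (Icc 0 1))
    (hpos : ∀ t ∈ Icc (0 : ℝ) 1, c t ∈ SLSymPos) (h0 : c 0 = C₀) (h1 : c 1 = C₁) {K : ℝ≥0∞}
    (hK : ∀ t ∈ Icc (0 : ℝ) 1, hatR r (c t) (derivWithin c (Icc 0 1) t) ≤ K) :
    dissMetric r C₀ C₁ ≤ K := by
  refine (iInf₂_le c ⟨hc, hpos, h0, h1⟩).trans ?_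
  refine (setLIntegral_mono' measurableSet_Icc hK).trans (le_of_eq ?_)
  simp

theorem hatR_exp {r : ℝ} {A : Mat} (hA : A.IsSymm) (V : Mat) :
    hatR r (NormedSpace.exp ((2 : ℝ) • A)) V
      = tildeR r (NormedSpace.exp (-A) * V * NormedSpace.exp (-A)) := by
  rw [hatR, inv_sqrtM_exp hA]

theorem contDiff_exp : ContDiff ℝ 2 (NormedSpace.exp : Mat → Mat) :=
  contDiff_iff_contDiffAt.2 fun x => (NormedSpace.exp_analytic x).contDiffAt

/-- The conjugated derivative depends continuously on `y` in operator norm and is the identity at `y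
= 0`. -/
theorem exists_norm_conj_fderiv_exp_le {𝔸 : Type*} [NormedRing 𝔸] [NormedAlgebra ℝ 𝔸]
    [CompleteSpace 𝔸] {η : ℝ} (hη : 0 < η) : ∃ δ > 0, ∀ y : 𝔸, ‖y‖ ≤ δ → ∀ V : 𝔸,
    ‖NormedSpace.exp (-((2⁻¹ : ℝ) • y)) * fderiv ℝ NormedSpace.exp y V
      * NormedSpace.exp (-((2⁻¹ : ℝ) • y))‖ ≤ (1 + η) * ‖V‖ := by
  have hexp : ContDiff ℝ 2 (NormedSpace.exp : 𝔸 → 𝔸) :=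
    contDiff_iff_contDiffAt.2 fun x => (NormedSpace.exp_analytic x).contDiffAt
  have hexp0 : fderiv ℝ (NormedSpace.exp : 𝔸 → 𝔸) 0 = ContinuousLinearMap.id ℝ 𝔸 :=
    (hasStrictFDerivAt_exp_zero (𝕂 := ℝ) (𝔸 := 𝔸)).hasFDerivAt.fderiv
  set Φ : 𝔸 → 𝔸 →L[ℝ] 𝔸 := fun y =>
    (ContinuousLinearMap.mulLeftRight ℝ 𝔸 (NormedSpace.exp (-((2⁻¹ : ℝ) • y)))
      (NormedSpace.exp (-((2⁻¹ : ℝ) • y)))).comp (fderiv ℝ NormedSpace.exp y) with hΦ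
  have hcont : Continuous Φ := by
    have h1 : Continuous fun y : 𝔸 => NormedSpace.exp (-((2⁻¹ : ℝ) • y)) :=
      hexp.continuous.comp (by fun_prop)
    have h2 : Continuous (fderiv ℝ (NormedSpace.exp : 𝔸 → 𝔸)) :=
      hexp.continuous_fderiv two_ne_zero
    exact (((ContinuousLinearMap.mulLeftRight ℝ 𝔸).continuous.comp h1).clm_apply h1).clm_comp h2
  have h0 : Φ 0 = ContinuousLinearMap.id ℝ 𝔸 := by
    ext1 V
    simp [hΦ, hexp0]
  have hev : ∀ᶠ y in 𝓝 (0 : 𝔸), ‖Φ y - ContinuousLinearMap.id ℝ 𝔸‖ < η := by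
    have : Tendsto (fun y => ‖Φ y - ContinuousLinearMap.id ℝ 𝔸‖) (𝓝 0)
        (𝓝 ‖Φ 0 - ContinuousLinearMap.id ℝ 𝔸‖) :=
      ((hcont.sub continuous_const).norm).tendsto 0
    rw [h0, sub_self, norm_zero] at this
    exact this.eventually_lt_const hη
  obtain ⟨δ, hδ, hball⟩ := Metric.eventually_nhds_iff_ball.1 hev
  refine ⟨δ / 2, by positivity, fun y hy V => ?_⟩
  have h1 := hball y (by rw [mem_ball_zero_iff]; linarith)
  change ‖Φ y V‖ ≤ _
  calc ‖Φ y V‖ = ‖V + (Φ y - ContinuousLinearMap.id ℝ 𝔸) V‖ := by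
        congr 1; simp
    _ ≤ ‖V‖ + η * ‖V‖ := by
        refine (norm_add_le _ _).trans ?_
        gcongr
        exact ((Φ y - ContinuousLinearMap.id ℝ 𝔸).le_opNorm V).trans (by gcongr)
    _ = _ := by ring

/-- The competitor is the exponential of the segment from `a` to `b`; its dissipation rate is almost
`(r/2) ‖b - a‖`. -/
theorem exists_dissMetric_exp_le (r : ℝ) (hr : 0 ≤ r) {η : ℝ} (hη : 0 < η) : ∃ δ > 0, ∀ a ∈ Dev, ∀ b ∈ Dev,
    ‖a‖ ≤ δ → ‖b‖ ≤ δ → dissMetric r (NormedSpace.exp a) (NormedSpace.exp b)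
      ≤ ENNReal.ofReal ((1 + η) * (r / 2 * ‖b - a‖)) := by
  obtain ⟨δ, hδ, h⟩ := exists_norm_conj_fderiv_exp_le (𝔸 := Mat) hη
  refine ⟨δ, hδ, fun a ha b hb hna hnb => ?_⟩
  set y : ℝ → Mat := fun t => a + t • (b - a) with hy
  have hydev : ∀ t, y t ∈ Dev := fun t => Dev.add_mem ha (Dev.smul_mem t (Dev.sub_mem hb ha))
  have hyn : ∀ t ∈ Icc (0 : ℝ) 1, ‖y t‖ ≤ δ := by
    intro t ht
    have := (convex_closedBall (0 : Mat) δ).add_smul_sub_mem (mem_closedBall_zero_iff.2 hna)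
      (mem_closedBall_zero_iff.2 hnb) ht
    exact mem_closedBall_zero_iff.1 this
  have hyc : ContDiff ℝ 1 y := by fun_prop
  have hyd : ∀ t, HasDerivAt y (b - a) t := fun t => by
    have h1 := ((hasDerivAt_id t).smul_const (b - a)).const_add a
    rw [one_smul] at h1
    exact h1
  set c : ℝ → Mat := fun t => NormedSpace.exp (y t) with hc
  have hcd : ∀ t, HasDerivAt c (fderiv ℝ NormedSpace.exp (y t) (b - a)) t := fun t =>
    ((contDiff_exp.differentiable two_ne_zero) (y t)).hasFDerivAt.comp_hasDerivAt t (hyd t)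
  refine dissMetric_le (c := c) ?_ (fun t _ => exp_mem_SLSymPos (hydev t)) (by simp [hc, hy])
    (by simp [hc, hy]) fun t ht => ?_
  · exact ((contDiff_exp.of_le one_le_two).comp hyc).contDiffOn
  have hdw := (hcd t).hasDerivWithinAt.derivWithin (uniqueDiffOn_Icc zero_lt_one t ht)
  erw [hdw]
  have hhalf : c t = NormedSpace.exp ((2 : ℝ) • ((2⁻¹ : ℝ) • y t)) := by
    rw [smul_smul]; norm_num [hc]
  rw [hhalf, hatR_exp ((hydev t).1.smul _), tildeR, if_pos]
  · refine ENNReal.ofReal_le_ofReal ?_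
    have := h (y t) (hyn t ht) (b - a)
    exact (mul_le_mul_of_nonneg_left this (by positivity)).trans (le_of_eq (by ring))
  -- The trace is `tr (c⁻¹ c')`, the derivative of the constant `det c = 1`, so `tildeR` takes its
  -- finite branch.
  · rw [Matrix.trace_mul_comm, ← mul_assoc, ← Matrix.exp_add_of_commute _ _ (Commute.refl _),
      ← neg_add, ← add_smul, show (2⁻¹ + 2⁻¹ : ℝ) = 1 by norm_num, one_smul]
    have h1 := hasDerivWithinAt_det (hcd t).hasDerivWithinAt (s := univ)
    have h2 : (fun u => (c u).det) = fun _ => (1 : ℝ) := by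
      funext u; exact det_exp_eq_one (hydev u).2
    rw [h2, hasDerivWithinAt_univ] at h1
    have h3 := h1.unique (hasDerivAt_const t (1 : ℝ))
    have h4 : (c t).adjugate = NormedSpace.exp (-y t) := by
      have h5 : (c t).adjugate * c t = 1 := by
        rw [Matrix.adjugate_mul, det_exp_eq_one (hydev t).2, one_smul]
      calc (c t).adjugate = (c t).adjugate * (c t * NormedSpace.exp (-y t)) := by
            rw [hc, exp_mul_exp_neg, mul_one]
        _ = _ := by rw [← mul_assoc, h5, one_mul]
    rwa [h4] at h3

/-- Strict differentiability of `exp` at zero gives `‖exp b - exp a‖ ≥ (1 - θ) ‖b - a‖`, and the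
denominator in `le_dissMetric` is at most `1 + θ`. With `θ = η/2`, `(1 - η)(1 + θ) ≤ 1 - θ`. -/
theorem exists_le_dissMetric_exp (r : ℝ) (hr : 0 ≤ r) {η : ℝ} (hη : 0 < η) : ∃ δ > 0, ∀ a b : Mat,
    ‖a‖ ≤ δ → ‖b‖ ≤ δ → ENNReal.ofReal ((1 - η) * (r / 2 * ‖b - a‖))
      ≤ dissMetric r (NormedSpace.exp a) (NormedSpace.exp b) := by
  set θ := η / 2 with hθ
  have hθ0 : 0 < θ := by positivity
  have hstrict := (hasStrictFDerivAt_exp_zero (𝕂 := ℝ) (𝔸 := Mat)).isLittleO.def hθ0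
  have hcont : Tendsto (NormedSpace.exp : Mat → Mat) (𝓝 0) (𝓝 1) := by
    have := (contDiff_exp.continuous).tendsto 0
    rwa [NormedSpace.exp_zero] at this
  have hc1 : ∀ᶠ a in 𝓝 (0 : Mat), ‖(NormedSpace.exp a : Mat) - 1‖ < θ / 3 := by
    have h1 : Tendsto (fun a : Mat => ‖(NormedSpace.exp a : Mat) - 1‖) (𝓝 0) (𝓝 ‖(1 : Mat) - 1‖) :=
      (hcont.sub tendsto_const_nhds).norm
    rw [sub_self, norm_zero] at h1
    exact h1.eventually_lt_const (by positivity)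
  obtain ⟨δ₁, hδ₁, h1⟩ := Metric.eventually_nhds_iff_ball.1 hstrict
  obtain ⟨δ₂, hδ₂, h2⟩ := Metric.eventually_nhds_iff_ball.1 hc1
  refine ⟨min δ₁ δ₂ / 2, by positivity, fun a b ha hb => ?_⟩
  have hlt : min δ₁ δ₂ / 2 < min δ₁ δ₂ := half_lt_self (by positivity)
  have ha' := ha.trans_lt hlt
  have hb' := hb.trans_lt hlt
  have e1 := h1 (b, a) (by
    rw [show ((0 : Mat), (0 : Mat)) = 0 from rfl, mem_ball_zero_iff, Prod.norm_def]
    exact max_lt (hb'.trans_le (min_le_left _ _)) (ha'.trans_le (min_le_left _ _)))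
  have e2 := h2 a (by rw [mem_ball_zero_iff]; exact ha'.trans_le (min_le_right _ _))
  have e3 := h2 b (by rw [mem_ball_zero_iff]; exact hb'.trans_le (min_le_right _ _))
  refine le_trans (ENNReal.ofReal_le_ofReal ?_) (le_dissMetric hr _ _)
  set d := ‖(NormedSpace.exp b : Mat) - NormedSpace.exp a‖ with hd
  have e4 : d ≤ θ / 3 + θ / 3 := by
    calc d = ‖((NormedSpace.exp b : Mat) - 1) - ((NormedSpace.exp a : Mat) - 1)‖ := by
          rw [hd]; congr 1; abel
      _ ≤ _ := (norm_sub_le _ _).trans (by linarith)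
  have e5 : (1 - θ) * ‖b - a‖ ≤ d := by
    have : ‖b - a‖ ≤ d + θ * ‖b - a‖ := by
      calc ‖b - a‖ = ‖((NormedSpace.exp b : Mat) - NormedSpace.exp a)
            - ((NormedSpace.exp b : Mat) - NormedSpace.exp a - (b - a))‖ := by congr 1; abel
        _ ≤ _ := (norm_sub_le _ _).trans (by gcongr; exact e1)
    linarith
  have hd0 : 0 ≤ d := norm_nonneg _
  have e6 : (1 - η) * ‖b - a‖ ≤ d / (1 + ‖(NormedSpace.exp a : Mat) - 1‖ + d) := by
    rw [le_div_iff₀ (by positivity)]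
    by_cases h1η : 1 - η ≤ 0
    · refine le_trans (mul_nonpos_of_nonpos_of_nonneg
        (mul_nonpos_of_nonpos_of_nonneg h1η (norm_nonneg _)) (by positivity)) hd0
    · push Not at h1η
      have : (1 - η) * ‖b - a‖ * (1 + ‖(NormedSpace.exp a : Mat) - 1‖ + d)
          ≤ (1 - η) * ‖b - a‖ * (1 + θ) :=
        mul_le_mul_of_nonneg_left (by linarith) (by positivity)
      nlinarith [norm_nonneg (b - a), mul_nonneg (sq_nonneg θ) (norm_nonneg (b - a))]
  calc (1 - η) * (r / 2 * ‖b - a‖) = r / 2 * ((1 - η) * ‖b - a‖) := by ring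
    _ ≤ _ := by gcongr

/-- The curve `exp ((1 - t) A)` commutes with `A`, so its dissipation rate is exactly `(r/2)|A|`.
This holds without smallness of `A`, as the a priori bound on stable states requires. -/
theorem dissMetric_exp_one_le {r : ℝ} {A : Mat} (hA : A ∈ Dev) :
    dissMetric r (NormedSpace.exp A) 1 ≤ ENNReal.ofReal (r / 2 * ‖A‖) := by
  set c : ℝ → Mat := fun t => NormedSpace.exp ((1 - t) • A) with hc
  have hcd : ∀ t, HasDerivAt c (-(A * NormedSpace.exp ((1 - t) • A))) t := fun t => by
    have h1 := hasDerivAt_exp_smul_const' (𝕂 := ℝ) A (1 - t)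
    have h2 := h1.scomp t ((hasDerivAt_id t).const_sub 1)
    rw [neg_one_smul] at h2
    exact h2
  refine dissMetric_le (c := c) ?_ (fun t _ => exp_mem_SLSymPos (Dev.smul_mem _ hA)) (by simp [hc])
    (by simp [hc]) fun t ht => ?_
  · exact ((contDiff_exp.of_le one_le_two).comp (by fun_prop)).contDiffOn
  have hdw := (hcd t).hasDerivWithinAt.derivWithin (uniqueDiffOn_Icc zero_lt_one t ht)
  erw [hdw]
  set h : Mat := (2⁻¹ : ℝ) • ((1 - t) • A) with hh
  have hhalf : c t = NormedSpace.exp ((2 : ℝ) • h) := by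
    rw [hh, smul_smul]; norm_num [hc]
  have hhalf' : NormedSpace.exp ((1 - t) • A) = NormedSpace.exp ((2 : ℝ) • h) := hhalf
  have hcomm : Commute (NormedSpace.exp (-h)) A := by
    refine Commute.exp_left ?_
    rw [hh]
    exact ((((Commute.refl A).smul_left _).smul_left _)).neg_left
  have hval : NormedSpace.exp (-h) * -(A * NormedSpace.exp ((1 - t) • A)) * NormedSpace.exp (-h)
      = -A := by
    rw [hhalf', exp_two_smul]
    calc _ = -((NormedSpace.exp (-h) * A) * NormedSpace.exp h
          * (NormedSpace.exp h * NormedSpace.exp (-h))) := by noncomm_ring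
      _ = _ := by rw [hcomm.eq, exp_mul_exp_neg, mul_one, mul_assoc, exp_neg_mul_exp, mul_one]
  rw [hhalf, hatR_exp ((hA.1.smul _).smul _), hval, tildeR, if_pos, norm_neg]
  rw [Matrix.trace_neg, hA.2, neg_zero]

theorem norm_real_smul {c : ℝ} (hc : 0 ≤ c) (A : Mat) : ‖c • A‖ = c * ‖A‖ := by
  rw [norm_smul, Real.norm_of_nonneg hc]

theorem norm_coe_dev (z : Dev) : ‖(z : Mat)‖ = ‖z‖ := rfl

theorem ofReal_rescale {ε : ℝ} (hε : 0 < ε) (x r d : ℝ) :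
    ENNReal.ofReal (1 / (2 * ε)) * ENNReal.ofReal (x * (r / 2 * (2 * ε * d)))
      = ENNReal.ofReal (x * (r / 2 * d)) := by
  rw [← ENNReal.ofReal_mul (by positivity)]
  congr 1
  field_simp

/-- The rescaled dissipation distance is uniformly close, up to factors tending to one on bounded
sets, to the dissipation distance of linearized plasticity. -/
theorem exists_Deps_bounds (r : ℝ) (hr : 0 ≤ r) (R : ℝ) {η : ℝ} (hη : 0 < η) :
    ∃ ε₀ > 0, ∀ ε, 0 < ε → ε < ε₀ → ∀ z₁ z₂ : Dev, ‖z₁‖ ≤ R → ‖z₂‖ ≤ R →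
      ENNReal.ofReal ((1 - η) * (r / 2 * ‖z₂ - z₁‖)) ≤ Deps r ε z₁ z₂ ∧
      Deps r ε z₁ z₂ ≤ ENNReal.ofReal ((1 + η) * (r / 2 * ‖z₂ - z₁‖)) := by
  obtain ⟨δ₁, hδ₁, h1⟩ := exists_dissMetric_exp_le r hr hη
  obtain ⟨δ₂, hδ₂, h2⟩ := exists_le_dissMetric_exp r hr hη
  refine ⟨min δ₁ δ₂ / (2 * (|R| + 1)), by positivity, fun ε hε hε' z₁ z₂ hz₁ hz₂ => ?_⟩
  rw [lt_div_iff₀ (by positivity)] at hε'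
  have hsmall : ∀ z : Dev, ‖z‖ ≤ R → ‖(2 * ε) • (z : Mat)‖ ≤ min δ₁ δ₂ := by
    intro z hz
    rw [norm_real_smul (by positivity)]
    have : ‖(z : Mat)‖ ≤ |R| + 1 := hz.trans ((le_abs_self R).trans (by linarith))
    calc 2 * ε * ‖(z : Mat)‖ ≤ 2 * ε * (|R| + 1) := by gcongr
      _ ≤ _ := by linarith
  have hdiff : ‖(2 * ε) • (z₂ : Mat) - (2 * ε) • (z₁ : Mat)‖ = 2 * ε * ‖z₂ - z₁‖ := by
    rw [← smul_sub, norm_real_smul (by positivity), ← norm_coe_dev (z₂ - z₁), Submodule.coe_sub]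
  rw [Deps, ← ofReal_rescale hε (1 - η), ← ofReal_rescale hε (1 + η), ← hdiff]
  exact ⟨mul_le_mul_right (h2 _ _ ((hsmall z₁ hz₁).trans (min_le_right _ _))
      ((hsmall z₂ hz₂).trans (min_le_right _ _))) _,
    mul_le_mul_right (h1 _ (Dev.smul_mem _ z₁.2) _ (Dev.smul_mem _ z₂.2)
      ((hsmall z₁ hz₁).trans (min_le_left _ _)) ((hsmall z₂ hz₂).trans (min_le_left _ _))) _⟩

theorem Deps_zero_le {r ε : ℝ} (hε : 0 < ε) (z : Dev) :
    Deps r ε z 0 ≤ ENNReal.ofReal (r / 2 * ‖z‖) := by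
  have h1 := dissMetric_exp_one_le (r := r) (Dev.smul_mem (2 * ε) z.2)
  rw [norm_real_smul (by positivity), norm_coe_dev] at h1
  have h2 := ofReal_rescale hε 1 r ‖z‖
  rw [one_mul, one_mul] at h2
  rw [Deps, ZeroMemClass.coe_zero, smul_zero, NormedSpace.exp_zero, ← h2]
  exact mul_le_mul_right h1 _

end DissMetric

/-! ### Taylor expansions at critical points and of conjugated exponentials -/

section Expansion

variable {E : Type*} [NormedAddCommGroup E] [NormedSpace ℝ E]

/-- Second-order expansion, at a critical point, of a twice differentiable function composed
with a smooth one. -/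
theorem exists_second_order_expansion {W : E → ℝ} {G : E → E} {x : E}
    (hW : ∀ᶠ F in 𝓝 (G x), DifferentiableAt ℝ W F)
    (hW2 : DifferentiableAt ℝ (fderiv ℝ W) (G x)) (hcrit : fderiv ℝ W (G x) = 0)
    (hG : ContDiffAt ℝ 2 G x) :
    ∃ (Ψ' : E → E →L[ℝ] ℝ) (B : E →L[ℝ] E →L[ℝ] ℝ),
      (∀ᶠ X in 𝓝 x, HasFDerivAt (W ∘ G) (Ψ' X) X) ∧ (∀ u v, B u v = B v u) ∧
      (∀ η > 0, ∀ᶠ X in 𝓝 x, ∀ H, |Ψ' X H - B (X - x) H| ≤ η * ‖X - x‖ * ‖H‖) ∧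
      ∀ η > 0, ∀ᶠ Y in 𝓝 (0 : E),
        |W (G (x + Y)) - W (G x) - 1 / 2 * B Y Y| ≤ η * ‖Y‖ ^ 2 := by
  set Ψ' : E → E →L[ℝ] ℝ := fun X => (fderiv ℝ W (G X)).comp (fderiv ℝ G X) with hΨ'
  have hGev : ∀ᶠ X in 𝓝 x, DifferentiableAt ℝ G X := by
    filter_upwards [hG.eventually (by simp)] with X hX
    exact hX.differentiableAt two_ne_zero
  have hder : ∀ᶠ X in 𝓝 x, HasFDerivAt (W ∘ G) (Ψ' X) X := by
    filter_upwards [hGev, hG.continuousAt.tendsto hW] with X h1 h2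
    exact h2.hasFDerivAt.comp X h1.hasFDerivAt
  have hG' : DifferentiableAt ℝ (fderiv ℝ G) x :=
    (hG.fderiv_right (m := 1) (by norm_num)).differentiableAt one_ne_zero
  have hΨd : DifferentiableAt ℝ Ψ' x :=
    (hW2.comp x (hG.differentiableAt two_ne_zero)).clm_comp hG'
  obtain ⟨B, hB⟩ := hΨd
  -- Criticality removes the zeroth-order part of the derivative, so `Ψ' X` is `B (X - x)` to first
  -- order.
  have hΨ0 : Ψ' x = 0 := by simp [hΨ', hcrit]
  have hexp : ∀ η > 0, ∀ᶠ X in 𝓝 x, ∀ H, |Ψ' X H - B (X - x) H| ≤ η * ‖X - x‖ * ‖H‖ := by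
    intro η hη
    filter_upwards [hB.isLittleO.def hη] with X hX H
    rw [hΨ0, sub_zero] at hX
    calc |Ψ' X H - B (X - x) H| = ‖(Ψ' X - B (X - x)) H‖ := rfl
      _ ≤ _ := ((Ψ' X - B (X - x)).le_opNorm H).trans (by gcongr)
  refine ⟨Ψ', B, hder, second_derivative_symmetric_of_eventually hder hB, hexp, fun η hη => ?_⟩
  obtain ⟨ρ, hρ, hball⟩ := Metric.eventually_nhds_iff_ball.1 (hder.and (hexp η hη))
  filter_upwards [Metric.ball_mem_nhds (0 : E) hρ] with Y hY
  rw [mem_ball_zero_iff] at hY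
  have hin : ∀ t ∈ Icc (0 : ℝ) 1, x + t • Y ∈ Metric.ball x ρ := by
    intro t ht
    rw [mem_ball_iff_norm, add_sub_cancel_left, norm_smul, Real.norm_of_nonneg ht.1]
    nlinarith [norm_nonneg Y, ht.2]
  have hgd : ∀ t ∈ Icc (0 : ℝ) 1, HasDerivWithinAt
      (fun t : ℝ => W (G (x + t • Y)) - 1 / 2 * t ^ 2 * B Y Y)
      (Ψ' (x + t • Y) Y - t * B Y Y) (Icc 0 1) t := by
    intro t ht
    have h1 : HasDerivAt (fun t : ℝ => x + t • Y) Y t := by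
      have := ((hasDerivAt_id t).smul_const Y).const_add x
      rwa [one_smul] at this
    have h2 := (hball _ (hin t ht)).1.comp_hasDerivAt t h1
    have h3 : HasDerivAt (fun t : ℝ => 1 / 2 * t ^ 2 * B Y Y) (t * B Y Y) t := by
      have := (((hasDerivAt_id t).pow 2).const_mul (1 / 2 : ℝ)).mul_const (B Y Y)
      refine this.congr_deriv ?_
      simp
    exact (h2.sub h3).hasDerivWithinAt
  -- Differentiability of the derivative at the single point `x` suffices: the mean value inequality
  -- is applied on the segment to the energy minus its quadratic model.
  have hmv := (convex_Icc (0 : ℝ) 1).norm_image_sub_le_of_norm_hasDerivWithin_le hgd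
    (C := η * ‖Y‖ ^ 2) (fun t ht => ?_) (left_mem_Icc.2 zero_le_one) (right_mem_Icc.2 zero_le_one)
  · rw [Real.norm_eq_abs] at hmv
    simp only [one_smul, zero_smul, add_zero] at hmv
    norm_num at hmv
    convert hmv using 2
    ring
  · have h1 := (hball _ (hin t ht)).2 Y
    rw [add_sub_cancel_left, map_smul, smul_apply, smul_eq_mul, norm_smul,
      Real.norm_of_nonneg ht.1] at h1
    refine h1.trans ?_
    have := mul_le_mul_of_nonneg_left ht.2 (mul_nonneg hη.le (sq_nonneg ‖Y‖))
    linarith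

variable {𝔸 : Type*} [NormedRing 𝔸] [NormedAlgebra ℝ 𝔸] [CompleteSpace 𝔸]

/-- This is differentiability at `(0,0)` of `(y,H) ↦ exp(-y) (1 + 2H) exp(-y)`; to first order the
multiplicative decomposition becomes the additive one, with elastic strain `H - y`. -/
theorem exists_conj_exp_expansion {η : ℝ} (hη : 0 < η) : ∃ δ > 0, ∀ y H : 𝔸, ‖y‖ ≤ δ → ‖H‖ ≤ δ →
    ‖NormedSpace.exp (-y) * (1 + (2 : ℝ) • H) * NormedSpace.exp (-y) - 1 - (2 : ℝ) • (H - y)‖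
      ≤ η * (‖y‖ + ‖H‖) := by
  have hexp : HasFDerivAt (NormedSpace.exp : 𝔸 → 𝔸) (1 : 𝔸 →L[ℝ] 𝔸) (-(0 : 𝔸 × 𝔸).1) := by
    simpa using (hasStrictFDerivAt_exp_zero (𝕂 := ℝ) (𝔸 := 𝔸)).hasFDerivAt
  have h1 : HasFDerivAt (fun p : 𝔸 × 𝔸 => NormedSpace.exp (-p.1))
      (-(ContinuousLinearMap.fst ℝ 𝔸 𝔸)) 0 := by
    have := hexp.comp (0 : 𝔸 × 𝔸) (hasFDerivAt_fst (𝕜 := ℝ) (E := 𝔸) (F := 𝔸) (p := 0)).neg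
    exact this
  have h2 : HasFDerivAt (fun p : 𝔸 × 𝔸 => 1 + (2 : ℝ) • p.2)
      ((2 : ℝ) • ContinuousLinearMap.snd ℝ 𝔸 𝔸) 0 :=
    ((hasFDerivAt_snd (𝕜 := ℝ) (E := 𝔸) (F := 𝔸) (p := 0)).const_smul (2 : ℝ)).const_add 1
  have h3 := ((h1.mul' h2).mul' h1).isLittleO.def hη
  obtain ⟨δ, hδ, hball⟩ := Metric.eventually_nhds_iff_ball.1 h3
  refine ⟨δ / 2, by positivity, fun y H hy hH => ?_⟩
  have h4 := hball (y, H) (by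
    rw [mem_ball_zero_iff, Prod.norm_def]
    exact max_lt (by dsimp only; linarith) (by dsimp only; linarith))
  rw [sub_zero] at h4
  have h5 : ‖((y, H) : 𝔸 × 𝔸)‖ ≤ ‖y‖ + ‖H‖ :=
    max_le (le_add_of_nonneg_right (norm_nonneg _)) (le_add_of_nonneg_left (norm_nonneg _))
  refine le_trans (le_of_eq ?_) (h4.trans (by gcongr))
  congr 1
  simp [two_smul]
  abel

theorem exists_conj_exp_sub_le {η : ℝ} (hη : 0 < η) : ∃ δ > 0, ∀ y : 𝔸, ‖y‖ ≤ δ → ∀ H : 𝔸,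
    ‖NormedSpace.exp (-y) * H * NormedSpace.exp (-y) - H‖ ≤ η * ‖H‖ := by
  set Φ : 𝔸 → 𝔸 →L[ℝ] 𝔸 := fun y =>
    ContinuousLinearMap.mulLeftRight ℝ 𝔸 (NormedSpace.exp (-y)) (NormedSpace.exp (-y)) with hΦ
  have hexp : ContDiff ℝ 2 (NormedSpace.exp : 𝔸 → 𝔸) :=
    contDiff_iff_contDiffAt.2 fun x => (NormedSpace.exp_analytic x).contDiffAt
  have hcont : Continuous Φ := by
    have h1 : Continuous fun y : 𝔸 => NormedSpace.exp (-y) := hexp.continuous.comp (by fun_prop)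
    exact ((ContinuousLinearMap.mulLeftRight ℝ 𝔸).continuous.comp h1).clm_apply h1
  have h0 : Φ 0 = ContinuousLinearMap.id ℝ 𝔸 := by
    ext1 V
    simp [hΦ]
  have hev : ∀ᶠ y in 𝓝 (0 : 𝔸), ‖Φ y - ContinuousLinearMap.id ℝ 𝔸‖ < η := by
    have : Tendsto (fun y => ‖Φ y - ContinuousLinearMap.id ℝ 𝔸‖) (𝓝 0)
        (𝓝 ‖Φ 0 - ContinuousLinearMap.id ℝ 𝔸‖) :=
      ((hcont.sub continuous_const).norm).tendsto 0
    rw [h0, sub_self, norm_zero] at this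
    exact this.eventually_lt_const hη
  obtain ⟨δ, hδ, hball⟩ := Metric.eventually_nhds_iff_ball.1 hev
  refine ⟨δ / 2, by positivity, fun y hy H => ?_⟩
  have h1 := hball y (by rw [mem_ball_zero_iff]; linarith)
  exact ((Φ y - ContinuousLinearMap.id ℝ 𝔸).le_opNorm H).trans (by gcongr)

end Expansion

/-! ### Four-tensors as bilinear forms, and the elastic energy near the identity -/

section Energies

attribute [local instance] Matrix.frobeniusNormedRing Matrix.frobeniusNormedAlgebra

theorem exists_continuous_bilinear {V : Type*} [NormedAddCommGroup V] [NormedSpace ℝ V]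
    [FiniteDimensional ℝ V] (B : V →ₗ[ℝ] V →ₗ[ℝ] ℝ) :
    ∃ a : V →L[ℝ] V →L[ℝ] ℝ, ∀ u v, a u v = B u v :=
  ⟨LinearMap.toContinuousLinearMap
    ((LinearMap.toContinuousLinearMap : (V →ₗ[ℝ] ℝ) ≃ₗ[ℝ] (V →L[ℝ] ℝ)).toLinearMap.comp B),
    fun _ _ => rfl⟩

theorem exists_bilinear_bound {V : Type*} [NormedAddCommGroup V] [NormedSpace ℝ V]
    [FiniteDimensional ℝ V] (B : V →ₗ[ℝ] V →ₗ[ℝ] ℝ) :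
    ∃ M, 0 ≤ M ∧ ∀ u v, |B u v| ≤ M * ‖u‖ * ‖v‖ := by
  obtain ⟨a, ha⟩ := exists_continuous_bilinear B
  exact ⟨‖a‖, norm_nonneg a, fun u v => by rw [← ha]; exact a.le_opNorm₂ u v⟩

/-- The bilinear form of a 4-tensor. -/
def Tensor4.form (K : Tensor4) : Mat →ₗ[ℝ] Mat →ₗ[ℝ] ℝ :=
  LinearMap.mk₂ ℝ (fun A B => contr (K.app A) B)
    (fun A A' B => by
      simp only [contr, Tensor4.app, Matrix.of_apply, Matrix.add_apply, mul_add, add_mul,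
        Finset.sum_add_distrib])
    (fun c A B => by
      simp only [contr, Tensor4.app, Matrix.of_apply, Matrix.smul_apply, smul_eq_mul,
        Finset.mul_sum, Finset.sum_mul]
      refine Finset.sum_congr rfl fun i _ => Finset.sum_congr rfl fun j _ =>
        Finset.sum_congr rfl fun k _ => Finset.sum_congr rfl fun l _ => by ring)
    (fun A B B' => by
      simp only [contr, Matrix.add_apply, mul_add, Finset.sum_add_distrib])
    (fun c A B => by
      simp only [contr, Matrix.smul_apply, smul_eq_mul, Finset.mul_sum]
      refine Finset.sum_congr rfl fun i _ => Finset.sum_congr rfl fun j _ => by ring)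

theorem Tensor4.form_apply (K : Tensor4) (A B : Mat) : K.form A B = contr (K.app A) B := rfl

theorem Tensor4.form_symm {K : Tensor4} (hK : K.IsSymm) (A B : Mat) : K.form A B = K.form B A := by
  simp only [form_apply, contr, Tensor4.app, Matrix.of_apply, Finset.sum_mul]
  have h : ∀ f : Fin 3 → Fin 3 → Fin 3 → Fin 3 → ℝ,
      ∑ i, ∑ j, ∑ l, ∑ k, f i j l k = ∑ l, ∑ k, ∑ i, ∑ j, f i j l k := by
    intro f
    calc ∑ i, ∑ j, ∑ l, ∑ k, f i j l k = ∑ i, ∑ l, ∑ j, ∑ k, f i j l k :=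
          Finset.sum_congr rfl fun i _ => Finset.sum_comm
      _ = ∑ l, ∑ i, ∑ j, ∑ k, f i j l k := Finset.sum_comm
      _ = ∑ l, ∑ i, ∑ k, ∑ j, f i j l k :=
          Finset.sum_congr rfl fun l _ => Finset.sum_congr rfl fun i _ => Finset.sum_comm
      _ = _ := Finset.sum_congr rfl fun l _ => Finset.sum_comm
  rw [h]
  refine Finset.sum_congr rfl fun i _ => Finset.sum_congr rfl fun j _ =>
    Finset.sum_congr rfl fun k _ => Finset.sum_congr rfl fun l _ => ?_
  rw [hK k l i j]
  ring

theorem Tensor4.quad_eq_form (K : Tensor4) (A : Mat) : K.quad A = K.form A A := by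
  simp only [quad, form_apply, contr, mul_comm]

theorem W0_eq (CC HH : Tensor4) (e z : Mat) :
    W0 CC HH e z = 1 / 2 * CC.form (e - z) (e - z) + 1 / 2 * HH.form z z := by
  rw [W0, CC.quad_eq_form, HH.quad_eq_form]

theorem isOpen_GLPos : IsOpen GLPos :=
  isOpen_lt continuous_const (continuous_id.matrix_det)

theorem one_mem_GLPos : (1 : Mat) ∈ GLPos := by
  simp [GLPos]

theorem sqrtM_one : sqrtM 1 = 1 := by
  have := sqrtM_mul_self (S := 1) Matrix.PosSemidef.one
  rwa [one_mul] at this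

theorem hatWe_one {We : Mat → ℝ} {CC : Tensor4}
    (hquad_e : ∀ δ > 0, ∃ c > 0, ∀ A : Mat, A.IsSymm → ‖A‖ ≤ c →
      |hatWe We (1 + (2 : ℝ) • A) - 1 / 2 * CC.quad A| ≤ δ * ‖A‖ ^ 2) : We 1 = 0 := by
  obtain ⟨c, hc, h⟩ := hquad_e 1 one_pos
  have h1 := h 0 Matrix.isSymm_zero (by rw [norm_zero]; exact hc.le)
  rw [CC.quad_eq_form, smul_zero, add_zero, hatWe, sqrtM_one, norm_zero, map_zero] at h1
  simpa using h1

/-- Near the identity, the elastic energy is a differentiable function of the elastic strain,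
and its stress is asymptotically linear with the elasticity tensor as tangent. -/
theorem exists_hatWe_expansion {We : Mat → ℝ} {CC : Tensor4} (hCC : CC.IsSymm)
    (hWe_nonneg : ∀ F ∈ GLPos, 0 ≤ We F) (hWe_C1 : ContDiffOn ℝ 1 We GLPos)
    (hWe_diff2 : DifferentiableAt ℝ (fderiv ℝ We) 1)
    (hquad_e : ∀ δ > 0, ∃ c > 0, ∀ A : Mat, A.IsSymm → ‖A‖ ≤ c →
      |hatWe We (1 + (2 : ℝ) • A) - 1 / 2 * CC.quad A| ≤ δ * ‖A‖ ^ 2) :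
    ∃ (Ψ : Mat → ℝ) (Ψ' : Mat → Mat →L[ℝ] ℝ),
      (∀ᶠ X in 𝓝 (1 : Mat), X.IsSymm → hatWe We X = Ψ X ∧ 0 ≤ Ψ X) ∧
      (∀ᶠ X in 𝓝 (1 : Mat), HasFDerivAt Ψ (Ψ' X) X) ∧
      ∀ η > 0, ∀ᶠ X in 𝓝 (1 : Mat), X.IsSymm → ∀ H : Mat, H.IsSymm →
        |Ψ' X H - CC.form ((2⁻¹ : ℝ) • (X - 1)) ((2⁻¹ : ℝ) • H)| ≤ η * ‖X - 1‖ * ‖H‖ := by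
  obtain ⟨G, hG, hG1, hGsqrt⟩ := exists_local_sqrt
  have hGt : Tendsto G (𝓝 1) (𝓝 1) := by
    have := hG.continuousAt.tendsto
    rwa [hG1] at this
  have hnhds : GLPos ∈ 𝓝 (1 : Mat) := isOpen_GLPos.mem_nhds one_mem_GLPos
  have hWd : ∀ᶠ F in 𝓝 (G 1), DifferentiableAt ℝ We F := by
    rw [hG1]
    filter_upwards [hnhds] with F hF
    exact (hWe_C1.differentiableOn one_ne_zero).differentiableAt (isOpen_GLPos.mem_nhds hF)
  have hW0 := hatWe_one hquad_e
  -- The reference state is stress-free: the energy is nonnegative and vanishes at the identity.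
  have hcrit : fderiv ℝ We (G 1) = 0 := by
    rw [hG1]
    refine IsLocalMin.fderiv_eq_zero ?_
    filter_upwards [hnhds] with F hF
    rw [hW0]
    exact hWe_nonneg F hF
  obtain ⟨Ψ', B, hder, hBs, hexp, hexp2⟩ :=
    exists_second_order_expansion hWd (by rw [hG1]; exact hWe_diff2) hcrit hG
  have hev : ∀ᶠ X in 𝓝 (1 : Mat), X.IsSymm → hatWe We X = We (G X) ∧ 0 ≤ We (G X) := by
    filter_upwards [hGsqrt, hGt hnhds] with X h1 h2 hs
    exact ⟨by rw [hatWe, h1 hs], hWe_nonneg _ h2⟩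
  -- Two quadratic expansions of the same energy along `1 + 2sA` are compared; the factor 4 is the
  -- square of the 2 in that argument. Polarization then covers all symmetric pairs.
  have hBdiag : ∀ A : Mat, A.IsSymm → 4 * B A A = CC.form A A := by
    intro A hA
    have htend : Tendsto (fun s : ℝ => s • A) (𝓝[>] 0) (𝓝 0) := by
      have : Tendsto (fun s : ℝ => s • A) (𝓝 0) (𝓝 ((0 : ℝ) • A)) :=
        (continuous_id.smul continuous_const).tendsto 0
      rw [zero_smul] at this
      exact this.mono_left nhdsWithin_le_nhds
    have hstep : ∀ η > 0, |4 * B A A - CC.form A A| ≤ η * (10 * ‖A‖ ^ 2) := by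
      intro η hη
      obtain ⟨c, hc, hq⟩ := hquad_e η hη
      have h2A : Tendsto (fun s : ℝ => (2 : ℝ) • (s • A)) (𝓝[>] 0) (𝓝 0) := by
        have := htend.const_smul (2 : ℝ)
        rwa [smul_zero] at this
      have h1A : Tendsto (fun s : ℝ => (1 : Mat) + (2 : ℝ) • (s • A)) (𝓝[>] 0) (𝓝 1) := by
        have := h2A.const_add (1 : Mat)
        rwa [add_zero] at this
      have hsmall : ∀ᶠ s in 𝓝[>] (0 : ℝ), ‖s • A‖ ≤ c := by
        have := htend.norm
        rw [norm_zero] at this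
        exact (this.eventually_lt_const hc).mono fun _ h => h.le
      obtain ⟨s, hs1, hs2, hs3, hs4⟩ := (hsmall.and ((h2A.eventually (hexp2 η hη)).and
        ((h1A.eventually hev).and self_mem_nhdsWithin))).exists
      have hs4 : 0 < s := hs4
      have e1 := hq (s • A) (hA.smul s) hs1
      have hsymm : ((1 : Mat) + (2 : ℝ) • (s • A)).IsSymm :=
        Matrix.isSymm_one.add ((hA.smul s).smul 2)
      rw [(hs3 hsymm).1, CC.quad_eq_form] at e1
      rw [hG1, hW0] at hs2
      simp only [map_smul, smul_apply, LinearMap.smul_apply, smul_eq_mul,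
        norm_real_smul hs4.le, norm_real_smul zero_le_two] at e1 hs2
      rw [abs_le] at e1 hs2 ⊢
      have hs2' : 0 < s ^ 2 := by positivity
      constructor <;> refine le_of_mul_le_mul_left ?_ hs2' <;> nlinarith
    have hlim : Tendsto (fun η : ℝ => η * (10 * ‖A‖ ^ 2)) (𝓝[>] 0) (𝓝 (0 * (10 * ‖A‖ ^ 2))) :=
      ((continuous_id.mul continuous_const).tendsto 0).mono_left nhdsWithin_le_nhds
    rw [zero_mul] at hlim
    have h0 := ge_of_tendsto hlim (by filter_upwards [self_mem_nhdsWithin] with η hη using hstep η hη)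
    exact sub_eq_zero.1 (abs_nonpos_iff.1 h0)
  have hBpolar : ∀ A H : Mat, A.IsSymm → H.IsSymm → 4 * B A H = CC.form A H := by
    intro A H hA hH
    have e1 := hBdiag (A + H) (hA.add hH)
    have e2 := hBdiag A hA
    have e3 := hBdiag H hH
    simp only [map_add, add_apply, LinearMap.add_apply] at e1
    rw [hBs H A, CC.form_symm hCC H A] at e1
    linarith
  refine ⟨We ∘ G, Ψ', hev, hder, fun η hη => ?_⟩
  filter_upwards [hexp η hη] with X hX hs H hH
  have e1 := hBpolar (X - 1) H (hs.sub Matrix.isSymm_one) hH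
  have e2 : CC.form ((2⁻¹ : ℝ) • (X - 1)) ((2⁻¹ : ℝ) • H) = B (X - 1) H := by
    rw [map_smul, smul_eq_mul, map_smul, LinearMap.smul_apply, smul_eq_mul, ← e1]
    ring
  rw [e2]
  exact hX H

end Energies

/-! ### Uniform convergence and coercivity of the rescaled energies -/

section Rescaled

attribute [local instance] Matrix.frobeniusNormedRing Matrix.frobeniusNormedAlgebra

/-- The elastic Cauchy-Green tensor of the rescaled model. -/
noncomputable def elasticStrain (ε : ℝ) (e z : Mat) : Mat :=
  NormedSpace.exp (-(ε • z)) * (1 + (2 : ℝ) • (ε • e)) * NormedSpace.exp (-(ε • z))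

theorem elasticStrain_isSymm {ε : ℝ} {e z : Mat} (he : e.IsSymm) (hz : z.IsSymm) :
    (elasticStrain ε e z).IsSymm := by
  have h1 := exp_isSymm (hz.smul ε).neg
  have h2 : (1 + (2 : ℝ) • (ε • e)).IsSymm := Matrix.isSymm_one.add ((he.smul ε).smul 2)
  rw [Matrix.IsSymm, elasticStrain, Matrix.transpose_mul, Matrix.transpose_mul, h1.eq, h2.eq,
    mul_assoc]

theorem Weps_eq (We : Mat → ℝ) (Wp : Mat → ℝ≥0∞) (ε : ℝ) (e : Mat) {z : Mat} (hz : z.IsSymm) :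
    Weps We Wp ε e z = ENNReal.ofReal (1 / ε ^ 2) *
      (ENNReal.ofReal (hatWe We (elasticStrain ε e z))
        + hatWp Wp (NormedSpace.exp ((2 : ℝ) • (ε • z)))) := by
  rw [Weps, hatW, mul_smul, mul_smul, inv_sqrtM_exp (hz.smul ε), elasticStrain]

theorem exists_elasticStrain_bounds {M η : ℝ} (hM : 0 < M) (hη : 0 < η) :
    ∃ ε₀ > 0, ∀ ε, 0 < ε → ε < ε₀ → ∀ e z : Mat, ‖e‖ ≤ M → ‖z‖ ≤ M →
      ‖(ε⁻¹ : ℝ) • ((2⁻¹ : ℝ) • (elasticStrain ε e z - 1)) - (e - z)‖ ≤ η ∧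
      ∀ H : Mat, ‖NormedSpace.exp (-(ε • z)) * H * NormedSpace.exp (-(ε • z)) - H‖ ≤ η * ‖H‖ := by
  -- The tolerance `η / M` turns the error `(η / M)(‖εz‖ + ‖εe‖) ≤ 2εη` into `η` after division by
  -- `2ε`.
  obtain ⟨δ₁, hδ₁, h1⟩ := exists_conj_exp_expansion (𝔸 := Mat) (η := η / M) (by positivity)
  obtain ⟨δ₂, hδ₂, h2⟩ := exists_conj_exp_sub_le (𝔸 := Mat) hη
  refine ⟨min δ₁ δ₂ / M, by positivity, fun ε hε hε' e z he hz => ?_⟩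
  rw [lt_div_iff₀ hM] at hε'
  have hn : ∀ A : Mat, ‖A‖ ≤ M → ‖ε • A‖ ≤ min δ₁ δ₂ := fun A hA => by
    rw [norm_real_smul hε.le]
    exact (mul_le_mul_of_nonneg_left hA hε.le).trans hε'.le
  refine ⟨?_, h2 _ ((hn z hz).trans (min_le_right _ _))⟩
  have h3 := h1 (ε • z) (ε • e) ((hn z hz).trans (min_le_left _ _))
    ((hn e he).trans (min_le_left _ _))
  have h4 : (ε⁻¹ : ℝ) • ((2⁻¹ : ℝ) • (elasticStrain ε e z - 1)) - (e - z)
      = (ε⁻¹ * 2⁻¹ : ℝ) • (elasticStrain ε e z - 1 - (2 : ℝ) • (ε • e - ε • z)) := by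
    rw [smul_sub _ _ ((2 : ℝ) • _), smul_smul (ε⁻¹), smul_smul (ε⁻¹ * 2⁻¹), ← smul_sub ε e z,
      smul_smul _ ε]
    rw [show ε⁻¹ * 2⁻¹ * 2 * ε = 1 by field_simp, one_smul]
  rw [h4, norm_real_smul (by positivity)]
  calc ε⁻¹ * 2⁻¹ * ‖elasticStrain ε e z - 1 - (2 : ℝ) • (ε • e - ε • z)‖
      ≤ ε⁻¹ * 2⁻¹ * (η / M * (‖ε • z‖ + ‖ε • e‖)) := mul_le_mul_of_nonneg_left h3 (by positivity)
    _ ≤ ε⁻¹ * 2⁻¹ * (η / M * (ε * M + ε * M)) := by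
        rw [norm_real_smul hε.le, norm_real_smul hε.le]
        gcongr
    _ = η := by field_simp; norm_num

theorem form_add_sub_le {B : Mat →ₗ[ℝ] Mat →ₗ[ℝ] ℝ} {M : ℝ}
    (hB : ∀ u v, |B u v| ≤ M * ‖u‖ * ‖v‖) (u v x y : Mat) :
    |B (u + x) (v + y) - B u v| ≤ M * ‖u‖ * ‖y‖ + M * ‖x‖ * ‖v‖ + M * ‖x‖ * ‖y‖ := by
  have h : B (u + x) (v + y) - B u v = B u y + B x v + B x y := by
    simp only [map_add, LinearMap.add_apply]; ring
  rw [h]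
  refine (abs_add_le _ _).trans (add_le_add ((abs_add_le _ _).trans (add_le_add ?_ ?_)) ?_)
  · exact hB _ _
  · exact hB _ _
  · exact hB _ _

theorem elasticStrain_sub_one {ε : ℝ} (hε : 0 < ε) {e z : Mat} {x : Mat}
    (hx : x = (ε⁻¹ : ℝ) • ((2⁻¹ : ℝ) • (elasticStrain ε e z - 1)) - (e - z)) :
    (2⁻¹ : ℝ) • (elasticStrain ε e z - 1) = ε • ((e - z) + x) := by
  rw [hx, add_sub_cancel, smul_smul, mul_inv_cancel₀ hε.ne', one_smul]

/-- Uniform convergence of the rescaled energies on bounded sets. -/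
theorem exists_Weps_approx {We : Mat → ℝ} {Wp : Mat → ℝ≥0∞} {CC HH : Tensor4} (hCC : CC.IsSymm)
    (hWe_nonneg : ∀ F ∈ GLPos, 0 ≤ We F) (hWe_C1 : ContDiffOn ℝ 1 We GLPos)
    (hWe_diff2 : DifferentiableAt ℝ (fderiv ℝ We) 1)
    (hquad_e : ∀ δ > 0, ∃ c > 0, ∀ A : Mat, A.IsSymm → ‖A‖ ≤ c →
      |hatWe We (1 + (2 : ℝ) • A) - 1 / 2 * CC.quad A| ≤ δ * ‖A‖ ^ 2)
    (hquad_p : ∀ δ > 0, ∃ c > 0, ∀ A ∈ Dev, ‖A‖ ≤ c →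
      hatWp Wp (NormedSpace.exp ((2 : ℝ) • A)) ≠ ⊤ ∧
      |(hatWp Wp (NormedSpace.exp ((2 : ℝ) • A))).toReal - 1 / 2 * HH.quad A| ≤ δ * ‖A‖ ^ 2)
    {M η : ℝ} (hM : 0 < M) (hη : 0 < η) :
    ∃ ε₀ > 0, ∀ ε, 0 < ε → ε < ε₀ → ∀ z ∈ Dev, ‖z‖ ≤ M → ∀ e : Mat, e.IsSymm → ‖e‖ ≤ M →
      Weps We Wp ε e z ≠ ⊤ ∧ |(Weps We Wp ε e z).toReal - W0 CC HH e z| ≤ η := by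
  obtain ⟨Ψ, -, hΨ, -, -⟩ := exists_hatWe_expansion hCC hWe_nonneg hWe_C1 hWe_diff2 hquad_e
  obtain ⟨ρ, hρ, hΨ⟩ := Metric.eventually_nhds_iff_ball.1 hΨ
  obtain ⟨K, hK, hKb⟩ := exists_bilinear_bound CC.form
  -- The three terms bound, per unit of `θ`, the error of the linearized strain inside `ℂ`, of the
  -- elastic expansion and of the plastic expansion.
  set Q : ℝ := 1 / 2 * K * (4 * M + 1) + (2 * M + 1) ^ 2 + M ^ 2 with hQ
  have hQ0 : 0 < Q := by positivity
  set θ : ℝ := min 1 (η / Q) with hθ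
  have hθ0 : 0 < θ := by positivity
  have hθ1 : θ ≤ 1 := min_le_left _ _
  have hθQ : θ * Q ≤ η := by
    calc θ * Q ≤ η / Q * Q := by gcongr; exact min_le_right _ _
      _ = η := by field_simp
  obtain ⟨c₁, hc₁, he⟩ := hquad_e θ hθ0
  obtain ⟨c₂, hc₂, hp⟩ := hquad_p θ hθ0
  obtain ⟨ε₁, hε₁, hstrain⟩ := exists_elasticStrain_bounds hM hθ0
  refine ⟨min ε₁ (min (min (c₁ / (2 * M + 1)) (ρ / (2 * (2 * M + 1)))) (c₂ / M)), by positivity,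
    fun ε hε hε' z hz hzM e hes heM => ?_⟩
  rw [lt_min_iff, lt_min_iff, lt_min_iff, lt_div_iff₀ (by positivity), lt_div_iff₀ (by positivity),
    lt_div_iff₀ hM] at hε'
  obtain ⟨hε1, ⟨hε2, hε3⟩, hε4⟩ := hε'
  set X := elasticStrain ε e z with hX
  have hXs : X.IsSymm := elasticStrain_isSymm hes hz.1
  set A := (2⁻¹ : ℝ) • (X - 1) with hA
  have hXA : X = 1 + (2 : ℝ) • A := by rw [hA, smul_smul]; norm_num
  have hAs : A.IsSymm := (hXs.sub Matrix.isSymm_one).smul _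
  obtain ⟨x, hx⟩ : ∃ x, x = (ε⁻¹ : ℝ) • ((2⁻¹ : ℝ) • (elasticStrain ε e z - 1)) - (e - z) :=
    ⟨_, rfl⟩
  have hxn : ‖x‖ ≤ θ := by
    rw [hx]; exact (hstrain ε hε hε1 e z heM hzM).1
  have hAe : A = ε • ((e - z) + x) := elasticStrain_sub_one hε hx
  have hw : ‖e - z‖ ≤ 2 * M := (norm_sub_le _ _).trans (by linarith)
  have hwx : ‖(e - z) + x‖ ≤ 2 * M + 1 := (norm_add_le _ _).trans (by linarith)
  have hAn : ‖A‖ ≤ ε * (2 * M + 1) := by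
    rw [hAe, norm_real_smul hε.le]; gcongr
  have hXball : X ∈ Metric.ball (1 : Mat) ρ := by
    rw [mem_ball_iff_norm, hXA, add_sub_cancel_left, norm_real_smul zero_le_two]
    linarith
  obtain ⟨hΨ1, hΨ2⟩ := hΨ X hXball hXs
  have hWnn : 0 ≤ hatWe We X := by rw [hΨ1]; exact hΨ2
  have hεz : ‖ε • z‖ ≤ c₂ := by
    rw [norm_real_smul hε.le]
    exact (mul_le_mul_of_nonneg_left hzM hε.le).trans hε4.le
  obtain ⟨hp1, hp2⟩ := hp (ε • z) (Dev.smul_mem _ hz) hεz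
  have he1 := he A hAs (by linarith)
  rw [← hXA] at he1
  rw [Weps_eq We Wp ε e hz.1]
  refine ⟨ENNReal.mul_ne_top ENNReal.ofReal_ne_top
    (ENNReal.add_ne_top.2 ⟨ENNReal.ofReal_ne_top, hp1⟩), ?_⟩
  rw [ENNReal.toReal_mul, ENNReal.toReal_add ENNReal.ofReal_ne_top hp1,
    ENNReal.toReal_ofReal (by positivity), ENNReal.toReal_ofReal hWnn, W0_eq]
  rw [CC.quad_eq_form] at he1
  rw [HH.quad_eq_form] at hp2
  have hform := form_add_sub_le hKb (e - z) (e - z) x x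
  have hA2 : CC.form A A = ε ^ 2 * CC.form ((e - z) + x) ((e - z) + x) := by
    rw [hAe]
    simp only [map_smul, LinearMap.smul_apply, smul_eq_mul]
    ring
  have hz2 : HH.form (ε • z) (ε • z) = ε ^ 2 * HH.form z z := by
    simp only [map_smul, LinearMap.smul_apply, smul_eq_mul]
    ring
  rw [hA2, hAe, norm_real_smul hε.le] at he1
  rw [hz2, norm_real_smul hε.le] at hp2
  have hform' : |CC.form ((e - z) + x) ((e - z) + x) - CC.form (e - z) (e - z)|
      ≤ θ * (K * (4 * M + 1)) := by
    refine hform.trans ?_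
    calc K * ‖e - z‖ * ‖x‖ + K * ‖x‖ * ‖e - z‖ + K * ‖x‖ * ‖x‖
        ≤ K * (2 * M) * θ + K * θ * (2 * M) + K * θ * 1 := by gcongr; linarith
      _ = _ := by ring
  have hε2' : 0 < ε ^ 2 := by positivity
  have he2 : |1 / ε ^ 2 * hatWe We X - 1 / 2 * CC.form ((e - z) + x) ((e - z) + x)|
      ≤ θ * (2 * M + 1) ^ 2 := by
    have : 1 / ε ^ 2 * hatWe We X - 1 / 2 * CC.form ((e - z) + x) ((e - z) + x)
        = 1 / ε ^ 2 * (hatWe We X - 1 / 2 * (ε ^ 2 * CC.form ((e - z) + x) ((e - z) + x))) := by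
      field_simp
    rw [this, abs_mul, abs_of_pos (by positivity : (0 : ℝ) < 1 / ε ^ 2)]
    calc _ ≤ 1 / ε ^ 2 * (θ * (ε * ‖(e - z) + x‖) ^ 2) := by gcongr
      _ = θ * ‖(e - z) + x‖ ^ 2 := by field_simp
      _ ≤ _ := by gcongr
  have hp3 : |1 / ε ^ 2 * (hatWp Wp (NormedSpace.exp ((2 : ℝ) • (ε • z)))).toReal
      - 1 / 2 * HH.form z z| ≤ θ * M ^ 2 := by
    have : 1 / ε ^ 2 * (hatWp Wp (NormedSpace.exp ((2 : ℝ) • (ε • z)))).toReal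
        - 1 / 2 * HH.form z z = 1 / ε ^ 2 * ((hatWp Wp (NormedSpace.exp ((2 : ℝ) • (ε • z)))).toReal
          - 1 / 2 * (ε ^ 2 * HH.form z z)) := by
      field_simp
    rw [this, abs_mul, abs_of_pos (by positivity : (0 : ℝ) < 1 / ε ^ 2)]
    calc _ ≤ 1 / ε ^ 2 * (θ * (ε * ‖z‖) ^ 2) := by gcongr
      _ = θ * ‖z‖ ^ 2 := by field_simp
      _ ≤ _ := by gcongr
  rw [abs_le] at *
  rw [hQ] at hθQ
  constructor <;> linarith

/-- Uniform convergence of the rescaled powers on bounded sets. -/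
theorem exists_power_approx {We : Mat → ℝ} {Wp : Mat → ℝ≥0∞} {CC HH : Tensor4} (hCC : CC.IsSymm)
    (hWe_nonneg : ∀ F ∈ GLPos, 0 ≤ We F) (hWe_C1 : ContDiffOn ℝ 1 We GLPos)
    (hWe_diff2 : DifferentiableAt ℝ (fderiv ℝ We) 1)
    (hquad_e : ∀ δ > 0, ∃ c > 0, ∀ A : Mat, A.IsSymm → ‖A‖ ≤ c →
      |hatWe We (1 + (2 : ℝ) • A) - 1 / 2 * CC.quad A| ≤ δ * ‖A‖ ^ 2)
    (hquad_p : ∀ δ > 0, ∃ c > 0, ∀ A ∈ Dev, ‖A‖ ≤ c →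
      hatWp Wp (NormedSpace.exp ((2 : ℝ) • A)) ≠ ⊤ ∧
      |(hatWp Wp (NormedSpace.exp ((2 : ℝ) • A))).toReal - 1 / 2 * HH.quad A| ≤ δ * ‖A‖ ^ 2)
    {M η : ℝ} (hM : 0 < M) (hη : 0 < η) :
    ∃ ε₀ > 0, ∀ ε, 0 < ε → ε < ε₀ → ∀ z ∈ Dev, ‖z‖ ≤ M →
      ∀ (S : Set ℝ) (e : ℝ → Mat) (e' : Mat), (∀ s ∈ S, (e s).IsSymm) → (∀ s ∈ S, ‖e s‖ ≤ M) →
        ∀ t ∈ S, HasDerivWithinAt e e' S t → e'.IsSymm → ‖e'‖ ≤ M →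
        ∃ p : ℝ, HasDerivWithinAt (fun s => (Weps We Wp ε (e s) z).toReal) p S t ∧
          |p - CC.form (e t - z) e'| ≤ η := by
  obtain ⟨Ψ, Ψ', hΨ, hΨd, hΨe⟩ :=
    exists_hatWe_expansion hCC hWe_nonneg hWe_C1 hWe_diff2 hquad_e
  obtain ⟨K, hK, hKb⟩ := exists_bilinear_bound CC.form
  -- The first term is the error of the linearized stress, the second that of replacing strain and
  -- strain rate by `e t - z` and `e'`.
  set Q : ℝ := 4 * (2 * M + 1) * (2 * M) + K * (2 * M * M + M + M) with hQ
  have hQ0 : 0 < Q := by positivity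
  set θ : ℝ := min 1 (η / Q) with hθ
  have hθ0 : 0 < θ := by positivity
  have hθ1 : θ ≤ 1 := min_le_left _ _
  have hθQ : θ * Q ≤ η := by
    calc θ * Q ≤ η / Q * Q := by gcongr; exact min_le_right _ _
      _ = η := by field_simp
  obtain ⟨ρ, hρ, hball⟩ := Metric.eventually_nhds_iff_ball.1 (hΨ.and (hΨd.and (hΨe θ hθ0)))
  -- The plastic energy is constant in time for fixed `z`; only its finiteness is needed.
  obtain ⟨c₂, hc₂, hp⟩ := hquad_p 1 one_pos
  obtain ⟨ε₁, hε₁, hstrain⟩ := exists_elasticStrain_bounds hM hθ0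
  refine ⟨min ε₁ (min (ρ / (2 * (2 * M + 1))) (c₂ / M)), by positivity,
    fun ε hε hε' z hz hzM S e e' hes heM t ht hder he's he'M => ?_⟩
  rw [lt_min_iff, lt_min_iff, lt_div_iff₀ (by positivity), lt_div_iff₀ hM] at hε'
  obtain ⟨hε1, hε3, hε4⟩ := hε'
  have hXball : ∀ s ∈ S, elasticStrain ε (e s) z ∈ Metric.ball (1 : Mat) ρ := by
    intro s hs
    have h1 := (hstrain ε hε hε1 (e s) z (heM s hs) hzM).1
    have h2 := elasticStrain_sub_one hε (e := e s) (z := z) rfl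
    have h3 : ‖(2⁻¹ : ℝ) • (elasticStrain ε (e s) z - 1)‖ ≤ ε * (2 * M + 1) := by
      rw [h2, norm_real_smul hε.le]
      gcongr
      refine (norm_add_le _ _).trans ?_
      have := (norm_sub_le (e s) z).trans (add_le_add (heM s hs) hzM)
      linarith
    rw [norm_real_smul (by norm_num)] at h3
    rw [mem_ball_iff_norm]
    linarith
  have hεz : ‖ε • z‖ ≤ c₂ := by
    rw [norm_real_smul hε.le]
    exact (mul_le_mul_of_nonneg_left hzM hε.le).trans hε4.le
  have hp1 := (hp (ε • z) (Dev.smul_mem _ hz) hεz).1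
  have heq : ∀ s ∈ S, (Weps We Wp ε (e s) z).toReal = 1 / ε ^ 2 * (Ψ (elasticStrain ε (e s) z)
      + (hatWp Wp (NormedSpace.exp ((2 : ℝ) • (ε • z)))).toReal) := by
    intro s hs
    obtain ⟨h1, h2⟩ := (hball _ (hXball s hs)).1 (elasticStrain_isSymm (hes s hs) hz.1)
    rw [Weps_eq We Wp ε (e s) hz.1, ENNReal.toReal_mul,
      ENNReal.toReal_add ENNReal.ofReal_ne_top hp1, ENNReal.toReal_ofReal (by positivity),
      ENNReal.toReal_ofReal (by rw [h1]; exact h2), h1]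
  set P := NormedSpace.exp (-(ε • z)) with hP
  set V : Mat := P * ((2 : ℝ) • (ε • e')) * P with hV
  have hXd : HasDerivWithinAt (fun s => elasticStrain ε (e s) z) V S t := by
    have h1 : HasDerivWithinAt (fun s => (1 : Mat) + (2 : ℝ) • (ε • e s)) ((2 : ℝ) • (ε • e')) S t :=
      ((hder.const_smul ε).const_smul (2 : ℝ)).const_add 1
    exact (h1.const_mul P).mul_const P
  obtain ⟨-, hΨdt, hΨet⟩ := hball _ (hXball t ht)
  have hPs : P.IsSymm := exp_isSymm (hz.1.smul ε).neg
  have hVs : V.IsSymm := by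
    rw [Matrix.IsSymm, hV, Matrix.transpose_mul, Matrix.transpose_mul, hPs.eq,
      ((he's.smul ε).smul 2).eq, mul_assoc]
  refine ⟨1 / ε ^ 2 * Ψ' (elasticStrain ε (e t) z) V, ?_, ?_⟩
  · refine HasDerivWithinAt.congr ?_ heq (heq t ht)
    exact ((hΨdt.comp_hasDerivWithinAt t hXd).add_const _).const_mul _
  obtain ⟨hb1, hb2⟩ := hstrain ε hε hε1 (e t) z (heM t ht) hzM
  obtain ⟨x, hx⟩ : ∃ x, x = (ε⁻¹ : ℝ) • ((2⁻¹ : ℝ) • (elasticStrain ε (e t) z - 1)) - (e t - z) :=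
    ⟨_, rfl⟩
  rw [← hx] at hb1
  have hXx := elasticStrain_sub_one hε hx
  obtain ⟨y, hy⟩ : ∃ y, y = P * e' * P - e' := ⟨_, rfl⟩
  have hyn : ‖y‖ ≤ θ * M := by
    rw [hy]; exact (hb2 e').trans (by gcongr)
  have hVy : (2⁻¹ : ℝ) • V = ε • (e' + y) := by
    rw [hV, hy, add_sub_cancel, Matrix.mul_smul, Matrix.mul_smul, Matrix.smul_mul, Matrix.smul_mul,
      smul_smul]
    norm_num
  have hw : ‖e t - z‖ ≤ 2 * M := (norm_sub_le _ _).trans (by linarith [heM t ht])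
  have hwx : ‖(e t - z) + x‖ ≤ 2 * M + 1 := (norm_add_le _ _).trans (by linarith)
  have hey : ‖e' + y‖ ≤ 2 * M := (norm_add_le _ _).trans (by nlinarith)
  have hXn : ‖elasticStrain ε (e t) z - 1‖ = 2 * ε * ‖(e t - z) + x‖ := by
    have := congrArg norm hXx
    rw [norm_real_smul (by norm_num), norm_real_smul hε.le] at this
    linarith
  have hVn : ‖V‖ = 2 * ε * ‖e' + y‖ := by
    have := congrArg norm hVy
    rw [norm_real_smul (by norm_num), norm_real_smul hε.le] at this
    linarith
  have hmain := hΨet (elasticStrain_isSymm (hes t ht) hz.1) V hVs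
  rw [hXx, hVy, hXn, hVn] at hmain
  simp only [map_smul, LinearMap.smul_apply, smul_eq_mul] at hmain
  have hform := form_add_sub_le hKb (e t - z) e' x y
  have hform' : |CC.form ((e t - z) + x) (e' + y) - CC.form (e t - z) e'|
      ≤ θ * (K * (2 * M * M + M + M)) := by
    refine hform.trans ?_
    calc K * ‖e t - z‖ * ‖y‖ + K * ‖x‖ * ‖e'‖ + K * ‖x‖ * ‖y‖
        ≤ K * (2 * M) * (θ * M) + K * θ * M + K * 1 * (θ * M) := by gcongr; linarith
      _ = _ := by ring
  have hp2 : |1 / ε ^ 2 * Ψ' (elasticStrain ε (e t) z) V - CC.form ((e t - z) + x) (e' + y)|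
      ≤ θ * (4 * (2 * M + 1) * (2 * M)) := by
    have : 1 / ε ^ 2 * Ψ' (elasticStrain ε (e t) z) V - CC.form ((e t - z) + x) (e' + y)
        = 1 / ε ^ 2 * (Ψ' (elasticStrain ε (e t) z) V
          - ε * (ε * CC.form ((e t - z) + x) (e' + y))) := by
      field_simp
    rw [this, abs_mul, abs_of_pos (by positivity : (0 : ℝ) < 1 / ε ^ 2)]
    calc _ ≤ 1 / ε ^ 2 * (θ * (2 * ε * ‖(e t - z) + x‖) * (2 * ε * ‖e' + y‖)) := by gcongr
      _ = θ * (4 * ‖(e t - z) + x‖ * ‖e' + y‖) := by field_simp; ring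
      _ ≤ _ := by gcongr
  rw [abs_le] at *
  rw [hQ] at hθQ
  constructor <;> linarith

/-- Coercivity of the rescaled energies. -/
theorem Weps_coercive {We : Mat → ℝ} {Wp : Mat → ℝ≥0∞} {c₃ : ℝ}
    (hcoer : ∀ A ∈ Dev,
      ENNReal.ofReal (c₃ * ‖A‖ ^ 2) ≤ hatWp Wp (NormedSpace.exp ((2 : ℝ) • A)))
    {ε : ℝ} (hε : 0 < ε) (e : Mat) {z : Mat} (hz : z ∈ Dev) :
    ENNReal.ofReal (c₃ * ‖z‖ ^ 2) ≤ Weps We Wp ε e z := by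
  have h1 := hcoer (ε • z) (Dev.smul_mem _ hz)
  rw [Weps_eq We Wp ε e hz.1]
  calc ENNReal.ofReal (c₃ * ‖z‖ ^ 2)
      = ENNReal.ofReal (1 / ε ^ 2) * ENNReal.ofReal (c₃ * ‖ε • z‖ ^ 2) := by
        rw [← ENNReal.ofReal_mul (by positivity), norm_real_smul hε.le]
        congr 1
        field_simp
    _ ≤ _ := mul_le_mul_right (h1.trans le_add_self) _

/-- The elasticity tensor is nonnegative on symmetric tensors. -/
theorem CC_form_nonneg {We : Mat → ℝ} {CC : Tensor4} (hCC : CC.IsSymm)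
    (hWe_nonneg : ∀ F ∈ GLPos, 0 ≤ We F) (hWe_C1 : ContDiffOn ℝ 1 We GLPos)
    (hWe_diff2 : DifferentiableAt ℝ (fderiv ℝ We) 1)
    (hquad_e : ∀ δ > 0, ∃ c > 0, ∀ A : Mat, A.IsSymm → ‖A‖ ≤ c →
      |hatWe We (1 + (2 : ℝ) • A) - 1 / 2 * CC.quad A| ≤ δ * ‖A‖ ^ 2)
    {A : Mat} (hA : A.IsSymm) : 0 ≤ CC.form A A := by
  obtain ⟨Ψ, -, hΨ, -, -⟩ := exists_hatWe_expansion hCC hWe_nonneg hWe_C1 hWe_diff2 hquad_e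
  obtain ⟨ρ, hρ, hΨ⟩ := Metric.eventually_nhds_iff_ball.1 hΨ
  -- A quadratic approximation of a nonnegative energy cannot be negative beyond its error, as the
  -- scaled argument `s • A` shows.
  have hstep : ∀ η > 0, -(η * (2 * ‖A‖ ^ 2)) ≤ CC.form A A := by
    intro η hη
    obtain ⟨c, hc, hq⟩ := hquad_e η hη
    set s := min c (ρ / 4) / (‖A‖ + 1) with hs
    have hs0 : 0 < s := by positivity
    have hsA : ‖s • A‖ ≤ min c (ρ / 4) := by
      rw [norm_real_smul hs0.le, hs, div_mul_eq_mul_div, div_le_iff₀ (by positivity)]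
      gcongr
      linarith
    have h1 := hq (s • A) (hA.smul s) (hsA.trans (min_le_left _ _))
    have h2 := hΨ (1 + (2 : ℝ) • (s • A)) (by
      rw [mem_ball_iff_norm, add_sub_cancel_left, norm_real_smul zero_le_two]
      have := hsA.trans (min_le_right _ _)
      linarith) (Matrix.isSymm_one.add ((hA.smul s).smul 2))
    rw [h2.1, CC.quad_eq_form, norm_real_smul hs0.le] at h1
    simp only [map_smul, LinearMap.smul_apply, smul_eq_mul] at h1
    have h3 := (abs_le.1 h1).2
    have h4 := h2.2
    have hs2 : 0 < s ^ 2 := by positivity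
    refine le_of_mul_le_mul_left ?_ hs2
    nlinarith
  have hlim : Tendsto (fun η : ℝ => -(η * (2 * ‖A‖ ^ 2))) (𝓝[>] 0) (𝓝 (-(0 * (2 * ‖A‖ ^ 2)))) :=
    ((continuous_id.mul continuous_const).neg.tendsto 0).mono_left nhdsWithin_le_nhds
  rw [zero_mul, neg_zero] at hlim
  exact le_of_tendsto hlim (by filter_upwards [self_mem_nhdsWithin] with η hη using hstep η hη)

/-- The hardening tensor is coercive on deviatoric tensors. -/
theorem HH_form_coercive {Wp : Mat → ℝ≥0∞} {HH : Tensor4} {c₃ : ℝ} (hc₃ : 0 < c₃)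
    (hcoer : ∀ A ∈ Dev,
      ENNReal.ofReal (c₃ * ‖A‖ ^ 2) ≤ hatWp Wp (NormedSpace.exp ((2 : ℝ) • A)))
    (hquad_p : ∀ δ > 0, ∃ c > 0, ∀ A ∈ Dev, ‖A‖ ≤ c →
      hatWp Wp (NormedSpace.exp ((2 : ℝ) • A)) ≠ ⊤ ∧
      |(hatWp Wp (NormedSpace.exp ((2 : ℝ) • A))).toReal - 1 / 2 * HH.quad A| ≤ δ * ‖A‖ ^ 2)
    {A : Mat} (hA : A ∈ Dev) : c₃ * ‖A‖ ^ 2 ≤ HH.form A A := by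
  -- With tolerance `c₃ / 2`, `½ ℍ` retains the coefficient `c₃ / 2` of the lower bound `c₃ ‖A‖²`.
  obtain ⟨c, hc, hq⟩ := hquad_p (c₃ / 2) (by positivity)
  set s := c / (‖A‖ + 1) with hs
  have hs0 : 0 < s := by positivity
  have hsA : ‖s • A‖ ≤ c := by
    rw [norm_real_smul hs0.le, hs, div_mul_eq_mul_div, div_le_iff₀ (by positivity)]
    gcongr
    linarith
  obtain ⟨h1, h2⟩ := hq (s • A) (Dev.smul_mem _ hA) hsA
  have h3 := ENNReal.toReal_mono h1 (hcoer (s • A) (Dev.smul_mem _ hA))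
  rw [ENNReal.toReal_ofReal (by positivity)] at h3
  rw [HH.quad_eq_form] at h2
  rw [norm_real_smul hs0.le] at h2 h3
  simp only [map_smul, LinearMap.smul_apply, smul_eq_mul] at h2
  have h4 := (abs_le.1 h2).2
  have hs2 : 0 < s ^ 2 := by positivity
  refine le_of_mul_le_mul_left ?_ hs2
  nlinarith

end Rescaled

/-! ### Quadratic rate-independent systems and their approximations -/

section Evolution

variable {V : Type*} [NormedAddCommGroup V] [NormedSpace ℝ V]

/-- The quadratic energy `½ a v v - ℓ t v + c t`. -/
noncomputable def energy (a : V →L[ℝ] V →L[ℝ] ℝ) (ℓ : ℝ → V →L[ℝ] ℝ) (c : ℝ → ℝ) (v : V) (t : ℝ) : ℝ :=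
  1 / 2 * a v v - ℓ t v + c t

/-- The dissipation distance `κ ‖w - v‖`. -/
noncomputable def normDist (κ : ℝ) (v w : V) : ℝ≥0∞ := ENNReal.ofReal (κ * ‖w - v‖)

/-- Quadratic rate-independent systems with a regular loading. -/
structure IsQuadraticSystem (a : V →L[ℝ] V →L[ℝ] ℝ) (ℓ : ℝ → V →L[ℝ] ℝ) (c : ℝ → ℝ)
    (p : V → ℝ → ℝ) (κ α Λ T : ℝ) : Prop where
  symm : ∀ u v, a u v = a v u
  pos_κ : 0 < κ
  pos_α : 0 < α
  pos_T : 0 < T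
  nonneg_Λ : 0 ≤ Λ
  coercive : ∀ v, α * ‖v‖ ^ 2 ≤ a v v
  energy_coercive : ∀ v, ∀ t ∈ Icc 0 T, α / 2 * ‖v‖ ^ 2 ≤ energy a ℓ c v t
  hasDeriv : ∀ v, ∀ t ∈ Icc 0 T, HasDerivWithinAt (energy a ℓ c v) (p v t) (Icc 0 T) t
  power_continuousOn : ∀ v, ContinuousOn (p v) (Icc 0 T)
  power_lipschitz : ∀ t ∈ Icc 0 T, ∀ v w, |p v t - p w t| ≤ Λ * ‖v - w‖

/-- Closeness, on a ball of radius `R`, of energy and dissipation to a quadratic system. -/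
structure IsApproximation (a : V →L[ℝ] V →L[ℝ] ℝ) (ℓ : ℝ → V →L[ℝ] ℝ) (c : ℝ → ℝ)
    (p : V → ℝ → ℝ) (κ α T η R : ℝ) (E : V → ℝ → EReal) (D : V → V → ℝ≥0∞) : Prop where
  energy_coercive : ∀ v, ∀ t ∈ Icc 0 T, ((α / 2 * ‖v‖ ^ 2 : ℝ) : EReal) ≤ E v t
  dist_zero : ∀ v, D v 0 ≤ ENNReal.ofReal (κ * ‖v‖)
  energy_approx : ∀ v, ‖v‖ ≤ R → ∀ t ∈ Icc 0 T, ∃ x : ℝ, E v t = x ∧ |x - energy a ℓ c v t| ≤ η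
  le_dist : ∀ v w, ‖v‖ ≤ R → ‖w‖ ≤ R → ENNReal.ofReal ((1 - η) * (κ * ‖w - v‖)) ≤ D v w
  dist_le : ∀ v w, ‖v‖ ≤ R → ‖w‖ ≤ R → D v w ≤ ENNReal.ofReal ((1 + η) * (κ * ‖w - v‖))
  power_approx : ∀ v, ‖v‖ ≤ R → ∀ t ∈ Icc 0 T, |power T E v t - p v t| ≤ η

variable {a : V →L[ℝ] V →L[ℝ] ℝ} {ℓ : ℝ → V →L[ℝ] ℝ} {c : ℝ → ℝ} {p : V → ℝ → ℝ} {κ α Λ T : ℝ}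

namespace IsQuadraticSystem

variable (hs : IsQuadraticSystem a ℓ c p κ α Λ T)

include hs

theorem power_eq (v : V) {t : ℝ} (ht : t ∈ Icc 0 T) :
    power T (fun v t => (energy a ℓ c v t : EReal)) v t = p v t :=
  (hs.hasDeriv v t ht).derivWithin (uniqueDiffOn_Icc hs.pos_T t ht)

theorem integral_power (v : V) {s s' : ℝ} (h0 : 0 ≤ s) (h : s ≤ s') (h' : s' ≤ T) :
    ∫ τ in s..s', p v τ = energy a ℓ c v s' - energy a ℓ c v s := by
  have hsub : Icc s s' ⊆ Icc 0 T := Icc_subset_Icc h0 h'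
  apply intervalIntegral.integral_eq_sub_of_hasDeriv_right_of_le h
  · exact fun τ hτ => ((hs.hasDeriv v τ (hsub hτ)).continuousWithinAt).mono hsub
  · intro τ hτ
    refine (hs.hasDeriv v τ (hsub (Ioo_subset_Icc_self hτ))).mono_of_mem_nhdsWithin ?_
    exact mem_nhdsWithin_of_mem_nhds (mem_of_superset (Icc_mem_nhds hτ.1 hτ.2) hsub)
  · exact ((hs.power_continuousOn v).mono hsub).intervalIntegrable_of_Icc h

/-- The difference of the powers at `v` and `0` integrates to minus the increment of `ℓ` applied to
`v`, so the Lipschitz bound on the power controls the loading. -/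
theorem norm_loading_sub_le {s s' : ℝ} (h0 : 0 ≤ s) (h : s ≤ s') (h' : s' ≤ T) :
    ‖ℓ s' - ℓ s‖ ≤ Λ * (s' - s) := by
  refine ContinuousLinearMap.opNorm_le_bound _ (mul_nonneg hs.nonneg_Λ (by linarith)) fun v => ?_
  have hsub : Icc s s' ⊆ Icc 0 T := Icc_subset_Icc h0 h'
  have hi : ∀ v, IntervalIntegrable (p v) volume s s' := fun v =>
    ((hs.power_continuousOn v).mono hsub).intervalIntegrable_of_Icc h
  have h1 : (ℓ s' - ℓ s) v = -∫ τ in s..s', (p v τ - p 0 τ) := by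
    rw [intervalIntegral.integral_sub (hi v) (hi 0), hs.integral_power v h0 h h',
      hs.integral_power 0 h0 h h']
    simp only [energy, map_zero, sub_apply]
    ring
  rw [h1, norm_neg]
  refine (intervalIntegral.norm_integral_le_of_norm_le_const (C := Λ * ‖v‖) ?_).trans ?_
  · intro τ hτ
    rw [uIoc_of_le h] at hτ
    simpa using hs.power_lipschitz τ (hsub (Ioc_subset_Icc_self hτ)) v 0
  · rw [abs_of_nonneg (by linarith)]
    exact le_of_eq (by ring)

/-- The loading is extended by its endpoint values outside `[0,T]`, because the Euler construction
assumes a Lipschitz loading on the whole line. -/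
theorem exists_quasistatic [FiniteDimensional ℝ V] {z₀ : V}
    (hz₀ : ∀ v, ℓ 0 v - a z₀ v ≤ κ * ‖v‖) :
    ∃ (z : ℝ → V) (L C : ℝ), z 0 = z₀ ∧ 0 ≤ L ∧ IsQuasistatic a ℓ κ T L C z := by
  set ℓ' : ℝ → V →L[ℝ] ℝ := fun t => ℓ (projIcc 0 T hs.pos_T.le t) with hℓ'
  have heq : ∀ t ∈ Icc 0 T, ℓ' t = ℓ t := fun t ht => by
    simp only [hℓ', projIcc_of_mem _ ht]
  have hlip : ∀ s s', ‖ℓ' s' - ℓ' s‖ ≤ Λ * |s' - s| := by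
    have hle : ∀ s s', s ≤ s' → ‖ℓ' s' - ℓ' s‖ ≤ Λ * |s' - s| := by
      intro s s' h
      have hm : ((projIcc 0 T hs.pos_T.le s : Icc 0 T) : ℝ) ≤ projIcc 0 T hs.pos_T.le s' :=
        monotone_projIcc hs.pos_T.le h
      refine (hs.norm_loading_sub_le (projIcc 0 T hs.pos_T.le s).2.1 hm
        (projIcc 0 T hs.pos_T.le s').2.2).trans ?_
      rw [← abs_of_nonneg (sub_nonneg.2 hm)]
      exact mul_le_mul_of_nonneg_left (abs_projIcc_sub_projIcc hs.pos_T.le) hs.nonneg_Λ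
    intro s s'
    rcases le_total s s' with h | h
    · exact hle s s' h
    · rw [norm_sub_rev, abs_sub_comm]; exact hle s' s h
  have h0 : (0 : ℝ) ∈ Icc 0 T := ⟨le_rfl, hs.pos_T.le⟩
  obtain ⟨z, hz, hq⟩ := exists_isQuasistatic hs.symm hs.pos_α hs.coercive hs.pos_κ.le hs.nonneg_Λ
    hlip z₀ (by rw [heq 0 h0]; exact hz₀) T
  refine ⟨z, Λ / α, (Λ + ‖a‖ * (Λ / α)) * (Λ / α), hz, div_nonneg hs.nonneg_Λ hs.pos_α.le, hq.lipschitz, ?_, ?_⟩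
  · intro s h1 h2
    have := hq.stable s h1 h2
    rwa [heq s ⟨h1, h2⟩] at this
  · intro s s' h1 h2 h3
    have := hq.flow s s' h1 h2 h3
    rwa [heq s ⟨h1, h2.trans h3⟩] at this

theorem power_comp_continuousOn {z : ℝ → V} {L : ℝ}
    (hz : ∀ s s', 0 ≤ s → s ≤ s' → s' ≤ T → ‖z s' - z s‖ ≤ L * (s' - s)) :
    ContinuousOn (fun t => p (z t) t) (Icc 0 T) := by
  intro t ht
  have h1 : Tendsto (fun s => p (z t) s) (𝓝[Icc 0 T] t) (𝓝 (p (z t) t)) :=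
    hs.power_continuousOn (z t) t ht
  have h2 : Tendsto (fun s => p (z s) s - p (z t) s) (𝓝[Icc 0 T] t) (𝓝 0) := by
    have h3 : Tendsto (fun s => Λ * (L * |s - t|)) (𝓝[Icc 0 T] t) (𝓝 (Λ * (L * |t - t|))) :=
      ((by fun_prop : Continuous fun s => Λ * (L * |s - t|)).tendsto t).mono_left
        nhdsWithin_le_nhds
    rw [sub_self, abs_zero, mul_zero, mul_zero] at h3
    refine squeeze_zero_norm' ?_ h3
    filter_upwards [self_mem_nhdsWithin] with s hs'
    refine (hs.power_lipschitz s hs' _ _).trans (mul_le_mul_of_nonneg_left ?_ hs.nonneg_Λ)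
    rcases le_total t s with h | h
    · rw [abs_of_nonneg (by linarith)]
      exact hz t s ht.1 h hs'.2
    · rw [norm_sub_rev, abs_of_nonpos (by linarith), neg_sub]
      exact hz s t hs'.1 h ht.2
  have h4 := h2.add h1
  rw [zero_add] at h4
  exact h4.congr fun s => by ring

/-- Convexity upgrades first-order stability to global stability. The function `b`, work minus
stored energy, bounds the dissipation from above, and the total dissipation is itself a
superadditive bound to which the second half of `IsQuasistatic.balance` applies. -/
theorem isEnergeticSolution {z : ℝ → V} {L C : ℝ} (hz : IsQuasistatic a ℓ κ T L C z) :
    IsEnergeticSolution T (fun v t => (energy a ℓ c v t : EReal)) (normDist κ) (z 0) z := by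
  have hpc := hs.power_comp_continuousOn hz.lipschitz
  have hpw : ∀ t ∈ Icc 0 T, power T (fun v t => (energy a ℓ c v t : EReal)) (z t) t = p (z t) t :=
    fun t ht => hs.power_eq (z t) ht
  have hint : ∀ t ∈ Icc 0 T, IntervalIntegrable (fun t => p (z t) t) volume 0 t := fun t ht =>
    (hpc.mono (Icc_subset_Icc_right ht.2)).intervalIntegrable_of_Icc ht.1
  refine ⟨rfl, fun t ht => ⟨EReal.coe_lt_top _, fun v => ?_⟩, fun t ht => ?_, ?_, fun t ht => ?_⟩
  · rw [normDist, EReal.coe_ennreal_ofReal, max_eq_left (mul_nonneg hs.pos_κ.le (norm_nonneg _)),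
      ← EReal.coe_add, EReal.coe_le_coe_iff]
    have h1 := hz.stable t ht.1 ht.2 (v - z t)
    have h2 := hs.coercive (v - z t)
    have h3 : 0 ≤ a (v - z t) (v - z t) := le_trans (mul_nonneg hs.pos_α.le (sq_nonneg _)) h2
    simp only [map_sub, sub_apply, energy] at *
    rw [hs.symm v (z t)] at h3
    linarith
  · exact (hs.hasDeriv (z t) t ht).differentiableWithinAt
  · refine (hint T ⟨hs.pos_T.le, le_rfl⟩).congr ?_
    intro t ht
    rw [uIoc_of_le hs.pos_T.le] at ht
    exact (hpw t (Ioc_subset_Icc_self ht)).symm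
  · set G : ℝ → ℝ := fun t => ∫ s in (0 : ℝ)..t, p (z s) s with hG
    have hGsub : ∀ s s', 0 ≤ s → s ≤ s' → s' ≤ T →
        |G s' - G s - ((c s' - ℓ s' (z s)) - (c s - ℓ s (z s)))| ≤ Λ * L * (s' - s) ^ 2 := by
      intro s s' h0 h h'
      have hsub : Icc s s' ⊆ Icc 0 T := Icc_subset_Icc h0 h'
      have h1 : G s' - G s = ∫ τ in s..s', p (z τ) τ :=
        intervalIntegral.integral_interval_sub_left (hint s' ⟨h0.trans h, h'⟩)
          (hint s ⟨h0, h.trans h'⟩)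
      have h2 : (c s' - ℓ s' (z s)) - (c s - ℓ s (z s)) = ∫ τ in s..s', p (z s) τ := by
        rw [hs.integral_power (z s) h0 h h', energy, energy]; ring
      rw [h1, h2, ← intervalIntegral.integral_sub
        ((hpc.mono hsub).intervalIntegrable_of_Icc h)
        (((hs.power_continuousOn (z s)).mono hsub).intervalIntegrable_of_Icc h)]
      rw [← Real.norm_eq_abs]
      refine (intervalIntegral.norm_integral_le_of_norm_le_const
        (C := Λ * (L * (s' - s))) fun τ hτ => ?_).trans (le_of_eq ?_)
      · rw [uIoc_of_le h] at hτ
        refine (hs.power_lipschitz τ (hsub (Ioc_subset_Icc_self hτ)) _ _).trans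
          (mul_le_mul_of_nonneg_left ?_ hs.nonneg_Λ)
        have hL : 0 ≤ L := by
          have h3 := (norm_nonneg _).trans (hz.lipschitz s τ h0 hτ.1.le (hτ.2.trans h'))
          exact nonneg_of_mul_nonneg_left h3 (by linarith [hτ.1])
        refine (hz.lipschitz s τ h0 hτ.1.le (hτ.2.trans h')).trans ?_
        gcongr
        exact hτ.2
      · rw [abs_of_nonneg (by linarith)]; ring
    obtain ⟨hb1, hb2⟩ := hz.balance hs.symm hs.nonneg_Λ
      (fun s s' h0 h h' => hs.norm_loading_sub_le h0 h h') hGsub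
      (b := fun s => G s - energy a ℓ c (z s) s) (fun s => rfl)
    have hle : diss (normDist κ) t z
        ≤ ENNReal.ofReal ((G t - energy a ℓ c (z t) t) - (G 0 - energy a ℓ c (z 0) 0)) := by
      refine diss_le_of_le_sub _ _ (g := fun s => G s - energy a ℓ c (z s) s)
        fun s s' h0 h h' => ?_
      have h1 := hb1 s s' h0 h (h'.trans ht.2)
      refine ⟨?_, ENNReal.ofReal_le_ofReal h1⟩
      have : 0 ≤ κ * ‖z s' - z s‖ := mul_nonneg hs.pos_κ.le (norm_nonneg _)
      linarith
    have hfin : diss (normDist κ) t z ≠ ⊤ := ne_top_of_le_ne_top ENNReal.ofReal_ne_top hle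
    have hge := hb2 (fun s => (diss (normDist κ) s z).toReal) t ht.1 ht.2 fun s s' h0 h h' => by
      have h1 := toReal_le_diss_sub (normDist κ) z h0 h
        (ne_top_of_le_ne_top hfin (diss_mono _ _ (h0.trans h) h'))
      rwa [normDist, ENNReal.toReal_ofReal (mul_nonneg hs.pos_κ.le (norm_nonneg _))] at h1
    have hnn : 0 ≤ (diss (normDist κ) 0 z).toReal := ENNReal.toReal_nonneg
    have hb0 : 0 ≤ (G t - energy a ℓ c (z t) t) - (G 0 - energy a ℓ c (z 0) 0) := by
      have h1 := hb1 0 t le_rfl ht.1 ht.2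
      have : 0 ≤ κ * ‖z t - z 0‖ := mul_nonneg hs.pos_κ.le (norm_nonneg _)
      linarith
    have hle' := ENNReal.toReal_mono ENNReal.ofReal_ne_top hle
    rw [ENNReal.toReal_ofReal hb0] at hle'
    have hdiss : (diss (normDist κ) t z).toReal
        = (G t - energy a ℓ c (z t) t) - (G 0 - energy a ℓ c (z 0) 0) := by
      linarith
    have hG0 : G 0 = 0 := by simp [hG]
    have hGt : ∫ s in (0 : ℝ)..t, power T (fun v t => (energy a ℓ c v t : EReal)) (z s) s = G t := by
      refine intervalIntegral.integral_congr fun s hs' => ?_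
      rw [uIcc_of_le ht.1] at hs'
      exact hpw s ⟨hs'.1, hs'.2.trans ht.2⟩
    rw [hGt, ← ENNReal.ofReal_toReal hfin, hdiss, EReal.coe_ennreal_ofReal, max_eq_left hb0,
      ← EReal.coe_add, ← EReal.coe_add, hG0]
    congr 1
    ring

/-- The limit system approximates itself. -/
theorem isApproximation {η : ℝ} (hη : 0 ≤ η) (R : ℝ) :
    IsApproximation a ℓ c p κ α T η R (fun v t => (energy a ℓ c v t : EReal)) (normDist κ) where
  energy_coercive v t ht := EReal.coe_le_coe_iff.2 (hs.energy_coercive v t ht)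
  dist_zero v := by rw [normDist, zero_sub, norm_neg]
  energy_approx v _ t _ := ⟨_, rfl, by rwa [sub_self, abs_zero]⟩
  le_dist v w _ _ := by
    refine ENNReal.ofReal_le_ofReal ?_
    have : 0 ≤ κ * ‖w - v‖ := mul_nonneg hs.pos_κ.le (norm_nonneg _)
    nlinarith
  dist_le v w _ _ := by
    refine ENNReal.ofReal_le_ofReal ?_
    have : 0 ≤ κ * ‖w - v‖ := mul_nonneg hs.pos_κ.le (norm_nonneg _)
    nlinarith
  power_approx v _ t ht := by rwa [hs.power_eq v ht, sub_self, abs_zero]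

/-- A priori bound for stable states of approximations. -/
theorem exists_stable_bound : ∃ R, 0 < R ∧ ∀ (E : V → ℝ → EReal) (D : V → V → ℝ≥0∞),
    IsApproximation a ℓ c p κ α T 1 0 E D → ∀ t ∈ Icc 0 T, ∀ v ∈ stableStates E D t, ‖v‖ ≤ R := by
  have hc : ContinuousOn (fun t => energy a ℓ c 0 t) (Icc 0 T) := fun t ht =>
    (hs.hasDeriv 0 t ht).continuousWithinAt
  obtain ⟨M, hM⟩ := isCompact_Icc.exists_bound_of_continuousOn hc
  have hα := hs.pos_α
  have hκ := hs.pos_κ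
  have hM0 : 0 ≤ M := (norm_nonneg _).trans (hM 0 ⟨le_rfl, hs.pos_T.le⟩)
  refine ⟨1 + (M + 1 + κ) / (α / 2), by positivity, fun E D h t ht v hv => ?_⟩
  -- Only the zero state is tested, so an approximation on the ball of radius 0 suffices: `α/2 ‖v‖²
  -- ≤ M + 1 + κ ‖v‖`.
  obtain ⟨x, hx, hx'⟩ := h.energy_approx 0 norm_zero.le t ht
  have h1 := hv.2 0
  have h2 : ((α / 2 * ‖v‖ ^ 2 : ℝ) : EReal) ≤ ((x + κ * ‖v‖ : ℝ) : EReal) := by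
    refine (h.energy_coercive v t ht).trans (h1.trans ?_)
    rw [hx, EReal.coe_add]
    refine add_le_add le_rfl ?_
    refine (EReal.coe_ennreal_le_coe_ennreal_iff.2 (h.dist_zero v)).trans (le_of_eq ?_)
    rw [EReal.coe_ennreal_ofReal, max_eq_left (by positivity)]
  rw [EReal.coe_le_coe_iff] at h2
  have h3 := (abs_le.1 hx').2
  have h4 := (le_abs_self _).trans (hM t ht)
  by_cases h5 : ‖v‖ ≤ 1
  · exact h5.trans (le_add_of_nonneg_right (by positivity))
  push Not at h5
  refine le_trans ?_ (le_add_of_nonneg_left zero_le_one)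
  rw [le_div_iff₀ (by positivity)]
  have h6 : ‖v‖ * (‖v‖ * (α / 2)) ≤ ‖v‖ * (M + 1 + κ) := by nlinarith
  exact le_of_mul_le_mul_left h6 (by linarith)

/-- Stable states of approximations are approximately stable for the quadratic system. -/
theorem exists_approx_stable (R : ℝ) {η₁ : ℝ} (hη₁ : 0 < η₁) :
    ∃ η₀ > 0, ∀ η, 0 ≤ η → η ≤ η₀ → ∀ (E : V → ℝ → EReal) (D : V → V → ℝ≥0∞),
      IsApproximation a ℓ c p κ α T η (R + 1) E D → ∀ t ∈ Icc 0 T, ∀ w ∈ stableStates E D t,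
        ‖w‖ ≤ R → ∀ v, ℓ t v - a w v ≤ (κ + η₁) * ‖v‖ := by
  have hκ := hs.pos_κ
  -- Stability is tested at a fixed distance `x`, not infinitesimally: `x` makes the quadratic term
  -- small, and `η` is then chosen small relative to `x` so that the energy errors survive division
  -- by `x`.
  set x : ℝ := min 1 (η₁ / (‖a‖ + 1)) with hx
  have hx0 : 0 < x := by positivity
  have hx1 : x ≤ 1 := min_le_left _ _
  have hxa : x * ‖a‖ ≤ η₁ := by
    calc x * ‖a‖ ≤ η₁ / (‖a‖ + 1) * (‖a‖ + 1) := by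
          gcongr
          · exact min_le_right _ _
          · linarith
      _ = η₁ := by field_simp
  refine ⟨x * η₁ / (2 * (κ + 2)), by positivity, fun η hη0 hη E D h t ht w hw hwR v => ?_⟩
  rw [le_div_iff₀ (by positivity)] at hη
  rcases eq_or_ne v 0 with rfl | hv
  · simp
  have hvn : 0 < ‖v‖ := norm_pos_iff.2 hv
  obtain ⟨u, hu⟩ : ∃ u : V, u = ‖v‖⁻¹ • v := ⟨_, rfl⟩
  have hun : ‖u‖ = 1 := by rw [hu, norm_smul, norm_inv, norm_norm, inv_mul_cancel₀ hvn.ne']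
  have hvu : v = ‖v‖ • u := by rw [hu, smul_smul, mul_inv_cancel₀ hvn.ne', one_smul]
  have hxu : ‖x • u‖ = x := by rw [norm_smul, hun, mul_one, Real.norm_of_nonneg hx0.le]
  have hwR' : ‖w‖ ≤ R + 1 := by linarith
  have hwx : ‖w + x • u‖ ≤ R + 1 := (norm_add_le _ _).trans (by linarith)
  obtain ⟨y, hy, hy'⟩ := h.energy_approx w hwR' t ht
  obtain ⟨y₁, hy₁, hy₁'⟩ := h.energy_approx (w + x • u) hwx t ht
  have h1 := hw.2 (w + x • u)
  have h2 : ((y : ℝ) : EReal) ≤ ((y₁ + (1 + η) * (κ * x) : ℝ) : EReal) := by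
    rw [← hy]
    refine h1.trans ?_
    rw [hy₁, EReal.coe_add]
    refine add_le_add le_rfl ?_
    refine (EReal.coe_ennreal_le_coe_ennreal_iff.2 (h.dist_le w _ hwR' hwx)).trans (le_of_eq ?_)
    rw [add_sub_cancel_left, hxu, EReal.coe_ennreal_ofReal, max_eq_left (by positivity)]
  rw [EReal.coe_le_coe_iff] at h2
  have h3 := (abs_le.1 hy').1
  have h4 := (abs_le.1 hy₁').2
  have h5 : a u u ≤ ‖a‖ := by
    refine (Real.le_norm_self _).trans ((a.le_opNorm₂ u u).trans ?_)
    rw [hun, mul_one, mul_one]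
  have h6 : ℓ t u - a w u ≤ κ + η₁ := by
    simp only [energy, map_add, map_smul, add_apply, smul_apply, smul_eq_mul, hs.symm u w] at h3 h4
    refine le_of_mul_le_mul_left ?_ hx0
    have h7 : x ^ 2 * a u u ≤ x * η₁ := by
      have := mul_le_mul_of_nonneg_left h5 (sq_nonneg x)
      have := mul_le_mul_of_nonneg_left hxa hx0.le
      nlinarith
    have h8 : η * (κ * x) ≤ η * κ := by
      have := mul_le_mul_of_nonneg_left hx1 (mul_nonneg hη0 hκ.le)
      linarith
    nlinarith
  have h7 := congrArg (fun v => ℓ t v - a w v) hvu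
  simp only [map_smul, smul_eq_mul] at h7
  rw [h7, ← mul_sub, mul_comm (κ + η₁)]
  exact mul_le_mul_of_nonneg_left h6 hvn.le

end IsQuadraticSystem

end Evolution

/-! ### Convergence of approximating trajectories and uniqueness -/

section Convergence

variable {V : Type*} [NormedAddCommGroup V] [NormedSpace ℝ V]
variable {a : V →L[ℝ] V →L[ℝ] ℝ} {ℓ : ℝ → V →L[ℝ] ℝ} {c : ℝ → ℝ} {p : V → ℝ → ℝ} {κ α Λ T : ℝ}

/-- The energy balance of an energetic solution in terms of real numbers. -/
theorem IsEnergeticSolution.real_balance {Z : Type*} {E : Z → ℝ → EReal} {D : Z → Z → ℝ≥0∞} {q₀ : Z}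
    {q : ℝ → Z} (h : IsEnergeticSolution T E D q₀ q) {t x x₀ : ℝ} (ht : t ∈ Icc 0 T)
    (hx : E (q t) t = x) (hx₀ : E (q 0) 0 = x₀) :
    diss D t q ≠ ⊤ ∧
      x + (diss D t q).toReal = x₀ + ∫ s in (0 : ℝ)..t, power T E (q s) s := by
  have h1 := h.balance t ht
  rw [hx, hx₀, ← EReal.coe_add] at h1
  have hfin : diss D t q ≠ ⊤ := by
    intro htop
    rw [htop, EReal.coe_ennreal_top, EReal.coe_add_top] at h1
    exact EReal.coe_ne_top _ h1.symm
  refine ⟨hfin, ?_⟩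
  rw [← ENNReal.ofReal_toReal hfin, EReal.coe_ennreal_ofReal, max_eq_left ENNReal.toReal_nonneg,
    ← EReal.coe_add, EReal.coe_eq_coe_iff] at h1
  exact h1

namespace IsQuadraticSystem

variable (hs : IsQuadraticSystem a ℓ c p κ α Λ T)

include hs

theorem exists_energy_bound (R : ℝ) :
    ∃ M, 0 ≤ M ∧ ∀ v, ‖v‖ ≤ R → ∀ t ∈ Icc 0 T, |energy a ℓ c v t| ≤ M ∧ |p v t| ≤ M := by
  have hc : ContinuousOn (fun t => energy a ℓ c 0 t) (Icc 0 T) := fun t ht =>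
    (hs.hasDeriv 0 t ht).continuousWithinAt
  obtain ⟨M₁, hM₁⟩ := isCompact_Icc.exists_bound_of_continuousOn hc
  obtain ⟨M₂, hM₂⟩ := isCompact_Icc.exists_bound_of_continuousOn (hs.power_continuousOn 0)
  have hT := hs.pos_T.le
  have hΛ := hs.nonneg_Λ
  have h1 : 0 ≤ M₁ := (norm_nonneg _).trans (hM₁ 0 ⟨le_rfl, hT⟩)
  have h2 : 0 ≤ M₂ := (norm_nonneg _).trans (hM₂ 0 ⟨le_rfl, hT⟩)
  refine ⟨M₁ + M₂ + 1 / 2 * ‖a‖ * |R| ^ 2 + (‖ℓ 0‖ + Λ * T) * |R| + Λ * |R|, by positivity,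
    fun v hv t ht => ?_⟩
  have hv' : ‖v‖ ≤ |R| := hv.trans (le_abs_self R)
  have e1 : |a v v| ≤ ‖a‖ * |R| ^ 2 := by
    refine (a.le_opNorm₂ v v).trans ?_
    rw [mul_assoc, sq]; gcongr
  have e2 : |ℓ t v| ≤ (‖ℓ 0‖ + Λ * T) * |R| := by
    refine ((ℓ t).le_opNorm v).trans ?_
    gcongr
    calc ‖ℓ t‖ = ‖ℓ 0 + (ℓ t - ℓ 0)‖ := by congr 1; abel
      _ ≤ ‖ℓ 0‖ + Λ * (t - 0) := (norm_add_le _ _).trans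
          (add_le_add le_rfl (hs.norm_loading_sub_le le_rfl ht.1 ht.2))
      _ ≤ _ := by rw [sub_zero]; gcongr; exact ht.2
  have e3 : |energy a ℓ c 0 t| ≤ M₁ := hM₁ t ht
  have e4 : |p 0 t| ≤ M₂ := hM₂ t ht
  have e5 : |p v t - p 0 t| ≤ Λ * |R| := by
    refine (hs.power_lipschitz t ht v 0).trans ?_
    rw [sub_zero]; gcongr
  have e6 : 0 ≤ 1 / 2 * ‖a‖ * |R| ^ 2 := by positivity
  have e7 : 0 ≤ (‖ℓ 0‖ + Λ * T) * |R| := by positivity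
  have e8 : 0 ≤ Λ * |R| := by positivity
  simp only [energy, map_zero, mul_zero, sub_zero, zero_add] at e3 ⊢
  rw [abs_le] at *
  rw [abs_le]
  refine ⟨⟨?_, ?_⟩, ?_, ?_⟩ <;> linarith

/-- Energetic solutions of approximations stay close to quasistatic trajectories. -/
theorem exists_comparison {z : ℝ → V} {L C : ℝ} (hL : 0 ≤ L) (hz : IsQuasistatic a ℓ κ T L C z)
    {R η₁ : ℝ} (hη₁ : 0 < η₁) :
    ∃ η₀ > 0, ∀ (E : V → ℝ → EReal) (D : V → V → ℝ≥0∞),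
      IsApproximation a ℓ c p κ α T η₀ (R + 1) E D →
      ∀ (w₀ : V) (w : ℝ → V), IsEnergeticSolution T E D w₀ w → (∀ t ∈ Icc 0 T, ‖w t‖ ≤ R) →
        ∀ t ∈ Icc 0 T, 1 / 2 * a (w t - z t) (w t - z t)
          ≤ 1 / 2 * a (w 0 - z 0) (w 0 - z 0) + η₁ := by
  have hT := hs.pos_T
  have hκ := hs.pos_κ
  have hΛ := hs.nonneg_Λ
  set η₂ : ℝ := η₁ / (1 + (1 + L) * T) with hη₂
  have hη₂0 : 0 < η₂ := by positivity
  obtain ⟨η₃, hη₃, hst⟩ := hs.exists_approx_stable R hη₂0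
  obtain ⟨M, hM, hMb⟩ := hs.exists_energy_bound R
  -- `Dm` bounds the total dissipation through the energy balance: two energies, two approximation
  -- errors and the work.
  set Dm : ℝ := 2 * M + 2 + (M + 1) * T with hDm
  have hDm0 : 0 < Dm := by positivity
  set η : ℝ := min (min (1 / 2) η₃) (η₂ / (2 + 2 * Dm)) with hη
  have hη0 : 0 < η := by positivity
  have hηhalf : η ≤ 1 / 2 := (min_le_left _ _).trans (min_le_left _ _)
  have hηη₃ : η ≤ η₃ := (min_le_left _ _).trans (min_le_right _ _)
  have hηη₂ : η * (2 + 2 * Dm) ≤ η₂ := by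
    rw [← le_div_iff₀ (by positivity)]; exact min_le_right _ _
  refine ⟨η, hη0, fun E D hA w₀ w hw hwR t ht => ?_⟩
  have hsub : ∀ {s}, 0 ≤ s → s ≤ t → s ∈ Icc 0 T := fun h h' => ⟨h, h'.trans ht.2⟩
  have hwR' : ∀ s ∈ Icc 0 T, ‖w s‖ ≤ R + 1 := fun s hs' => (hwR s hs').trans (by linarith)
  have h0mem : (0 : ℝ) ∈ Icc 0 T := ⟨le_rfl, hT.le⟩
  obtain ⟨x, hx, hx'⟩ := hA.energy_approx (w t) (hwR' t ht) t ht
  obtain ⟨x₀, hx₀, hx₀'⟩ := hA.energy_approx (w 0) (hwR' 0 h0mem) 0 h0mem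
  obtain ⟨hfin, hbal⟩ := hw.real_balance ht hx hx₀
  have hpint : ∀ s s', 0 ≤ s → s ≤ s' → s' ≤ t →
      IntervalIntegrable (fun τ => power T E (w τ) τ) volume s s' := fun s s' h0 h h' => by
    refine hw.power_integrable.mono_set ?_
    rw [uIcc_of_le h, uIcc_of_le hT.le]
    exact Icc_subset_Icc h0 (h'.trans ht.2)
  have hpbound : ∀ s ∈ Icc 0 T, |power T E (w s) s| ≤ M + 1 := fun s hs' => by
    have e1 := hA.power_approx (w s) (hwR' s hs') s hs'
    have e2 := (hMb (w s) (hwR s hs') s hs').2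
    rw [abs_le] at *
    constructor <;> linarith
  set d : ℝ → ℝ := fun s => (diss D s w).toReal with hd
  -- For `η ≤ 1/2`, `(1 + 2η)(1 - η) ≥ 1`, so the inflated dissipation dominates `κ ‖w s' - w s‖`.
  -- The excess `2 η d t` is absorbed in `η₂`.
  set g : ℝ → ℝ := fun s => (1 + 2 * η) * d s with hg
  set G : ℝ → ℝ := fun s => ∫ τ in (0 : ℝ)..s, power T E (w τ) τ with hG
  have hGt : |G t| ≤ (M + 1) * T := by
    have e1 := intervalIntegral.norm_integral_le_of_norm_le_const (a := 0) (b := t) (C := M + 1)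
      (f := fun τ => power T E (w τ) τ) fun τ hτ => by
        rw [uIoc_of_le ht.1] at hτ
        exact hpbound τ (hsub hτ.1.le hτ.2)
    rw [sub_zero, abs_of_nonneg ht.1] at e1
    refine e1.trans ?_
    gcongr
    exact ht.2
  have hdt : d t ≤ Dm := by
    have e1 := (hMb (w t) (hwR t ht) t ht).1
    have e2 := (hMb (w 0) (hwR 0 h0mem) 0 h0mem).1
    change x + d t = x₀ + G t at hbal
    rw [abs_le] at *
    linarith
  have hdg : ∀ s s', 0 ≤ s → s ≤ s' → s' ≤ t → κ * ‖w s' - w s‖ ≤ g s' - g s := by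
    intro s s' h0 h h'
    have e1 := toReal_le_diss_sub D w h0 h
      (ne_top_of_le_ne_top hfin (diss_mono D w (h0.trans h) h'))
    have hDfin : D (w s) (w s') ≠ ⊤ := ne_top_of_le_ne_top hfin
      ((le_add_self.trans (diss_add_le D w h0 h)).trans (diss_mono D w (h0.trans h) h'))
    have e2 := ENNReal.toReal_mono hDfin (hA.le_dist (w s) (w s')
      (hwR' s (hsub h0 (h.trans h'))) (hwR' s' (hsub (h0.trans h) h')))
    have e3 : 0 ≤ κ * ‖w s' - w s‖ := by positivity
    rw [ENNReal.toReal_ofReal (mul_nonneg (by linarith) e3)] at e2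
    have e4 : (1 - η) * (κ * ‖w s' - w s‖) ≤ d s' - d s := e2.trans e1
    have e5 : κ * ‖w s' - w s‖ ≤ (1 + 2 * η) * ((1 - η) * (κ * ‖w s' - w s‖)) := by
      have : 0 ≤ (η * (1 - 2 * η)) * (κ * ‖w s' - w s‖) :=
        mul_nonneg (mul_nonneg hη0.le (by linarith)) e3
      linarith
    have e6 := mul_le_mul_of_nonneg_left e4 (by positivity : 0 ≤ 1 + 2 * η)
    simp only [hg]
    linarith
  have hmain := hz.comparison hs.symm (w := w) (g := g) (G := G) (c := c) (B := Λ / κ) (η := η₂)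
    (t := t) hη₂0.le ht.1 ht.2
    (fun s h0 h => hst η hη0.le hηη₃ E D hA s (hsub h0 h) (w s) (hw.stable s (hsub h0 h))
      (hwR s (hsub h0 h))) hdg ?_ ?_
  · refine hmain.trans ?_
    have e1 : η₂ * (1 + (1 + L) * T) = η₁ := by rw [hη₂]; field_simp
    have e2 : (η₂ + η₂ * L) * t ≤ (η₂ + η₂ * L) * T := by
      gcongr
      exact ht.2
    linarith
  · intro s s' h0 h h'
    have e1 : G s' - G s = ∫ τ in s..s', power T E (w τ) τ :=
      intervalIntegral.integral_interval_sub_left (hpint 0 s' le_rfl (h0.trans h) h')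
        (hpint 0 s le_rfl h0 (h.trans h'))
    have hpc := (hs.power_continuousOn (w s)).mono (Icc_subset_Icc h0 (h'.trans ht.2))
    have e2 : ∫ τ in s..s', power T E (w τ) τ
        ≤ ∫ τ in s..s', (p (w s) τ + (η₂ + Λ / κ * (g s' - g s))) := by
      refine intervalIntegral.integral_mono_on h (hpint s s' h0 h h')
        ((hpc.intervalIntegrable_of_Icc h).add intervalIntegrable_const) fun τ hτ => ?_
      have hτT : τ ∈ Icc 0 T := hsub (h0.trans hτ.1) (hτ.2.trans h')
      have f1 := (abs_le.1 (hA.power_approx (w τ) (hwR' τ hτT) τ hτT)).2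
      have f2 := (abs_le.1 (hs.power_lipschitz τ hτT (w τ) (w s))).2
      have f3 := hdg s τ h0 hτ.1 (hτ.2.trans h')
      have f4 := hdg τ s' (h0.trans hτ.1) hτ.2 h'
      have f5 : 0 ≤ κ * ‖w s' - w τ‖ := by positivity
      have f6 : ‖w τ - w s‖ ≤ (g s' - g s) / κ := by
        rw [le_div_iff₀' hκ]; linarith
      have f7 := mul_le_mul_of_nonneg_left f6 hΛ
      have f8 : η ≤ η₂ := by nlinarith
      have f9 : Λ * ((g s' - g s) / κ) = Λ / κ * (g s' - g s) := by ring
      linarith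
    rw [intervalIntegral.integral_add (hpc.intervalIntegrable_of_Icc h) intervalIntegrable_const,
      hs.integral_power (w s) h0 h (h'.trans ht.2), intervalIntegral.integral_const,
      smul_eq_mul] at e2
    rw [e1]
    simp only [energy] at e2
    linarith
  · have hG0 : G 0 = 0 := by simp [hG]
    have hg0 : 0 ≤ g 0 := mul_nonneg (by positivity) ENNReal.toReal_nonneg
    change x + d t = x₀ + G t at hbal
    have e1 := (abs_le.1 hx').1
    have e2 := (abs_le.1 hx₀').2
    have e3 : η * d t ≤ η * Dm := by gcongr
    rw [hG0]
    simp only [hg, energy] at *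
    linarith

/-- Convergence of energetic solutions of approximating systems to the unique energetic solution
of a quadratic system. -/
theorem convergence [FiniteDimensional ℝ V] {ι : Type*} {l : Filter ι} [l.NeBot]
    {E : ι → V → ℝ → EReal} {D : ι → V → V → ℝ≥0∞}
    (hA : ∀ R η : ℝ, 0 < η → ∀ᶠ i in l, IsApproximation a ℓ c p κ α T η R (E i) (D i))
    {w₀ : ι → V} {z₀ : V} (hw₀ : Tendsto w₀ l (𝓝 z₀)) {w : ι → ℝ → V}
    (hw : ∀ᶠ i in l, IsEnergeticSolution T (E i) (D i) (w₀ i) (w i)) :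
    ∃ (z : ℝ → V) (L C : ℝ), 0 ≤ L ∧ IsQuasistatic a ℓ κ T L C z ∧
      IsEnergeticSolution T (fun v t => (energy a ℓ c v t : EReal)) (normDist κ) z₀ z ∧
      (∀ z' : ℝ → V,
        IsEnergeticSolution T (fun v t => (energy a ℓ c v t : EReal)) (normDist κ) z₀ z' →
          ∀ t ∈ Icc 0 T, z' t = z t) ∧
      ∀ t ∈ Icc 0 T,
        Tendsto (fun i => w i t) l (𝓝 (z t)) ∧
        Tendsto (fun i => diss (D i) t (w i)) l (𝓝 (diss (normDist κ) t z)) ∧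
        Tendsto (fun i => E i (w i t) t) l (𝓝 (energy a ℓ c (z t) t : EReal)) := by
  have hT := hs.pos_T
  have hκ := hs.pos_κ
  have hα := hs.pos_α
  have hΛ := hs.nonneg_Λ
  have h0mem : (0 : ℝ) ∈ Icc 0 T := ⟨le_rfl, hT.le⟩
  obtain ⟨R, hR, hRb⟩ := hs.exists_stable_bound
  have hwR : ∀ᶠ i in l, ∀ t ∈ Icc 0 T, ‖w i t‖ ≤ R := by
    filter_upwards [hw, hA 0 1 one_pos] with i hi hAi t ht
    exact hRb (E i) (D i) hAi t ht _ (hi.stable t ht)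
  -- Stability of the limit initial state is inherited from the approximate stability of the `w₀ i`;
  -- the Euler construction needs it.
  have hz₀ : ∀ v, ℓ 0 v - a z₀ v ≤ κ * ‖v‖ := by
    intro v
    have h1 : ∀ η > 0, ℓ 0 v - a z₀ v ≤ (κ + η) * ‖v‖ := by
      intro η hη
      obtain ⟨η₀, hη₀, h⟩ := hs.exists_approx_stable R hη
      have hcont : Tendsto (fun i => ℓ 0 v - a (w₀ i) v) l (𝓝 (ℓ 0 v - a z₀ v)) :=
        ((by fun_prop : Continuous fun x => ℓ 0 v - a x v).tendsto z₀).comp hw₀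
      refine le_of_tendsto hcont ?_
      filter_upwards [hw, hA (R + 1) η₀ hη₀, hwR] with i hi hAi hRi
      have := h η₀ hη₀.le le_rfl (E i) (D i) hAi 0 h0mem (w i 0) (hi.stable 0 h0mem)
        (hRi 0 h0mem) v
      rwa [hi.init] at this
    have hlim : Tendsto (fun η : ℝ => (κ + η) * ‖v‖) (𝓝[>] 0) (𝓝 ((κ + 0) * ‖v‖)) :=
      ((by fun_prop : Continuous fun η : ℝ => (κ + η) * ‖v‖).tendsto 0).mono_left
        nhdsWithin_le_nhds
    rw [add_zero] at hlim
    exact ge_of_tendsto hlim (by filter_upwards [self_mem_nhdsWithin] with η hη using h1 η hη)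
  obtain ⟨z, L, C, hz0, hL, hz⟩ := hs.exists_quasistatic hz₀
  have hsol := hs.isEnergeticSolution hz
  rw [hz0] at hsol
  have hzR : ∀ t ∈ Icc 0 T, ‖z t‖ ≤ R := fun t ht =>
    hRb _ _ (hs.isApproximation zero_le_one 0) t ht _ (hsol.stable t ht)
  -- The quantification over all approximating systems lets this estimate serve convergence and,
  -- with the limit system itself, uniqueness.
  have hclose : ∀ δ > 0, ∃ η > 0, ∃ ρ > 0, ∀ (E : V → ℝ → EReal) (D : V → V → ℝ≥0∞),
      IsApproximation a ℓ c p κ α T η (R + 1) E D →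
      ∀ (x₀ : V) (x : ℝ → V), IsEnergeticSolution T E D x₀ x → (∀ t ∈ Icc 0 T, ‖x t‖ ≤ R) →
        ‖x₀ - z₀‖ ≤ ρ → ∀ t ∈ Icc 0 T, ‖x t - z t‖ ≤ δ := by
    intro δ hδ
    obtain ⟨η, hη, h⟩ := hs.exists_comparison hL hz (R := R) (η₁ := α * δ ^ 2 / 4) (by positivity)
    set ρ : ℝ := min 1 (α * δ ^ 2 / (2 * (‖a‖ + 1))) with hρ
    have hρ0 : 0 < ρ := by positivity
    refine ⟨η, hη, ρ, hρ0, fun E D hAE x₀ x hx hxR hxρ t ht => ?_⟩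
    have h1 := h E D hAE x₀ x hx hxR t ht
    rw [hx.init, hz0] at h1
    have h2 := hs.coercive (x t - z t)
    have h3 : a (x₀ - z₀) (x₀ - z₀) ≤ α * δ ^ 2 / 2 := by
      calc a (x₀ - z₀) (x₀ - z₀) ≤ ‖a‖ * ‖x₀ - z₀‖ * ‖x₀ - z₀‖ :=
            (Real.le_norm_self _).trans (a.le_opNorm₂ _ _)
        _ ≤ (‖a‖ + 1) * 1 * (α * δ ^ 2 / (2 * (‖a‖ + 1))) := by
            gcongr
            · linarith
            · exact hxρ.trans (min_le_left _ _)
            · exact hxρ.trans (min_le_right _ _)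
        _ = _ := by field_simp
    have h4 : α * ‖x t - z t‖ ^ 2 ≤ α * δ ^ 2 := by linarith
    exact le_of_sq_le_sq (le_of_mul_le_mul_left h4 hα) hδ.le
  have hunif : ∀ δ > 0, ∀ᶠ i in l, ∀ t ∈ Icc 0 T, ‖w i t - z t‖ ≤ δ := by
    intro δ hδ
    obtain ⟨η, hη, ρ, hρ, h⟩ := hclose δ hδ
    have hw₀' : ∀ᶠ i in l, ‖w₀ i - z₀‖ ≤ ρ := by
      have h1 := (tendsto_iff_norm_sub_tendsto_zero.1 hw₀).eventually_lt_const hρ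
      exact h1.mono fun _ => le_of_lt
    filter_upwards [hw, hA (R + 1) η hη, hwR, hw₀'] with i hi hAi hRi hρi
    exact h (E i) (D i) hAi (w₀ i) (w i) hi hRi hρi
  have hEconv : ∀ t ∈ Icc 0 T, ∀ δ > 0, ∀ᶠ i in l, ∃ x : ℝ, E i (w i t) t = x ∧
      |x - energy a ℓ c (z t) t| ≤ δ := by
    intro t ht δ hδ
    have hcont : Continuous fun v => energy a ℓ c v t := by
      unfold energy; fun_prop
    obtain ⟨ρ, hρ, hcρ⟩ := Metric.continuousAt_iff.1 (hcont.continuousAt (x := z t)) (δ / 2)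
      (by positivity)
    filter_upwards [hwR, hA R (δ / 2) (by positivity), hunif (ρ / 2) (by positivity)]
      with i hRi hAi hui
    obtain ⟨x, hx, hx'⟩ := hAi.energy_approx (w i t) (hRi t ht) t ht
    have h1 := hcρ (x := w i t) (by rw [dist_eq_norm]; linarith [hui t ht])
    rw [Real.dist_eq] at h1
    refine ⟨x, hx, ?_⟩
    have h2 := abs_add_le (x - energy a ℓ c (w i t) t) (energy a ℓ c (w i t) t - energy a ℓ c (z t) t)
    rw [sub_add_sub_cancel] at h2
    linarith
  have hpc := hs.power_comp_continuousOn hz.lipschitz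
  have hPconv : ∀ t ∈ Icc 0 T, ∀ δ > 0, ∀ᶠ i in l,
      |(∫ s in (0 : ℝ)..t, power T (E i) (w i s) s) - ∫ s in (0 : ℝ)..t, p (z s) s| ≤ δ := by
    intro t ht δ hδ
    filter_upwards [hw, hwR, hA R (δ / (2 * T)) (by positivity),
      hunif (δ / (2 * T * (Λ + 1))) (by positivity)] with i hi hRi hAi hui
    rw [← intervalIntegral.integral_sub]
    · rw [← Real.norm_eq_abs]
      refine (intervalIntegral.norm_integral_le_of_norm_le_const (C := δ / T) fun s hs' => ?_).trans ?_
      · rw [uIoc_of_le ht.1] at hs'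
        have hsT : s ∈ Icc 0 T := ⟨hs'.1.le, hs'.2.trans ht.2⟩
        have h1 := hAi.power_approx (w i s) (hRi s hsT) s hsT
        have h2 := hs.power_lipschitz s hsT (w i s) (z s)
        have h3 := hui s hsT
        have h4 : Λ * ‖w i s - z s‖ ≤ δ / (2 * T) := by
          calc Λ * ‖w i s - z s‖ ≤ (Λ + 1) * (δ / (2 * T * (Λ + 1))) := by
                gcongr; linarith
            _ = _ := by field_simp
        have h5 := abs_add_le (power T (E i) (w i s) s - p (w i s) s) (p (w i s) s - p (z s) s)
        rw [sub_add_sub_cancel] at h5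
        have h6 : δ / T = δ / (2 * T) + δ / (2 * T) := by field_simp; norm_num
        rw [Real.norm_eq_abs, h6]
        linarith
      · rw [sub_zero, abs_of_nonneg ht.1]
        calc δ / T * t ≤ δ / T * T := by gcongr; exact ht.2
          _ = δ := by field_simp
    · refine hi.power_integrable.mono_set ?_
      rw [uIcc_of_le ht.1, uIcc_of_le hT.le]
      exact Icc_subset_Icc_right ht.2
    · exact (hpc.mono (Icc_subset_Icc_right ht.2)).intervalIntegrable_of_Icc ht.1
  refine ⟨z, L, C, hL, hz, hsol, fun z' hz' t ht => ?_, fun t ht => ⟨?_, ?_, ?_⟩⟩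
  · rw [← sub_eq_zero, ← norm_le_zero_iff]
    refine le_of_forall_pos_le_add fun δ hδ => ?_
    rw [zero_add]
    obtain ⟨η, hη, ρ, hρ, h⟩ := hclose δ hδ
    exact h _ _ (hs.isApproximation hη.le (R + 1)) z₀ z' hz'
      (fun s hs' => hRb _ _ (hs.isApproximation zero_le_one 0) s hs' _ (hz'.stable s hs'))
      (by rw [sub_self, norm_zero]; exact hρ.le) t ht
  · rw [tendsto_iff_norm_sub_tendsto_zero, Metric.tendsto_nhds]
    intro δ hδ
    filter_upwards [hunif (δ / 2) (by positivity)] with i hi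
    rw [Real.dist_eq, sub_zero, abs_of_nonneg (norm_nonneg _)]
    linarith [hi t ht]
  · obtain ⟨hfin, hbal⟩ := hsol.real_balance ht (x := energy a ℓ c (z t) t)
      (x₀ := energy a ℓ c (z 0) 0) rfl rfl
    have hGt : ∫ s in (0 : ℝ)..t, power T (fun v t => (energy a ℓ c v t : EReal)) (z s) s
        = ∫ s in (0 : ℝ)..t, p (z s) s := by
      refine intervalIntegral.integral_congr fun s hs' => ?_
      rw [uIcc_of_le ht.1] at hs'
      exact hs.power_eq (z s) ⟨hs'.1, hs'.2.trans ht.2⟩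
    rw [hGt] at hbal
    have hev : ∀ δ > 0, ∀ᶠ i in l, diss (D i) t (w i) ≠ ⊤ ∧
        |(diss (D i) t (w i)).toReal - (diss (normDist κ) t z).toReal| ≤ δ := by
      intro δ hδ
      -- The dissipation is the only remaining term of the energy balance; the final energy, initial
      -- energy and work each contribute `δ / 3`.
      filter_upwards [hw, hEconv t ht (δ / 3) (by positivity), hEconv 0 h0mem (δ / 3) (by positivity),
        hPconv t ht (δ / 3) (by positivity)] with i hi ⟨x, hx, hx'⟩ ⟨x₀, hx₀, hx₀'⟩ hP
      obtain ⟨hfi, hbi⟩ := hi.real_balance ht hx hx₀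
      refine ⟨hfi, ?_⟩
      rw [abs_le] at *
      constructor <;> linarith
    have hreal : Tendsto (fun i => (diss (D i) t (w i)).toReal) l
        (𝓝 (diss (normDist κ) t z).toReal) := by
      rw [Metric.tendsto_nhds]
      intro δ hδ
      filter_upwards [hev (δ / 2) (by positivity)] with i hi
      rw [Real.dist_eq]
      linarith [hi.2]
    rw [← ENNReal.ofReal_toReal hfin]
    refine (ENNReal.tendsto_ofReal hreal).congr' ?_
    filter_upwards [hev 1 one_pos] with i hi
    exact ENNReal.ofReal_toReal hi.1
  · have hreal : Tendsto (fun i => (E i (w i t) t).toReal) l (𝓝 (energy a ℓ c (z t) t)) := by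
      rw [Metric.tendsto_nhds]
      intro δ hδ
      filter_upwards [hEconv t ht (δ / 2) (by positivity)] with i ⟨x, hx, hx'⟩
      rw [Real.dist_eq, hx, EReal.toReal_coe]
      linarith
    refine ((continuous_coe_real_ereal.tendsto _).comp hreal).congr' ?_
    filter_upwards [hEconv t ht 1 one_pos] with i ⟨x, hx, _⟩
    rw [Function.comp_apply, hx, EReal.toReal_coe]

end IsQuadraticSystem

end Convergence

/-! ### The differential inclusion -/

section StrongSolution

variable {V : Type*} [NormedAddCommGroup V] [NormedSpace ℝ V]
variable {a : V →L[ℝ] V →L[ℝ] ℝ} {ℓ : ℝ → V →L[ℝ] ℝ} {κ T L C : ℝ} {z : ℝ → V}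

theorem IsQuasistatic.lipschitzOnWith (hL : 0 ≤ L) (hz : IsQuasistatic a ℓ κ T L C z) :
    LipschitzOnWith L.toNNReal z (Icc 0 T) := by
  refine LipschitzOnWith.of_dist_le_mul fun s hs s' hs' => ?_
  rw [Real.coe_toNNReal L hL]
  rcases le_total s s' with h | h
  · rw [dist_comm, dist_eq_norm, dist_comm s, Real.dist_eq, abs_of_nonneg (sub_nonneg.2 h)]
    exact hz.lipschitz s s' hs.1 h hs'.2
  · rw [dist_eq_norm, Real.dist_eq, abs_of_nonneg (sub_nonneg.2 h)]
    exact hz.lipschitz s' s hs'.1 h hs.2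

/-- Dividing the flow inequality by the time step gives `κ ‖v‖ ≤ (ℓ t - a (z t)) v`; subtracting it
from stability tested with `w` is the subdifferential inequality. -/
theorem IsQuasistatic.inclusion (hz : IsQuasistatic a ℓ κ T L C z) {t : ℝ} (ht : t ∈ Ioo 0 T)
    {v : V} (hv : HasDerivAt z v t) (w : V) :
    (ℓ t - a (z t)) (w - v) ≤ κ * ‖w‖ - κ * ‖v‖ := by
  have hflow : κ * ‖v‖ ≤ (ℓ t - a (z t)) v := by
    have hd : Tendsto (fun h : ℝ => h⁻¹ • (z (t + h) - z t)) (𝓝[>] 0) (𝓝 v) :=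
      (hasDerivAt_iff_tendsto_slope_zero.1 hv).mono_left (nhdsGT_le_nhdsNE 0)
    have hC : Tendsto (fun h : ℝ => C * h) (𝓝[>] 0) (𝓝 0) := by
      have : Tendsto (fun h : ℝ => C * h) (𝓝 0) (𝓝 (C * 0)) := tendsto_id.const_mul C
      rw [mul_zero] at this
      exact this.mono_left nhdsWithin_le_nhds
    have h1 := (((ℓ t - a (z t)).continuous.tendsto v).comp hd).add hC
    rw [add_zero] at h1
    refine le_of_tendsto_of_tendsto (hd.norm.const_mul κ) h1 ?_
    filter_upwards [Ioo_mem_nhdsGT (sub_pos.2 ht.2)] with h hh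
    have h2 := hz.flow t (t + h) ht.1.le (by linarith [hh.1]) (by linarith [hh.2])
    have hi : 0 < h⁻¹ := inv_pos.2 hh.1
    have h3 := mul_le_mul_of_nonneg_left h2 hi.le
    simp only [Function.comp_apply, map_smul, smul_eq_mul, norm_smul, sub_apply, Real.norm_eq_abs,
      abs_of_pos hi]
    have h4 : h⁻¹ * h = 1 := inv_mul_cancel₀ hh.1.ne'
    have h5 : h⁻¹ * (C * (t + h - t) ^ 2) = C * h := by
      rw [add_sub_cancel_left]
      linear_combination C * h * h4
    linarith
  have hst := hz.stable t ht.1.le ht.2.le w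
  rw [map_sub]
  have : (ℓ t - a (z t)) w ≤ κ * ‖w‖ := hst
  linarith

/-- Rademacher's theorem supplies the derivative; the endpoints form a null set. -/
theorem IsQuasistatic.ae_inclusion [FiniteDimensional ℝ V] (hL : 0 ≤ L)
    (hz : IsQuasistatic a ℓ κ T L C z) :
    ∀ᵐ t ∂(volume.restrict (Icc 0 T)), ∃ v, HasDerivAt z v t ∧
      ∀ w, (ℓ t - a (z t)) (w - v) ≤ κ * ‖w‖ - κ * ‖v‖ := by
  rw [restrict_Ioo_eq_restrict_Icc.symm, ae_restrict_iff' measurableSet_Ioo]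
  filter_upwards [(hz.lipschitzOnWith hL).ae_differentiableWithinAt_of_mem] with t h ht
  have hd := (h (Ioo_subset_Icc_self ht)).differentiableAt (Icc_mem_nhds ht.1 ht.2)
  exact ⟨_, hd.hasDerivAt, hz.inclusion ht hd.hasDerivAt⟩

end StrongSolution

/-! ### Linearized and finite plasticity as instances of the abstract setting -/

section Concrete

variable {T : ℝ} {e : ℝ → Mat}

/-- Transposition is linear and continuous, and derivatives within the interval are unique. -/
theorem derivWithin_isSymm (hT : 0 < T) (he_symm : ∀ t ∈ Icc 0 T, (e t).IsSymm)
    (he : DifferentiableOn ℝ e (Icc 0 T)) {t : ℝ} (ht : t ∈ Icc 0 T) :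
    (derivWithin e (Icc 0 T) t).IsSymm := by
  have hd : HasDerivWithinAt e (derivWithin e (Icc 0 T) t) (Icc 0 T) t :=
    (he t ht).hasDerivWithinAt
  set τ : Mat →L[ℝ] Mat := LinearMap.toContinuousLinearMap
    (Matrix.transposeLinearEquiv (Fin 3) (Fin 3) ℝ ℝ).toLinearMap with hτ
  have h1 : HasDerivWithinAt (fun s => τ (e s)) (τ (derivWithin e (Icc 0 T) t)) (Icc 0 T) t :=
    τ.hasFDerivAt.comp_hasDerivWithinAt t hd
  have h2 : HasDerivWithinAt e (τ (derivWithin e (Icc 0 T) t)) (Icc 0 T) t :=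
    h1.congr (fun s hs => (he_symm s hs).symm) (he_symm t ht).symm
  exact (uniqueDiffOn_Icc hT t ht).eq_deriv _ h2 hd

/-- The bilinear form of linearized plasticity on deviatoric tensors. -/
noncomputable def hardeningForm (CC HH : Tensor4) : Dev →L[ℝ] Dev →L[ℝ] ℝ :=
  (exists_continuous_bilinear ((CC.form + HH.form).compl₁₂ Dev.subtype Dev.subtype)).choose

theorem hardeningForm_apply (CC HH : Tensor4) (u v : Dev) :
    hardeningForm CC HH u v = CC.form u v + HH.form u v :=
  (exists_continuous_bilinear ((CC.form + HH.form).compl₁₂ Dev.subtype Dev.subtype)).choose_spec u v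

/-- The loading induced by a strain tensor. -/
noncomputable def loading (CC : Tensor4) (A : Mat) : Dev →L[ℝ] ℝ :=
  LinearMap.toContinuousLinearMap ((CC.form A).comp Dev.subtype)

theorem loading_apply (CC : Tensor4) (A : Mat) (v : Dev) : loading CC A v = CC.form A v := rfl

theorem energy_eq_W0 {CC : Tensor4} (hCC : CC.IsSymm) (HH : Tensor4) (e : ℝ → Mat) (v : Dev)
    (t : ℝ) :
    energy (hardeningForm CC HH) (fun t => loading CC (e t))
      (fun t => 1 / 2 * CC.form (e t) (e t)) v t = W0 CC HH (e t) v := by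
  rw [W0_eq]
  change 1 / 2 * hardeningForm CC HH v v - loading CC (e t) v + 1 / 2 * CC.form (e t) (e t) = _
  rw [hardeningForm_apply, loading_apply]
  simp only [map_sub, LinearMap.sub_apply]
  rw [Tensor4.form_symm hCC (v : Mat) (e t)]
  ring

theorem hasDerivWithinAt_W0 {CC : Tensor4} (hCC : CC.IsSymm) (HH : Tensor4) {S : Set ℝ} {t : ℝ}
    {e' : Mat} (he : HasDerivWithinAt e e' S t) (z : Mat) :
    HasDerivWithinAt (fun s => W0 CC HH (e s) z) (CC.form (e t - z) e') S t := by
  obtain ⟨b, hb⟩ := exists_continuous_bilinear CC.form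
  have h1 : HasDerivWithinAt (fun s => e s - z) e' S t := he.sub_const z
  have h2 := b.hasFDerivWithinAt_of_bilinear h1.hasFDerivWithinAt h1.hasFDerivWithinAt
  have h3 := (h2.hasDerivWithinAt.const_mul (1 / 2)).add_const (1 / 2 * HH.form z z)
  refine (h3.congr_deriv ?_).congr (fun s _ => by rw [W0_eq, hb]) (by rw [W0_eq, hb])
  change 1 / 2 * (b (e t - z) ((1 : ℝ) • e') + b ((1 : ℝ) • e') (e t - z)) = _
  rw [one_smul, hb, hb, Tensor4.form_symm hCC e' (e t - z)]
  ring

theorem exists_strain_bound (hT : 0 < T) (he : ContDiffOn ℝ 1 e (Icc 0 T)) :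
    ∃ M, 0 < M ∧ ∀ t ∈ Icc 0 T, ‖e t‖ ≤ M ∧ ‖derivWithin e (Icc 0 T) t‖ ≤ M := by
  obtain ⟨M₁, h1⟩ := isCompact_Icc.exists_bound_of_continuousOn he.continuousOn
  obtain ⟨M₂, h2⟩ := isCompact_Icc.exists_bound_of_continuousOn
    (he.continuousOn_derivWithin (uniqueDiffOn_Icc hT) le_rfl)
  refine ⟨max 1 (max M₁ M₂), by positivity, fun t ht => ⟨?_, ?_⟩⟩
  · exact (h1 t ht).trans ((le_max_left _ _).trans (le_max_right _ _))
  · exact (h2 t ht).trans ((le_max_right _ _).trans (le_max_right _ _))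

/-- Coercivity comes from hardening alone, as `ℂ` is only nonnegative; `Λ` is a bound for `ℂ` times
a bound for the strain rate. -/
theorem isQuadraticSystem_linearized {CC HH : Tensor4} (hCC : CC.IsSymm) (hHH : HH.IsSymm)
    (hCC0 : ∀ A : Mat, A.IsSymm → 0 ≤ CC.form A A) {c₃ : ℝ} (hc₃ : 0 < c₃)
    (hHH0 : ∀ A ∈ Dev, c₃ * ‖A‖ ^ 2 ≤ HH.form A A) {r : ℝ} (hr : 0 < r) (hT : 0 < T)
    (he_symm : ∀ t ∈ Icc 0 T, (e t).IsSymm) (he : ContDiffOn ℝ 1 e (Icc 0 T)) :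
    ∃ Λ, IsQuadraticSystem (hardeningForm CC HH) (fun t => loading CC (e t))
      (fun t => 1 / 2 * CC.form (e t) (e t))
      (fun v t => CC.form (e t - v) (derivWithin e (Icc 0 T) t)) (r / 2) c₃ Λ T := by
  obtain ⟨M, hM, hMb⟩ := exists_strain_bound hT he
  obtain ⟨K, hK, hKb⟩ := exists_bilinear_bound CC.form
  refine ⟨K * M, ⟨?_, half_pos hr, hc₃, hT, by positivity, ?_, ?_, ?_, ?_, ?_⟩⟩
  · intro u v
    refine (hardeningForm_apply CC HH u v).trans (.trans ?_ (hardeningForm_apply CC HH v u).symm)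
    rw [Tensor4.form_symm hCC, Tensor4.form_symm hHH]
  · intro v
    refine le_of_le_of_eq ?_ (hardeningForm_apply CC HH v v).symm
    rw [← norm_coe_dev]
    linarith [hCC0 v v.2.1, hHH0 v v.2]
  · intro v t ht
    rw [energy_eq_W0 hCC, W0_eq, ← norm_coe_dev]
    linarith [hCC0 (e t - v) ((he_symm t ht).sub v.2.1), hHH0 v v.2]
  · intro v t ht
    rw [show energy (hardeningForm CC HH) (fun t => loading CC (e t))
      (fun t => 1 / 2 * CC.form (e t) (e t)) v = fun t => W0 CC HH (e t) v from
      funext fun t => energy_eq_W0 hCC HH e v t]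
    exact hasDerivWithinAt_W0 hCC HH (he.differentiableOn one_ne_zero t ht).hasDerivWithinAt v
  · intro v
    obtain ⟨b, hb⟩ := exists_continuous_bilinear CC.form
    simp only [← hb]
    exact b.isBoundedBilinearMap.continuous.comp_continuousOn
      ((he.continuousOn.sub continuousOn_const).prodMk
        (he.continuousOn_derivWithin (uniqueDiffOn_Icc hT) le_rfl))
  · intro t ht v w
    rw [← LinearMap.sub_apply, ← map_sub, sub_sub_sub_cancel_left, norm_sub_rev v w]
    refine (hKb _ _).trans ?_
    rw [mul_right_comm]
    exact mul_le_mul_of_nonneg_right (mul_le_mul_of_nonneg_left (hMb t ht).2 hK) (norm_nonneg _)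

/-- On bounded sets, finite plasticity is close to linearized plasticity for small strains. -/
theorem exists_isApproximation {We : Mat → ℝ} {Wp : Mat → ℝ≥0∞} {CC HH : Tensor4} (hCC : CC.IsSymm)
    (hWe_nonneg : ∀ F ∈ GLPos, 0 ≤ We F) (hWe_C1 : ContDiffOn ℝ 1 We GLPos)
    (hWe_diff2 : DifferentiableAt ℝ (fderiv ℝ We) 1)
    {c₃ : ℝ} (hc₃ : 0 < c₃)
    (hcoer : ∀ A ∈ Dev,
      ENNReal.ofReal (c₃ * ‖A‖ ^ 2) ≤ hatWp Wp (NormedSpace.exp ((2 : ℝ) • A)))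
    (hquad_e : ∀ δ > 0, ∃ c > 0, ∀ A : Mat, A.IsSymm → ‖A‖ ≤ c →
      |hatWe We (1 + (2 : ℝ) • A) - 1 / 2 * CC.quad A| ≤ δ * ‖A‖ ^ 2)
    (hquad_p : ∀ δ > 0, ∃ c > 0, ∀ A ∈ Dev, ‖A‖ ≤ c →
      hatWp Wp (NormedSpace.exp ((2 : ℝ) • A)) ≠ ⊤ ∧
      |(hatWp Wp (NormedSpace.exp ((2 : ℝ) • A))).toReal - 1 / 2 * HH.quad A| ≤ δ * ‖A‖ ^ 2)
    {r : ℝ} (hr : 0 < r) (hT : 0 < T)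
    (he_symm : ∀ t ∈ Icc 0 T, (e t).IsSymm) (he : ContDiffOn ℝ 1 e (Icc 0 T))
    (R : ℝ) {η : ℝ} (hη : 0 < η) :
    ∃ ε₀ > 0, ∀ ε, 0 < ε → ε < ε₀ →
      IsApproximation (hardeningForm CC HH) (fun t => loading CC (e t))
        (fun t => 1 / 2 * CC.form (e t) (e t))
        (fun v t => CC.form (e t - v) (derivWithin e (Icc 0 T) t)) (r / 2) c₃ T η R
        (Eeps We Wp e ε) (Deps r ε) := by
  obtain ⟨M, hM, hMb⟩ := exists_strain_bound hT he
  have hM' : 0 < max M R := lt_max_of_lt_left hM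
  obtain ⟨ε₁, hε₁, h1⟩ :=
    exists_Weps_approx hCC hWe_nonneg hWe_C1 hWe_diff2 hquad_e hquad_p hM' hη
  obtain ⟨ε₂, hε₂, h2⟩ :=
    exists_power_approx hCC hWe_nonneg hWe_C1 hWe_diff2 hquad_e hquad_p hM' hη
  obtain ⟨ε₃, hε₃, h3⟩ := exists_Deps_bounds r hr.le R hη
  refine ⟨min ε₁ (min ε₂ ε₃), by positivity, fun ε hε hlt => ?_⟩
  rw [lt_min_iff, lt_min_iff] at hlt
  refine ⟨?_, fun v => Deps_zero_le hε v, ?_, fun v w hv hw => (h3 ε hε hlt.2.2 v w hv hw).1,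
    fun v w hv hw => (h3 ε hε hlt.2.2 v w hv hw).2, ?_⟩
  · intro v t _
    have h4 := Weps_coercive (We := We) hcoer hε (e t) v.2
    rw [norm_coe_dev] at h4
    have h5 : ((ENNReal.ofReal (c₃ * ‖v‖ ^ 2) : ℝ≥0∞) : EReal) ≤ Eeps We Wp e ε v t :=
      EReal.coe_ennreal_le_coe_ennreal_iff.2 h4
    refine le_trans ?_ h5
    rw [EReal.coe_ennreal_ofReal, EReal.coe_le_coe_iff]
    refine le_trans ?_ (le_max_left _ _)
    have : 0 ≤ c₃ * ‖v‖ ^ 2 := by positivity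
    linarith
  · intro v hv t ht
    have h4 := h1 ε hε hlt.1 v v.2 (hv.trans (le_max_right _ _)) (e t) (he_symm t ht)
      ((hMb t ht).1.trans (le_max_left _ _))
    refine ⟨(Weps We Wp ε (e t) v).toReal, (EReal.coe_toReal ?_ ?_).symm.trans ?_, ?_⟩
    · exact fun h => h4.1 (EReal.coe_ennreal_eq_top_iff.1 h)
    · exact EReal.coe_ennreal_ne_bot _
    · rw [Eeps, EReal.toReal_coe_ennreal]
    · rw [energy_eq_W0 hCC]
      exact h4.2
  · intro v hv t ht
    have hd := he.differentiableOn one_ne_zero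
    obtain ⟨q, hq, hq'⟩ := h2 ε hε hlt.2.1 v v.2 (hv.trans (le_max_right _ _)) (Icc 0 T) e
      (derivWithin e (Icc 0 T) t) he_symm (fun s hs => (hMb s hs).1.trans (le_max_left _ _)) t ht
      (hd t ht).hasDerivWithinAt (derivWithin_isSymm hT he_symm hd ht)
      ((hMb t ht).2.trans (le_max_left _ _))
    have hpow : power T (Eeps We Wp e ε) v t = q := by
      refine HasDerivWithinAt.derivWithin ?_ (uniqueDiffOn_Icc hT t ht)
      simpa only [Eeps, EReal.toReal_coe_ennreal] using hq
    rw [hpow]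
    exact hq'

theorem isStrongSolution_of_isQuasistatic {CC HH : Tensor4} {r L C : ℝ} {z : ℝ → Dev} (hL : 0 ≤ L)
    (hz : IsQuasistatic (hardeningForm CC HH) (fun t => loading CC (e t)) (r / 2) T L C z) :
    IsStrongSolution T r CC HH e (z 0) z := by
  refine ⟨rfl, ⟨_, hz.lipschitzOnWith hL⟩, ?_⟩
  filter_upwards [hz.ae_inclusion hL] with t ⟨v, hv, hvw⟩
  refine ⟨v, hv, fun w => ?_⟩
  refine le_of_eq_of_le ?_ (hvw w)
  change _ = loading CC (e t) (w - v) - hardeningForm CC HH (z t) (w - v)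
  rw [loading_apply, hardeningForm_apply]
  simp only [Tensor4.form_apply, contr, Matrix.sub_apply, Matrix.add_apply, sub_mul, add_mul,
    Finset.sum_sub_distrib, Finset.sum_add_distrib]
  rfl

end Concrete

end Plasticity

theorem theorem5p1
    (T : ℝ) (hT : 0 < T) (r : ℝ) (hr : 0 < r)
    -- elastic energy density on matrices with positive determinant
    (We : Plasticity.Mat → ℝ)
    (hWe_nonneg : ∀ F ∈ Plasticity.GLPos, 0 ≤ We F)
    (hWe_C1 : ContDiffOn ℝ 1 We Plasticity.GLPos)
    (hWe_frame : ∀ R ∈ Plasticity.SO, ∀ F ∈ Plasticity.GLPos, We (R * F) = We F)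
    (hWe_iso : ∀ Q ∈ Plasticity.SO, ∀ F ∈ Plasticity.GLPos, We (F * Q) = We F)
    -- twice differentiability at the identity
    (hWe_diff2 : DifferentiableAt ℝ (fderiv ℝ We) 1)
    -- plastic energy density on matrices with determinant one
    (Wp : Plasticity.Mat → ℝ≥0∞)
    (hWp_inv : ∀ Q ∈ Plasticity.SO, ∀ P ∈ Plasticity.SL, Wp (Q * P) = Wp P)
    -- elasticity and hardening tensors
    (CC HH : Plasticity.Tensor4) (hCC : CC.IsSymm) (hHH : HH.IsSymm)
    -- coercivity
    (c₃ : ℝ) (hc₃ : 0 < c₃)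
    (hcoer : ∀ A ∈ Plasticity.Dev,
      ENNReal.ofReal (c₃ * ‖A‖ ^ 2) ≤ Plasticity.hatWp Wp (NormedSpace.exp ((2 : ℝ) • A)))
    -- quadratic behaviour at the identity
    (hquad_e : ∀ δ > 0, ∃ c > 0, ∀ A : Plasticity.Mat, A.IsSymm → ‖A‖ ≤ c →
      |Plasticity.hatWe We (1 + (2 : ℝ) • A) - 1 / 2 * CC.quad A| ≤ δ * ‖A‖ ^ 2)
    (hquad_p : ∀ δ > 0, ∃ c > 0, ∀ A ∈ Plasticity.Dev, ‖A‖ ≤ c →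
      Plasticity.hatWp Wp (NormedSpace.exp ((2 : ℝ) • A)) ≠ ⊤ ∧
      |(Plasticity.hatWp Wp (NormedSpace.exp ((2 : ℝ) • A))).toReal - 1 / 2 * HH.quad A|
        ≤ δ * ‖A‖ ^ 2)
    -- prescribed rescaled strain
    (e : ℝ → Plasticity.Mat) (he_symm : ∀ t ∈ Icc 0 T, (e t).IsSymm)
    (he_C1 : ContDiffOn ℝ 1 e (Icc 0 T))
    -- a family (or sequence) of positive parameters tending to zero
    {ι : Type*} (l : Filter ι) [l.NeBot] [l.IsCountablyGenerated]
    (ε : ι → ℝ) (hε : Tendsto ε l (𝓝[>] 0))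
    -- stable, well-prepared initial data
    (z₀ε : ι → Plasticity.Dev) (z₀ : Plasticity.Dev)
    (hstable : ∀ᶠ i in l, z₀ε i ∈ Plasticity.stableStates
      (Plasticity.Eeps We Wp e (ε i)) (Plasticity.Deps r (ε i)) 0)
    (hz₀ : Tendsto z₀ε l (𝓝 z₀))
    (hE₀ : Tendsto (fun i => Plasticity.Eeps We Wp e (ε i) (z₀ε i) 0) l
      (𝓝 (Plasticity.E0 CC HH e z₀ 0)))
    -- finite-plasticity trajectories
    (zε : ι → ℝ → Plasticity.Dev)
    (hzε : ∀ᶠ i in l, Plasticity.IsEnergeticSolution T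
      (Plasticity.Eeps We Wp e (ε i)) (Plasticity.Deps r (ε i)) (z₀ε i) (zε i)) :
    ∃ z : ℝ → Plasticity.Dev,
      -- `z` is the unique linearized-plasticity trajectory starting from `z₀`
      Plasticity.IsEnergeticSolution T (Plasticity.E0 CC HH e) (Plasticity.D0 r) z₀ z ∧
      (∀ z' : ℝ → Plasticity.Dev,
        Plasticity.IsEnergeticSolution T (Plasticity.E0 CC HH e) (Plasticity.D0 r) z₀ z' →
          ∀ t ∈ Icc 0 T, z' t = z t) ∧
      Plasticity.IsStrongSolution T r CC HH e z₀ z ∧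
      -- convergence of trajectories, dissipations and energies
      ∀ t ∈ Icc 0 T,
        Tendsto (fun i => zε i t) l (𝓝 (z t)) ∧
        Tendsto (fun i => Plasticity.diss (Plasticity.Deps r (ε i)) t (zε i)) l
          (𝓝 (Plasticity.diss (Plasticity.D0 r) t z)) ∧
        Tendsto (fun i => Plasticity.Eeps We Wp e (ε i) (zε i t) t) l
          (𝓝 (Plasticity.E0 CC HH e (z t) t)) := by
  have hCC0 : ∀ A : Plasticity.Mat, A.IsSymm → 0 ≤ CC.form A A := fun A hA =>
    Plasticity.CC_form_nonneg hCC hWe_nonneg hWe_C1 hWe_diff2 hquad_e hA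
  have hHH0 : ∀ A ∈ Plasticity.Dev, c₃ * ‖A‖ ^ 2 ≤ HH.form A A := fun A hA =>
    Plasticity.HH_form_coercive hc₃ hcoer hquad_p hA
  obtain ⟨Λ, hs⟩ :=
    Plasticity.isQuadraticSystem_linearized hCC hHH hCC0 hc₃ hHH0 hr hT he_symm he_C1
  obtain ⟨z, L, C, hL, hq, hz, huniq, hconv⟩ := hs.convergence (l := l)
    (E := fun i => Plasticity.Eeps We Wp e (ε i)) (D := fun i => Plasticity.Deps r (ε i))
    (fun R η hη => by
      obtain ⟨ε₀, hε₀, h⟩ := Plasticity.exists_isApproximation hCC hWe_nonneg hWe_C1 hWe_diff2 hc₃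
        hcoer hquad_e hquad_p hr hT he_symm he_C1 R hη
      -- The one-sided limit of the parameters places them eventually in `(0, ε₀)`.
      filter_upwards [hε (Ioo_mem_nhdsGT hε₀)] with i hi
      exact h (ε i) hi.1 hi.2) hz₀ hzε
  have hE : (fun (v : Plasticity.Dev) t =>
      ((Plasticity.energy (Plasticity.hardeningForm CC HH) (fun t => Plasticity.loading CC (e t))
        (fun t => 1 / 2 * CC.form (e t) (e t)) v t : ℝ) : EReal)) = Plasticity.E0 CC HH e := by
    funext v t
    rw [Plasticity.energy_eq_W0 hCC, Plasticity.E0]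
  have hD : (Plasticity.normDist (r / 2) : Plasticity.Dev → Plasticity.Dev → ℝ≥0∞)
      = Plasticity.D0 r := by
    funext v w
    rw [Plasticity.D0_eq, Plasticity.normDist]
  rw [hE, hD] at hz huniq
  rw [hD] at hconv
  have hinit := Plasticity.isStrongSolution_of_isQuasistatic hL hq
  rw [hz.init] at hinit
  refine ⟨z, hz, huniq, hinit, fun t ht => ?_⟩
  obtain ⟨h1, h2, h3⟩ := hconv t ht
  refine ⟨h1, h2, ?_⟩
  rwa [Plasticity.energy_eq_W0 hCC] at h3
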